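/- A \emph{partial cube} is an undirected graph $G$ whose vertices can be labeled by bitvectors of some common finite length $d$ such that the distance in $G$ between any two vertices equals the Hamming distance between their labels (equivalently, $G$ embeds isometrically into a hypercube; in particular $G$ is connected); such a labeling is called \emph{valid}. The cost model is a RAM whose words are $w$-bit integers. A program is fixed independently of $w$ and of the input. It uses finitely many one-word registers and finitely many tables of words; a table cell is addressed by a pair of words. Constants, register accesses, addition and subtraction modulo $2^w$, bitwise Boolean operations, comparisons and table accesses cost one step each. The input, a simple undirected graph $G$ on the vertices $0,\dots,n-1$, is given by $n$ in a register and the adjacency matrix of $G$ in a table; all other memory is initially zero. \textbf{Theorem.} There are a program $P$ and a constant $C$ such that for every $n\ge 0$, every simple undirected graph $G$ with $n$ vertices, and every word size $w\ge 1$ with $2^w>n$ (words of about $\log_2 n$ bits or more), the program $P$ on input $G$ halts within $C(n^2+1)$ steps, i.e. in time $O(n^2)$, and correctly decides whether $G$ is a partial cube (final answer $1$ or $0$ in a register). If $G$ is a partial cube, then $P$ also outputs a valid labeling of $G$: the length $d$ of the labels in a register, and the bits of the labels in a table, with bit $i$ of the label of vertex $v$ in cell $(v,i)$. -/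

import Mathlib

/-! ### Partial cubes -/

/-- `label` assigns to every vertex a bitvector of length `d` in such a way that the distance of any
two vertices equals the Hamming distance of their bitvectors. The distance is the extended one
(`⊤` between different components), so a labeled graph is connected. -/
def IsPartialCubeLabeling {V : Type*} (G : SimpleGraph V) {d : ℕ} (label : V → Fin d → Bool) :
    Prop :=
  ∀ u v : V, G.edist u v = (hammingDist (label u) (label v) : ℕ∞)

/-- A partial cube: a graph that embeds isometrically into a hypercube `{0,1}^d`. -/
def IsPartialCube {V : Type*} (G : SimpleGraph V) : Prop :=
  ∃ (d : ℕ) (label : V → Fin d → Bool), IsPartialCubeLabeling G label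

/-! ### The word RAM

A machine word is an element of `BitVec w`. A program has registers, each holding one word, and
tables, whose cells hold one word each and are indexed by pairs of words. (Two index words are
needed to address `n ^ 2` cells when a word has only about `log n` bits.) A program names finitely
many registers and tables; it depends neither on the word size `w` nor on the input. Every constant,
register access, arithmetic or bitwise operation, comparison, and table access costs one step. There
are no multiplication and shift instructions. -/

namespace WordRAM

/-- Operations on words: addition and subtraction modulo `2 ^ w`, and bitwise operations. -/
inductive BinOp where
  | add | sub | and | or | xor

/-- Expressions whose value is a word. -/
inductive Expr where
  /-- the number `k` modulo `2 ^ w` -/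
  | const (k : ℕ)
  /-- the content of register `r` -/
  | reg (r : ℕ)
  /-- an operation on two words -/
  | op (o : BinOp) (a b : Expr)
  /-- the content of cell `(i, j)` of table `T` -/
  | load (T : ℕ) (i j : Expr)

/-- Tests. -/
inductive Test where
  /-- equality of words -/
  | eq (a b : Expr)
  /-- unsigned comparison of words -/
  | lt (a b : Expr)
  | not (c : Test)
  | and (c d : Test)

/-- Programs. -/
inductive Prog where
  /-- do nothing -/
  | nop
  /-- put the value of `e` into register `r` -/
  | assign (r : ℕ) (e : Expr)
  /-- put the value of `e` into cell `(i, j)` of table `T` -/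
  | store (T : ℕ) (i j e : Expr)
  /-- first `p`, then `q` -/
  | seq (p q : Prog)
  /-- if `c` then `p` else `q` -/
  | branch (c : Test) (p q : Prog)
  /-- while `c` do `p` -/
  | loop (c : Test) (p : Prog)

/-- The state of a machine with `w`-bit words: the contents of its registers and tables. -/
@[ext] structure State (w : ℕ) where
  reg : ℕ → BitVec w
  table : ℕ → BitVec w → BitVec w → BitVec w

variable {w : ℕ}

/-- Put `x` into register `r`. -/
def State.setReg (σ : State w) (r : ℕ) (x : BitVec w) : State w where
  reg := Function.update σ.reg r x
  table := σ.table

/-- Put `x` into cell `(i, j)` of table `T`. -/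
def State.setCell (σ : State w) (T : ℕ) (i j x : BitVec w) : State w where
  reg := σ.reg
  table := Function.update σ.table T
    (Function.update (σ.table T) i (Function.update (σ.table T i) j x))

def BinOp.eval : BinOp → BitVec w → BitVec w → BitVec w
  | .add, x, y => x + y
  | .sub, x, y => x - y
  | .and, x, y => x &&& y
  | .or, x, y => x ||| y
  | .xor, x, y => x ^^^ y

def Expr.eval (σ : State w) : Expr → BitVec w
  | .const k => BitVec.ofNat w k
  | .reg r => σ.reg r
  | .op o a b => o.eval (a.eval σ) (b.eval σ)
  | .load T i j => σ.table T (i.eval σ) (j.eval σ)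

/-- The number of steps in which an expression is evaluated. -/
def Expr.cost : Expr → ℕ
  | .const _ => 1
  | .reg _ => 1
  | .op _ a b => a.cost + b.cost + 1
  | .load _ i j => i.cost + j.cost + 1

def Test.eval (σ : State w) : Test → Bool
  | .eq a b => decide (a.eval σ = b.eval σ)
  | .lt a b => decide (a.eval σ < b.eval σ)
  | .not c => !c.eval σ
  | .and c d => c.eval σ && d.eval σ

/-- The number of steps in which a test is evaluated. -/
def Test.cost : Test → ℕ
  | .eq a b => a.cost + b.cost + 1
  | .lt a b => a.cost + b.cost + 1
  | .not c => c.cost + 1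
  | .and c d => c.cost + d.cost + 1

/-- `Runs p σ τ t`: started in state `σ`, the program `p` halts in state `τ` after `t` steps. -/
inductive Runs : Prog → State w → State w → ℕ → Prop
  | nop (σ : State w) : Runs .nop σ σ 0
  | assign (r : ℕ) (e : Expr) (σ : State w) :
      Runs (.assign r e) σ (σ.setReg r (e.eval σ)) (e.cost + 1)
  | store (T : ℕ) (i j e : Expr) (σ : State w) :
      Runs (.store T i j e) σ (σ.setCell T (i.eval σ) (j.eval σ) (e.eval σ))
        (i.cost + j.cost + e.cost + 1)
  | seq {p q : Prog} {σ σ' σ'' : State w} {t t' : ℕ} :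
      Runs p σ σ' t → Runs q σ' σ'' t' → Runs (.seq p q) σ σ'' (t + t')
  | branch_true {c : Test} {p : Prog} (q : Prog) {σ σ' : State w} {t : ℕ} :
      c.eval σ = true → Runs p σ σ' t → Runs (.branch c p q) σ σ' (c.cost + t)
  | branch_false {c : Test} (p : Prog) {q : Prog} {σ σ' : State w} {t : ℕ} :
      c.eval σ = false → Runs q σ σ' t → Runs (.branch c p q) σ σ' (c.cost + t)
  | loop_true {c : Test} {p : Prog} {σ σ' σ'' : State w} {t t' : ℕ} :
      c.eval σ = true → Runs p σ σ' t → Runs (.loop c p) σ' σ'' t' →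
      Runs (.loop c p) σ σ'' (c.cost + t + t')
  | loop_false {c : Test} (p : Prog) {σ : State w} :
      c.eval σ = false → Runs (.loop c p) σ σ c.cost

/-- The machine is deterministic: a program that halts has only one run. -/
theorem Runs.unique {p : Prog} {σ τ τ' : State w} {t t' : ℕ} (h : Runs p σ τ t)
    (h' : Runs p σ τ' t') : τ = τ' ∧ t = t' := by
  induction h generalizing τ' t' with
  | nop | assign | store => cases h'; exact ⟨rfl, rfl⟩
  | seq _ _ ih₁ ih₂ =>
    cases h' with
    | seq h₁ h₂ =>
      obtain ⟨rfl, rfl⟩ := ih₁ h₁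
      obtain ⟨rfl, rfl⟩ := ih₂ h₂
      exact ⟨rfl, rfl⟩
  | branch_true _ hc _ ih =>
    cases h' with
    | branch_true _ _ h₁ => obtain ⟨rfl, rfl⟩ := ih h₁; exact ⟨rfl, rfl⟩
    | branch_false _ hc' _ => simp [hc] at hc'
  | branch_false _ hc _ ih =>
    cases h' with
    | branch_true _ hc' _ => simp [hc] at hc'
    | branch_false _ _ h₁ => obtain ⟨rfl, rfl⟩ := ih h₁; exact ⟨rfl, rfl⟩
  | loop_true hc _ _ ih₁ ih₂ =>
    cases h' with
    | loop_true _ h₁ h₂ =>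
      obtain ⟨rfl, rfl⟩ := ih₁ h₁
      obtain ⟨rfl, rfl⟩ := ih₂ h₂
      exact ⟨rfl, rfl⟩
    | loop_false _ hc' => simp [hc] at hc'
  | loop_false _ hc =>
    cases h' with
    | loop_true hc' _ _ => simp [hc] at hc'
    | loop_false => exact ⟨rfl, rfl⟩

/-- The initial state of a machine with `w`-bit words for the input graph `G` on the vertices
`0, …, n - 1`: register `0` holds `n`, table `0` holds the adjacency matrix of `G`, and everything
else is zero. -/
def inputState (w : ℕ) {n : ℕ} (G : SimpleGraph (Fin n)) [DecidableRel G.Adj] : State w where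
  reg := fun r => if r = 0 then BitVec.ofNat w n else 0
  table := fun T i j =>
    if T = 0 ∧ ∃ u v : Fin n, G.Adj u v ∧ i.toNat = u ∧ j.toNat = v then 1 else 0

/-- The final state `τ` contains a valid partial cube labeling of `G`: register `1` holds the length
`d` of the bitvectors, and cell `(v, i)` of table `1` holds bit `i` of the bitvector of vertex `v`,
for `v < n` and `i < d`. -/
def OutputsLabeling {n : ℕ} (G : SimpleGraph (Fin n)) (τ : State w) : Prop :=
  ∃ label : Fin n → Fin (τ.reg 1).toNat → Bool, IsPartialCubeLabeling G label ∧
    ∀ (v : Fin n) (i : Fin (τ.reg 1).toNat),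
      τ.table 1 (BitVec.ofNat w v) (BitVec.ofNat w i) = if label v i then 1 else 0

end WordRAM

/-!
A labeling of the vertices by bitvectors is an isometric embedding into a cube if and only if two
local conditions hold: every edge flips exactly one coordinate, and at every vertex there is, for
every other vertex, an edge that flips a coordinate in which the two differ (`CubeLabeling`). So it
suffices to compute a labeling that satisfies these conditions if `G` is a partial cube, and then to
test them. A partial cube has at most `n log₂ n` edges (`card_pairs_diffSet_card_eq_one_le`), so
graphs with essentially more edges are rejected at once. Let `k = log₂ n`.

The labels are found in phases. In a partial cube the edges at a vertex `v` flip different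
coordinates, and the vertices that differ from `v` in the coordinate of one of these edges form a
half-space. Half-spaces spread along shortest paths from `v`: beyond the neighbors of `v`, a vertex
belongs to such a half-space if and only if one of its predecessors in the breadth-first search from
`v` does (`CubeLabeling.layering`). One search thus finds the half-spaces of up to `k` edges at `v`,
as the bits of one word for each vertex. They are appended to the labels, and the edges that leave
one of them are contracted; the quotient is the partial cube in the remaining coordinates, and the
procedure is repeated until no edge is left (`CubeLabeling.quot`, `LabelProgress.next`).

The time is amortized. The root `v` is chosen of maximal degree `m`, and a phase uses
`c = min k m` edges. As the sum of the degrees is at most `n * m` and at most `(2 * k + 1) * n`, it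
is `O(n * c)`, and so is the time of the phase outside of the merging of classes. Every merging of
two classes takes `O(n)` steps. On the other hand, a phase reduces the number of classes by at least
`c`, and there are at most `n` classes, so all phases together take `O(n ^ 2)` steps
(`wp_contractProg`, `wp_labelProg`).

For the test, the labels and their columns are packed, with `k` bits in a word. The coordinates
flipped by an edge are found in `O(n / k)` steps from the packed labels of its ends (`wp_flipProg`).
To see that from `u` one can move towards every other vertex, the columns of the coordinates flipped
by the edges at `u`, complemented where `u` has a `1`, are combined by a bitwise disjunction
(`wp_towardProg`). Both take `O(n / k)` steps for every edge, and there are `O(n * k)` edges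
(`wp_checkProg`).

Programs are analyzed on memories with natural numbers (`WordRAM.Mem`), by the weakest precondition
`WordRAM.wp`, which keeps track of the number of steps; `WordRAM.wp_runs` transfers the result to
the machine with `w`-bit words.
-/

/-! ### Reasoning about word RAM programs -/

namespace WordRAM

/-- A memory whose registers and cells hold natural numbers. It stands for the machine state
`Mem.toState w` that holds these numbers modulo `2 ^ w`. -/
@[ext] structure Mem where
  reg : ℕ → ℕ
  tab : ℕ → ℕ → ℕ → ℕ

namespace Mem

/-- The machine state with `w`-bit words; cell `(i, j)` of a table is addressed by the words of the
numbers `i` and `j`. -/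
def toState (w : ℕ) (s : Mem) : State w where
  reg r := BitVec.ofNat w (s.reg r)
  table T i j := BitVec.ofNat w (s.tab T i.toNat j.toNat)

/-- Put `x` into register `r`. -/
def setReg (s : Mem) (r x : ℕ) : Mem where
  reg r' := if r' = r then x else s.reg r'
  tab := s.tab

/-- Put `x` into cell `(i, j)` of table `T`. -/
def setCell (s : Mem) (T i j x : ℕ) : Mem where
  reg := s.reg
  tab T' i' j' := if T' = T ∧ i' = i ∧ j' = j then x else s.tab T' i' j'

@[simp] theorem reg_setReg (s : Mem) (r x r' : ℕ) :
    (s.setReg r x).reg r' = if r' = r then x else s.reg r' := rfl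

@[simp] theorem tab_setReg (s : Mem) (r x : ℕ) : (s.setReg r x).tab = s.tab := rfl

@[simp] theorem reg_setCell (s : Mem) (T i j x : ℕ) : (s.setCell T i j x).reg = s.reg := rfl

@[simp] theorem tab_setCell (s : Mem) (T i j x T' i' j' : ℕ) :
    (s.setCell T i j x).tab T' i' j' = if T' = T ∧ i' = i ∧ j' = j then x else s.tab T' i' j' :=
  rfl

/-- A row of a table as a function; it applies where a row occurs without a column index. -/
@[simp] theorem row_setCell (s : Mem) (T i j x T' i' : ℕ) :
    (s.setCell T i j x).tab T' i' =
      fun j' => if T' = T ∧ i' = i ∧ j' = j then x else s.tab T' i' j' :=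
  rfl

theorem tab_setCell_of_ne (s : Mem) {T T' : ℕ} (i j x : ℕ) (h : T' ≠ T) :
    (s.setCell T i j x).tab T' = s.tab T' := by
  funext i' j'
  simp [h]

theorem toState_setReg (w : ℕ) (s : Mem) (r x : ℕ) :
    (s.setReg r x).toState w = (s.toState w).setReg r (BitVec.ofNat w x) := by
  ext r'
  · simp only [toState, State.setReg, setReg, Function.update_apply]
    split_ifs <;> rfl
  · rfl

theorem toState_setCell (w : ℕ) (s : Mem) (T x : ℕ) {i j : ℕ} (hi : i < 2 ^ w) (hj : j < 2 ^ w) :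
    (s.setCell T i j x).toState w =
      (s.toState w).setCell T (BitVec.ofNat w i) (BitVec.ofNat w j) (BitVec.ofNat w x) := by
  have key : ∀ (a : BitVec w) {b : ℕ}, b < 2 ^ w → (a = BitVec.ofNat w b ↔ a.toNat = b) := by
    intro a b hb
    rw [← BitVec.toNat_inj, BitVec.toNat_ofNat, Nat.mod_eq_of_lt hb]
  have htab : ((s.setCell T i j x).toState w).table = ((s.toState w).setCell T (BitVec.ofNat w i)
      (BitVec.ofNat w j) (BitVec.ofNat w x)).table := by
    funext r' i' j'
    simp only [toState, State.setCell, setCell, Function.update_apply]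
    by_cases h1 : r' = T
    · subst h1
      by_cases h2 : i' = BitVec.ofNat w i
      · by_cases h3 : j' = BitVec.ofNat w j
        · simp [h2, h3, Nat.mod_eq_of_lt hi, Nat.mod_eq_of_lt hj]
        · have h3' : ¬ j'.toNat = j := fun h => h3 ((key j' hj).2 h)
          simp [h2, h3, h3']
      · have h2' : ¬ i'.toNat = i := fun h => h2 ((key i' hi).2 h)
        simp [h2, h2']
    · simp [h1]
  exact State.ext rfl htab

end Mem

/-- The operations on natural numbers. Subtraction is the truncated one. -/
def BinOp.val : BinOp → ℕ → ℕ → ℕ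
  | .add, x, y => x + y
  | .sub, x, y => x - y
  | .and, x, y => x &&& y
  | .or, x, y => x ||| y
  | .xor, x, y => x ^^^ y

/-- The value of an expression, as a natural number that is not reduced modulo `2 ^ w`. -/
def Expr.val (s : Mem) : Expr → ℕ
  | .const k => k
  | .reg r => s.reg r
  | .op o a b => o.val (a.val s) (b.val s)
  | .load T i j => s.tab T (i.val s) (j.val s)

/-- The operation on natural numbers represents the operation on words of every size: a subtraction
must not be truncated. -/
def BinOp.Safe : BinOp → ℕ → ℕ → Prop
  | .sub, x, y => y ≤ x
  | _, _, _ => True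

/-- Machine arithmetic on `w`-bit words agrees with the arithmetic of natural numbers in the
evaluation of the expression: no subtraction is truncated, and all addresses are below `2 ^ w`. The
other operations need no condition, since they commute with reduction modulo `2 ^ w`. -/
def Expr.Safe (w : ℕ) (s : Mem) : Expr → Prop
  | .const _ => True
  | .reg _ => True
  | .op o a b => a.Safe w s ∧ b.Safe w s ∧ o.Safe (a.val s) (b.val s)
  | .load _ i j => i.Safe w s ∧ j.Safe w s ∧ i.val s < 2 ^ w ∧ j.val s < 2 ^ w

/-- The truth of a test about natural numbers. -/
def Test.val (s : Mem) : Test → Prop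
  | .eq a b => a.val s = b.val s
  | .lt a b => a.val s < b.val s
  | .not c => ¬ c.val s
  | .and c d => c.val s ∧ d.val s

/-- A test about natural numbers agrees with the test about words: the numbers compared must be
below `2 ^ w`. -/
def Test.Safe (w : ℕ) (s : Mem) : Test → Prop
  | .eq a b => a.Safe w s ∧ b.Safe w s ∧ a.val s < 2 ^ w ∧ b.val s < 2 ^ w
  | .lt a b => a.Safe w s ∧ b.Safe w s ∧ a.val s < 2 ^ w ∧ b.val s < 2 ^ w
  | .not c => c.Safe w s
  | .and c d => c.Safe w s ∧ d.Safe w s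

theorem BinOp.eval_ofNat {w : ℕ} (o : BinOp) (x y : ℕ) (h : o.Safe x y) :
    o.eval (BitVec.ofNat w x) (BitVec.ofNat w y) = BitVec.ofNat w (o.val x y) := by
  cases o with
  | add => exact (BitVec.ofNat_add ..).symm
  | sub =>
    have h' : x = (x - y) + y := (Nat.sub_add_cancel h).symm
    simp only [BinOp.eval, BinOp.val]
    conv_lhs => rw [h', BitVec.ofNat_add, BitVec.add_sub_cancel]
  | and => simp [BinOp.eval, BinOp.val]
  | or => simp [BinOp.eval, BinOp.val]
  | xor => simp [BinOp.eval, BinOp.val]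

theorem Expr.eval_toState {w : ℕ} (s : Mem) (e : Expr) (h : e.Safe w s) :
    e.eval (s.toState w) = BitVec.ofNat w (e.val s) := by
  induction e with
  | const | reg => rfl
  | op o a b iha ihb =>
    obtain ⟨ha, hb, ho⟩ := h
    rw [Expr.eval, iha ha, ihb hb, BinOp.eval_ofNat o _ _ ho, Expr.val]
  | load T i j ihi ihj =>
    obtain ⟨hi, hj, hi', hj'⟩ := h
    rw [Expr.eval, ihi hi, ihj hj]
    simp only [Mem.toState, BitVec.toNat_ofNat, Nat.mod_eq_of_lt hi', Nat.mod_eq_of_lt hj',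
      Expr.val]

theorem Test.eval_toState {w : ℕ} (s : Mem) (c : Test) (h : c.Safe w s) :
    c.eval (s.toState w) = true ↔ c.val s := by
  induction c with
  | eq a b =>
    obtain ⟨ha, hb, ha', hb'⟩ := h
    simp only [Test.eval, Expr.eval_toState s _ ha, Expr.eval_toState s _ hb, decide_eq_true_eq,
      Test.val, ← BitVec.toNat_inj, BitVec.toNat_ofNat, Nat.mod_eq_of_lt ha', Nat.mod_eq_of_lt hb']
  | lt a b =>
    obtain ⟨ha, hb, ha', hb'⟩ := h
    simp only [Test.eval, Expr.eval_toState s _ ha, Expr.eval_toState s _ hb, decide_eq_true_eq,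
      Test.val, BitVec.lt_def, BitVec.toNat_ofNat, Nat.mod_eq_of_lt ha', Nat.mod_eq_of_lt hb']
  | not c ih =>
    have := ih h
    simp only [Test.eval, Test.val, ← this, Bool.not_eq_true', Bool.not_eq_true]
  | and c d ihc ihd =>
    simp only [Test.eval, Test.val, ← ihc h.1, ← ihd h.2, Bool.and_eq_true]

/-- The registers that a program may change. -/
def Prog.regs : Prog → List ℕ
  | .nop => []
  | .assign r _ => [r]
  | .store _ _ _ _ => []
  | .seq p q => p.regs ++ q.regs
  | .branch _ p q => p.regs ++ q.regs
  | .loop _ p => p.regs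

/-- The tables that a program may change. -/
def Prog.tabs : Prog → List ℕ
  | .nop => []
  | .assign _ _ => []
  | .store T _ _ _ => [T]
  | .seq p q => p.tabs ++ q.tabs
  | .branch _ p q => p.tabs ++ q.tabs
  | .loop _ p => p.tabs

/-- `s'` differs from `s` only in registers and tables that `p` may change. -/
structure Frame (p : Prog) (s s' : Mem) : Prop where
  reg : ∀ r, r ∉ p.regs → s'.reg r = s.reg r
  tab : ∀ T, T ∉ p.tabs → s'.tab T = s.tab T

theorem Frame.refl (p : Prog) (s : Mem) : Frame p s s := ⟨fun _ _ => rfl, fun _ _ => rfl⟩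

theorem Frame.trans {p : Prog} {s s' s'' : Mem} (h : Frame p s s') (h' : Frame p s' s'') :
    Frame p s s'' :=
  ⟨fun r hr => (h'.reg r hr).trans (h.reg r hr), fun r hr => (h'.tab r hr).trans (h.tab r hr)⟩

theorem Frame.mono {p q : Prog} {s s' : Mem} (h : Frame p s s') (hr : p.regs ⊆ q.regs)
    (ht : p.tabs ⊆ q.tabs) : Frame q s s' :=
  ⟨fun r hr' => h.reg r fun h => hr' (hr h), fun T hT => h.tab T fun h => hT (ht h)⟩

/-- `wp w p Q s`: with `w`-bit words, started in the memory `s`, the program `p` halts after some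
number `t` of steps in some memory `s'` with `Q s' t`. The definition is computed from the program
except at loops, for which `wp_forLoop` below is the rule. -/
def wp (w : ℕ) : Prog → (Mem → ℕ → Prop) → Mem → Prop
  | .nop, Q, s => Q s 0
  | .assign r e, Q, s => e.Safe w s ∧ Q (s.setReg r (e.val s)) (e.cost + 1)
  | .store T i j e, Q, s => (i.Safe w s ∧ i.val s < 2 ^ w) ∧ (j.Safe w s ∧ j.val s < 2 ^ w) ∧
      e.Safe w s ∧ Q (s.setCell T (i.val s) (j.val s) (e.val s)) (i.cost + j.cost + e.cost + 1)
  | .seq p q, Q, s => wp w p (fun s' t => wp w q (fun s'' t' => Q s'' (t + t')) s') s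
  | .branch c p q, Q, s => c.Safe w s ∧ (c.val s → wp w p (fun s' t => Q s' (c.cost + t)) s) ∧
      (¬ c.val s → wp w q (fun s' t => Q s' (c.cost + t)) s)
  | .loop c p, Q, s => ∃ s' t, Runs (.loop c p) (s.toState w) (s'.toState w) t ∧
      Frame (.loop c p) s s' ∧ Q s' t

/-- The rule of consequence, with the information that only registers and tables that occur in `p`
have changed. -/
theorem wp_frame {w : ℕ} {p : Prog} {Q R : Mem → ℕ → Prop} {s : Mem} (h : wp w p Q s)
    (hQR : ∀ s' t, Frame p s s' → Q s' t → R s' t) : wp w p R s := by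
  induction p generalizing Q R s with
  | nop => exact hQR s 0 (Frame.refl _ _) h
  | assign r e =>
    refine ⟨h.1, hQR _ _ ⟨fun r' hr' => ?_, fun _ _ => rfl⟩ h.2⟩
    simp only [Prog.regs, List.mem_singleton] at hr'
    simp [hr']
  | store T i j e =>
    refine ⟨h.1, h.2.1, h.2.2.1, hQR _ _ ⟨fun _ _ => rfl, fun T' hT' => ?_⟩ h.2.2.2⟩
    simp only [Prog.tabs, List.mem_singleton] at hT'
    exact Mem.tab_setCell_of_ne _ _ _ _ hT'
  | seq p q ihp ihq =>
    refine ihp (Q := fun s' t => wp w q (fun s'' t' => Q s'' (t + t')) s') h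
      fun s' t hF h' => ihq h' fun s'' t' hF' h'' => hQR _ _ ?_ h''
    exact (hF.mono (by simp [Prog.regs]) (by simp [Prog.tabs])).trans
      (hF'.mono (by simp [Prog.regs]) (by simp [Prog.tabs]))
  | branch c p q ihp ihq =>
    refine ⟨h.1, fun hc => ihp (h.2.1 hc) fun s' t hF h' => hQR _ _ ?_ h',
      fun hc => ihq (h.2.2 hc) fun s' t hF h' => hQR _ _ ?_ h'⟩
    · exact hF.mono (by simp [Prog.regs]) (by simp [Prog.tabs])
    · exact hF.mono (by simp [Prog.regs]) (by simp [Prog.tabs])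
  | loop c p _ =>
    obtain ⟨s', t, h1, h2, h3⟩ := h
    exact ⟨s', t, h1, h2, hQR _ _ h2 h3⟩

theorem wp_mono {w : ℕ} {p : Prog} {Q R : Mem → ℕ → Prop} {s : Mem} (h : wp w p Q s)
    (hQR : ∀ s' t, Q s' t → R s' t) : wp w p R s :=
  wp_frame h fun s' t _ => hQR s' t

/-- Soundness: `wp` describes a run of the machine. -/
theorem wp_runs {w : ℕ} {p : Prog} {Q : Mem → ℕ → Prop} {s : Mem} (h : wp w p Q s) :
    ∃ s' t, Runs p (s.toState w) (s'.toState w) t ∧ Q s' t := by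
  induction p generalizing s Q with
  | nop => exact ⟨s, 0, .nop _, h⟩
  | assign r e =>
    refine ⟨_, _, ?_, h.2⟩
    rw [Mem.toState_setReg, ← Expr.eval_toState s e h.1]
    exact .assign ..
  | store T i j e =>
    refine ⟨_, _, ?_, h.2.2.2⟩
    rw [Mem.toState_setCell _ _ _ _ h.1.2 h.2.1.2, ← Expr.eval_toState s e h.2.2.1,
      ← Expr.eval_toState s i h.1.1, ← Expr.eval_toState s j h.2.1.1]
    exact .store ..
  | seq p q ihp ihq =>
    obtain ⟨s', t, h1, h2⟩ := ihp h
    obtain ⟨s'', t', h3, h4⟩ := ihq h2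
    exact ⟨s'', _, .seq h1 h3, h4⟩
  | branch c p q ihp ihq =>
    by_cases hc : c.val s
    · obtain ⟨s', t, h1, h2⟩ := ihp (h.2.1 hc)
      exact ⟨s', _, .branch_true _ ((Test.eval_toState s c h.1).2 hc) h1, h2⟩
    · obtain ⟨s', t, h1, h2⟩ := ihq (h.2.2 hc)
      refine ⟨s', _, .branch_false _ ?_ h1, h2⟩
      rw [← Bool.not_eq_true, Test.eval_toState s c h.1]
      exact hc
  | loop c p _ =>
    obtain ⟨s', t, h1, _, h3⟩ := h
    exact ⟨s', t, h1, h3⟩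

theorem wp_sound {w : ℕ} {p : Prog} {Q : Mem → ℕ → Prop} {s : Mem} (h : wp w p Q s) :
    ∃ s' t, Runs p (s.toState w) (s'.toState w) t ∧ Frame p s s' ∧ Q s' t :=
  wp_runs (wp_frame h fun _ _ hF hQ => ⟨hF, hQ⟩)

/-- For `r = 0, …, b - 1` do `p`, where `b` is the content of a register. -/
def Prog.forLoop (r b : ℕ) (p : Prog) : Prog :=
  .seq (.assign r (.const 0))
    (.loop (.lt (.reg r) (.reg b)) (.seq p (.assign r (.op .add (.reg r) (.const 1)))))

/-- The rule for counting loops. The invariant `I j s t` is about the memory `s` and the number `t`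
of steps before iteration `j`, where `t` includes the five steps for the initialization of the
counter and for the last test; every iteration takes seven steps more than its body. -/
theorem wp_forLoop {w : ℕ} {r b : ℕ} {p : Prog} {s : Mem} {Q : Mem → ℕ → Prop}
    (I : ℕ → Mem → ℕ → Prop) (hr : r ∉ p.regs) (hb : b ∉ p.regs) (hrb : b ≠ r)
    (hN : s.reg b < 2 ^ w) (h0 : I 0 (s.setReg r 0) 5)
    (step : ∀ j < s.reg b, ∀ s' t, Frame (.forLoop r b p) s s' → s'.reg r = j → I j s' t →
      wp w p (fun s'' t' => I (j + 1) (s''.setReg r (j + 1)) (t + t' + 7)) s')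
    (hQ : ∀ s' t, Frame (.forLoop r b p) s s' → I (s.reg b) s' t → Q s' t) :
    wp w (.forLoop r b p) Q s := by
  set N := s.reg b with hNdef
  set body : Prog := .seq p (.assign r (.op .add (.reg r) (.const 1))) with hbody
  set c : Test := .lt (.reg r) (.reg b) with hc
  have hregs : ∀ x, x ∈ (Prog.forLoop r b p).regs ↔ x = r ∨ x ∈ p.regs := by
    intro x; simp [Prog.forLoop, Prog.regs]; tauto
  have hbF : b ∉ (Prog.forLoop r b p).regs := by rw [hregs]; tauto
  have hFl : ∀ {s1 s2 : Mem}, Frame (.loop c body) s1 s2 → Frame (.forLoop r b p) s1 s2 :=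
    fun h => h.mono (by simp [Prog.forLoop, Prog.regs, hbody]) (by simp [Prog.forLoop, Prog.tabs, hbody])
  have key : ∀ m j, j + m = N → ∀ s' t, Frame (.forLoop r b p) s s' → s'.reg r = j → I j s' t →
      ∃ s'' t', Runs (.loop c body) (s'.toState w) (s''.toState w) (t' + 3) ∧
        Frame (.loop c body) s' s'' ∧ I N s'' (t + t') := by
    intro m
    induction m with
    | zero =>
      intro j hj s' t hF hr' hI
      have hj' : j = N := by omega
      subst hj'
      refine ⟨s', 0, ?_, Frame.refl _ _, hI⟩
      refine .loop_false _ ?_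
      rw [← Bool.not_eq_true, Test.eval_toState]
      · simp [hc, Test.val, Expr.val, hr', hF.reg b hbF, hNdef]
      · simp [hc, Test.Safe, Expr.Safe, Expr.val, hr', hF.reg b hbF, ← hNdef, hN]
    | succ m ih =>
      intro j hj s' t hF hr' hI
      have hjN : j < N := by omega
      obtain ⟨s1, t1, hR1, hF1, hI1⟩ := wp_sound (step j hjN s' t hF hr' hI)
      have hs1r : s1.reg r = j := (hF1.reg r hr).trans hr'
      have hFb : Frame (.loop c body) s' (s1.setReg r (j + 1)) := by
        constructor
        · intro x hx
          simp only [Prog.regs, hbody, List.mem_append, List.mem_singleton, not_or] at hx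
          simp [hx.2, hF1.reg x hx.1]
        · intro T hT
          simp only [Prog.tabs, hbody, List.append_nil] at hT
          exact hF1.tab T hT
      obtain ⟨s2, t2, hR2, hF2, hI2⟩ := ih (j + 1) (by omega) (s1.setReg r (j + 1)) (t + t1 + 7)
        (hF.trans (hFl hFb)) (by simp) hI1
      refine ⟨s2, t1 + 7 + t2, ?_, hFb.trans hF2, ?_⟩
      · have : t1 + 7 + t2 + 3 = 3 + (t1 + 4) + (t2 + 3) := by omega
        rw [this]
        refine .loop_true ?_ (.seq hR1 ?_) hR2
        · rw [Test.eval_toState]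
          · simp [hc, Test.val, Expr.val, hr', hF.reg b hbF, ← hNdef, hjN]
          · simp only [hc, Test.Safe, Expr.Safe, Expr.val, hr', hF.reg b hbF, ← hNdef]
            exact ⟨trivial, trivial, by omega, hN⟩
        · have h := Runs.assign r (.op .add (.reg r) (.const 1)) (s1.toState w)
          rw [Expr.eval_toState _ _ (by simp [Expr.Safe, BinOp.Safe]), ← Mem.toState_setReg] at h
          simpa [Expr.val, BinOp.val, hs1r, Expr.cost] using h
      · rw [show t + (t1 + 7 + t2) = t + t1 + 7 + t2 by omega]; exact hI2
  have hF0 : Frame (.forLoop r b p) s (s.setReg r 0) := by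
    refine ⟨fun x hx => ?_, fun _ _ => rfl⟩
    rw [hregs, not_or] at hx
    simp [hx.1]
  obtain ⟨s', t, h1, h2, h3⟩ := key N 0 (by omega) (s.setReg r 0) 5 hF0 (by simp) h0
  refine ⟨trivial, s', t + 3, h1, h2, ?_⟩
  show Q s' ((Expr.const 0).cost + 1 + (t + 3))
  rw [show (Expr.const 0).cost + 1 + (t + 3) = 5 + t by simp [Expr.cost]; omega]
  exact hQ s' _ (hF0.trans (hFl h2)) h3

/-- The rule for counting loops in which iteration `j` takes at most `T j` steps. -/
theorem wp_forLoop_sum {w : ℕ} {r b : ℕ} {p : Prog} {s : Mem} {Q : Mem → ℕ → Prop}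
    (I : ℕ → Mem → Prop) (T : ℕ → ℕ) (hr : r ∉ p.regs) (hb : b ∉ p.regs) (hrb : b ≠ r)
    (hN : s.reg b < 2 ^ w) (h0 : I 0 (s.setReg r 0))
    (step : ∀ j < s.reg b, ∀ s', Frame (.forLoop r b p) s s' → s'.reg r = j → I j s' →
      wp w p (fun s'' t' => t' ≤ T j ∧ I (j + 1) (s''.setReg r (j + 1))) s')
    (hQ : ∀ s' t, Frame (.forLoop r b p) s s' → I (s.reg b) s' →
      t ≤ (∑ j ∈ Finset.range (s.reg b), (T j + 7)) + 5 → Q s' t) :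
    wp w (.forLoop r b p) Q s := by
  refine wp_forLoop (fun j s' t => I j s' ∧ t ≤ (∑ i ∈ Finset.range j, (T i + 7)) + 5) hr hb hrb hN
    ⟨h0, by simp⟩ ?_ fun s' t hF h => hQ s' t hF h.1 h.2
  intro j hj s' t hF hr' hI
  refine wp_mono (step j hj s' hF hr' hI.1) fun s'' t' h => ⟨h.2, ?_⟩
  rw [Finset.sum_range_succ]
  have := hI.2
  have := h.1
  omega

/-- The rule for counting loops in which every iteration takes at most `T` steps. -/
theorem wp_forLoop_const {w : ℕ} {r b : ℕ} {p : Prog} {s : Mem} {Q : Mem → ℕ → Prop}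
    (I : ℕ → Mem → Prop) (T : ℕ) (hr : r ∉ p.regs) (hb : b ∉ p.regs) (hrb : b ≠ r)
    (hN : s.reg b < 2 ^ w) (h0 : I 0 (s.setReg r 0))
    (step : ∀ j < s.reg b, ∀ s', Frame (.forLoop r b p) s s' → s'.reg r = j → I j s' →
      wp w p (fun s'' t' => t' ≤ T ∧ I (j + 1) (s''.setReg r (j + 1))) s')
    (hQ : ∀ s' t, Frame (.forLoop r b p) s s' → I (s.reg b) s' →
      t ≤ s.reg b * (T + 7) + 5 → Q s' t) :
    wp w (.forLoop r b p) Q s :=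
  wp_forLoop_sum I (fun _ => T) hr hb hrb hN h0 step fun s' t hF h ht =>
    hQ s' t hF h (by simpa using ht)

end WordRAM

/-! ### Cube labelings -/

/-- The coordinates in `S` at which the labels of `u` and `v` differ. -/
def diffSet (S : Finset ℕ) (l : ℕ → ℕ → Bool) (u v : ℕ) : Finset ℕ :=
  S.filter fun i => l u i ≠ l v i

section diffSet

variable {S : Finset ℕ} {l : ℕ → ℕ → Bool} {u v x i : ℕ}

theorem mem_diffSet : i ∈ diffSet S l u v ↔ i ∈ S ∧ l u i ≠ l v i := by
  simp [diffSet]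

theorem diffSet_comm (S : Finset ℕ) (l : ℕ → ℕ → Bool) (u v : ℕ) :
    diffSet S l u v = diffSet S l v u := by
  ext i; simp only [mem_diffSet, ne_comm]

theorem diffSet_self (S : Finset ℕ) (l : ℕ → ℕ → Bool) (u : ℕ) : diffSet S l u u = ∅ := by
  ext i; simp [mem_diffSet]

theorem diffSet_congr_left (h : diffSet S l u x = ∅) (v : ℕ) :
    diffSet S l u v = diffSet S l x v := by
  ext i
  by_cases hi : i ∈ S
  · have : i ∉ diffSet S l u x := by simp [h]
    simp only [mem_diffSet, hi, true_and, not_not] at this ⊢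
    rw [this]
  · simp [mem_diffSet, hi]

theorem diffSet_congr_right (h : diffSet S l u x = ∅) (v : ℕ) :
    diffSet S l v u = diffSet S l v x := by
  rw [diffSet_comm, diffSet_congr_left h, diffSet_comm]

/-- A step that flips coordinate `i` adds `i` to the set of the differences from `v`, or removes it.
-/
theorem diffSet_flip (h : diffSet S l u x = {i}) (v : ℕ) :
    diffSet S l x v = if i ∈ diffSet S l u v then (diffSet S l u v).erase i
      else insert i (diffSet S l u v) := by
  have hi : i ∈ diffSet S l u x := by simp [h]
  have key : ∀ j ∈ S, j ≠ i → l u j = l x j := by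
    intro j hj hji
    by_contra hne
    have : j ∈ diffSet S l u x := mem_diffSet.2 ⟨hj, hne⟩
    simp [h, hji] at this
  rw [mem_diffSet] at hi
  split_ifs with hv
  · ext j
    rw [mem_diffSet] at hv
    by_cases hji : j = i
    · subst hji
      have : l x j = l v j := by
        revert hv hi
        cases l x j <;> cases l v j <;> cases l u j <;> simp
      simp [mem_diffSet, this]
    · simp only [mem_diffSet, Finset.mem_erase, ne_eq, hji, not_false_eq_true, true_and]
      exact and_congr_right fun hj => by rw [key j hj hji]
  · ext j
    have hv : l u i = l v i := by
      by_contra hne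
      exact hv (mem_diffSet.2 ⟨hi.1, hne⟩)
    by_cases hji : j = i
    · subst hji
      simp only [mem_diffSet, hi.1, true_and, Finset.mem_insert, true_or, iff_true]
      rw [← hv]; exact hi.2.symm
    · simp only [mem_diffSet, Finset.mem_insert, hji, false_or]
      exact and_congr_right fun hj => by rw [key j hj hji]

theorem card_diffSet_of_mem (h : diffSet S l u x = {i}) (hi : i ∈ diffSet S l u v) :
    (diffSet S l x v).card + 1 = (diffSet S l u v).card := by
  rw [diffSet_flip h, if_pos hi, Finset.card_erase_add_one hi]

theorem card_diffSet_of_notMem (h : diffSet S l u x = {i}) (hi : i ∉ diffSet S l u v) :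
    (diffSet S l x v).card = (diffSet S l u v).card + 1 := by
  rw [diffSet_flip h, if_neg hi, Finset.card_insert_of_notMem hi]

end diffSet

/-- The labels `l`, read at the coordinates in `S`, embed the graph with vertex set `V` and
adjacency relation `E` isometrically into a cube. The condition is stated locally: every edge flips
exactly one coordinate, and from every vertex one can move towards any other one. -/
structure CubeLabeling (V : Set ℕ) (E : ℕ → ℕ → Prop) (S : Finset ℕ) (l : ℕ → ℕ → Bool) :
    Prop where
  flip : ∀ ⦃u v⦄, E u v → ∃ i, diffSet S l u v = {i}
  toward : ∀ ⦃u v⦄, u ∈ V → v ∈ V → u ≠ v →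
    ∃ x i, E u x ∧ diffSet S l u x = {i} ∧ i ∈ diffSet S l u v

/-- An adjacency relation on `V`. -/
structure IsGraphOn (V : Set ℕ) (E : ℕ → ℕ → Prop) : Prop where
  symm : ∀ ⦃u v⦄, E u v → E v u
  left_mem : ∀ ⦃u v⦄, E u v → u ∈ V
  irrefl : ∀ u, ¬ E u u

theorem IsGraphOn.right_mem {V : Set ℕ} {E : ℕ → ℕ → Prop} (h : IsGraphOn V E) {u v : ℕ}
    (huv : E u v) : v ∈ V :=
  h.left_mem (h.symm huv)

namespace CubeLabeling

variable {V : Set ℕ} {E : ℕ → ℕ → Prop} {S : Finset ℕ} {l : ℕ → ℕ → Bool}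

theorem eq_of_diffSet_eq_empty (h : CubeLabeling V E S l) {u v : ℕ} (hu : u ∈ V) (hv : v ∈ V)
    (huv : diffSet S l u v = ∅) : u = v := by
  by_contra hne
  obtain ⟨x, i, -, -, hi⟩ := h.toward hu hv hne
  simp [huv] at hi

/-- Being a cube labeling depends only on the Hamming distances of the labels. -/
theorem of_card_eq (hE : IsGraphOn V E) (h : CubeLabeling V E S l) {S' : Finset ℕ}
    {l' : ℕ → ℕ → Bool}
    (hc : ∀ u ∈ V, ∀ v ∈ V, (diffSet S' l' u v).card = (diffSet S l u v).card) :
    CubeLabeling V E S' l' := by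
  have hflip : ∀ ⦃u v⦄, E u v → ∃ i, diffSet S' l' u v = {i} := by
    intro u v huv
    obtain ⟨i, hi⟩ := h.flip huv
    rw [← Finset.card_eq_one, hc u (hE.left_mem huv) v (hE.right_mem huv), hi,
      Finset.card_singleton]
  refine ⟨hflip, fun u v hu hv huv => ?_⟩
  obtain ⟨x, i, hux, hi, hiv⟩ := h.toward hu hv huv
  obtain ⟨i', hi'⟩ := hflip hux
  refine ⟨x, i', hux, hi', ?_⟩
  by_contra hn
  have h1 := card_diffSet_of_notMem hi' hn
  have h2 := card_diffSet_of_mem hi hiv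
  rw [hc x (hE.right_mem hux) v hv, hc u hu v hv] at h1
  omega

end CubeLabeling

/-- The relation in which the classes of the map `rep` are adjacent if some of their elements are;
a class is named by its representative. -/
def quotAdj (E : ℕ → ℕ → Prop) (rep : ℕ → ℕ) (a b : ℕ) : Prop :=
  a ≠ b ∧ ∃ u v, E u v ∧ rep u = a ∧ rep v = b

/-- The map `rep` chooses representatives of the classes of an equivalence relation on `V`. -/
structure IsRep (V : Set ℕ) (rep : ℕ → ℕ) : Prop where
  mem : ∀ u ∈ V, rep u ∈ V
  idem : ∀ u ∈ V, rep (rep u) = rep u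

/-- The set of the representatives. -/
def repSet (V : Set ℕ) (rep : ℕ → ℕ) : Set ℕ := {a | a ∈ V ∧ rep a = a}

theorem IsRep.mem_repSet {V : Set ℕ} {rep : ℕ → ℕ} (h : IsRep V rep) {u : ℕ} (hu : u ∈ V) :
    rep u ∈ repSet V rep :=
  ⟨h.mem u hu, h.idem u hu⟩

theorem isGraphOn_quotAdj {V : Set ℕ} {E : ℕ → ℕ → Prop} {rep : ℕ → ℕ} (hE : IsGraphOn V E)
    (h : IsRep V rep) : IsGraphOn (repSet V rep) (quotAdj E rep) where
  symm := fun _ _ ⟨hne, u, v, huv, hu, hv⟩ => ⟨hne.symm, v, u, hE.symm huv, hv, hu⟩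
  left_mem := by
    rintro _ _ ⟨-, u, v, huv, rfl, -⟩
    exact h.mem_repSet (hE.left_mem huv)
  irrefl := fun _ h => h.1 rfl

/-- Contracting all edges that flip coordinates outside of `T` leaves a graph that is embedded in
the cube with coordinates `T`. -/
theorem CubeLabeling.quot {V : Set ℕ} {E : ℕ → ℕ → Prop} {S T : Finset ℕ} {l : ℕ → ℕ → Bool}
    {rep : ℕ → ℕ} (h : CubeLabeling V E S l) (hE : IsGraphOn V E) (hT : T ⊆ S) (hr : IsRep V rep)
    (hrep : ∀ u ∈ V, ∀ v ∈ V, rep u = rep v ↔ diffSet T l u v = ∅) :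
    CubeLabeling (repSet V rep) (quotAdj E rep) T l := by
  have hsub : ∀ u v, diffSet T l u v ⊆ diffSet S l u v := fun u v =>
    Finset.filter_subset_filter _ hT
  have hrepd : ∀ u ∈ V, diffSet T l (rep u) u = ∅ := fun u hu =>
    (hrep _ (hr.mem u hu) u hu).1 (hr.idem u hu)
  constructor
  · rintro _ _ ⟨hne, u, v, huv, rfl, rfl⟩
    have hu := hE.left_mem huv
    have hv := hE.right_mem huv
    rw [diffSet_congr_left (hrepd u hu), diffSet_congr_right (hrepd v hv)]
    obtain ⟨i, hi⟩ := h.flip huv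
    refine ⟨i, (Finset.subset_singleton_iff.1 (hi ▸ hsub u v)).resolve_left fun h0 => hne ?_⟩
    exact (hrep u hu v hv).2 h0
  · -- walk from `u` towards `v` until an edge flips a coordinate in `T`
    have key : ∀ m, ∀ u ∈ V, ∀ v ∈ V, (diffSet S l u v).card = m → rep u ≠ rep v →
        ∃ x i, quotAdj E rep (rep u) x ∧ diffSet T l u x = {i} ∧ i ∈ diffSet T l u v := by
      intro m
      induction m using Nat.strong_induction_on with
      | _ m ih =>
        intro u hu v hv hm hne
        obtain ⟨x, i, hux, hi, hiv⟩ := h.toward hu hv (fun h => hne (h ▸ rfl))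
        have hx := hE.right_mem hux
        by_cases hiT : i ∈ T
        · have hi' : diffSet T l u x = {i} := by
            refine (Finset.subset_singleton_iff.1 (hi ▸ hsub u x)).resolve_left fun h0 => ?_
            have : i ∈ diffSet S l u x := by simp [hi]
            have : i ∈ diffSet T l u x := mem_diffSet.2 ⟨hiT, (mem_diffSet.1 this).2⟩
            simp [h0] at this
          refine ⟨rep x, i, ⟨fun he => ?_, u, x, hux, rfl, rfl⟩, ?_, ?_⟩
          · rw [hrep u hu x hx, hi'] at he
            simp at he
          · rw [diffSet_congr_right (hrepd x hx), hi']
          · exact mem_diffSet.2 ⟨hiT, (mem_diffSet.1 hiv).2⟩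
        · have h0 : diffSet T l u x = ∅ := by
            refine (Finset.subset_singleton_iff.1 (hi ▸ hsub u x)).resolve_right fun h1 => hiT ?_
            have : i ∈ diffSet T l u x := by simp [h1]
            exact (mem_diffSet.1 this).1
          have hux' : rep u = rep x := (hrep u hu x hx).2 h0
          have hlt := card_diffSet_of_mem hi hiv
          obtain ⟨y, j, h1, h2, h3⟩ := ih _ (by omega) x hx v hv rfl (hux' ▸ hne)
          rw [hux']
          exact ⟨y, j, h1, diffSet_congr_left h0 y ▸ h2, diffSet_congr_left h0 v ▸ h3⟩
    intro u v hu hv huv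
    obtain ⟨x, i, h1, h2, h3⟩ := key _ u hu.1 v hv.1 rfl (by rw [hu.2, hv.2]; exact huv)
    rw [hu.2] at h1
    exact ⟨x, i, h1, h2, h3⟩

/-! ### Cube labelings and isometric embeddings -/

/-- The adjacency relation of a graph on `Fin n`, on the natural numbers. -/
def natAdj {n : ℕ} (G : SimpleGraph (Fin n)) (u v : ℕ) : Prop :=
  ∃ (hu : u < n) (hv : v < n), G.Adj ⟨u, hu⟩ ⟨v, hv⟩

theorem isGraphOn_natAdj {n : ℕ} (G : SimpleGraph (Fin n)) : IsGraphOn (Set.Iio n) (natAdj G) where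
  symm := fun _ _ ⟨hu, hv, h⟩ => ⟨hv, hu, h.symm⟩
  left_mem := fun _ _ ⟨hu, _, _⟩ => hu
  irrefl := fun _ ⟨_, _, h⟩ => G.irrefl h

theorem natAdj_coe {n : ℕ} {G : SimpleGraph (Fin n)} {u v : Fin n} :
    natAdj G u v ↔ G.Adj u v :=
  ⟨fun ⟨_, _, h⟩ => h, fun h => ⟨u.2, v.2, h⟩⟩

theorem card_diffSet_range {n d : ℕ} (label : Fin n → Fin d → Bool) (l : ℕ → ℕ → Bool)
    (h : ∀ (v : Fin n) (i : Fin d), l v i = label v i) (u v : Fin n) :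
    (diffSet (Finset.range d) l u v).card = hammingDist (label u) (label v) := by
  unfold hammingDist
  refine (Finset.card_bij (fun (i : Fin d) _ => (i : ℕ)) ?_ ?_ ?_).symm
  · intro i hi
    simp only [Finset.mem_filter, Finset.mem_univ, true_and] at hi
    simp [mem_diffSet, h, hi]
  · intro i _ j _ hij
    exact Fin.ext hij
  · intro i hi
    rw [mem_diffSet, Finset.mem_range] at hi
    refine ⟨⟨i, hi.1⟩, ?_, rfl⟩
    have hu := h u ⟨i, hi.1⟩
    have hv := h v ⟨i, hi.1⟩
    simp only at hu hv
    rw [Finset.mem_filter, ← hu, ← hv]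
    exact ⟨Finset.mem_univ _, hi.2⟩

/-- The local conditions imply isometry: following steps towards `v` gives a walk as long as the
Hamming distance, and no walk is shorter, as each of its edges flips only one coordinate. -/
theorem CubeLabeling.isPartialCubeLabeling {n d : ℕ} {G : SimpleGraph (Fin n)} {l : ℕ → ℕ → Bool}
    (h : CubeLabeling (Set.Iio n) (natAdj G) (Finset.range d) l) :
    IsPartialCubeLabeling G fun (v : Fin n) (i : Fin d) => l v i := by
  intro u v
  rw [← card_diffSet_range (fun (v : Fin n) (i : Fin d) => l v i) l (fun _ _ => rfl)]
  apply le_antisymm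
  · suffices H : ∀ m (u : Fin n), (diffSet (Finset.range d) l u v).card = m →
        ∃ p : G.Walk u v, p.length = m by
      obtain ⟨p, hp⟩ := H _ u rfl
      rw [← hp]
      exact G.edist_le p
    intro m
    induction m with
    | zero =>
      intro u hu
      have := h.eq_of_diffSet_eq_empty u.2 v.2 (Finset.card_eq_zero.1 hu)
      have := Fin.ext this
      subst this
      exact ⟨.nil, rfl⟩
    | succ m ih =>
      intro u hu
      obtain ⟨x, i, hux, hi, hiv⟩ := h.toward u.2 v.2 fun he => by
        rw [he, diffSet_self] at hu
        simp at hu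
      have hx : x < n := (isGraphOn_natAdj G).right_mem hux
      obtain ⟨p, hp⟩ := ih ⟨x, hx⟩ (by have := card_diffSet_of_mem hi hiv; simp only; omega)
      exact ⟨.cons (natAdj_coe (v := ⟨x, hx⟩).1 hux) p, by simp [hp]⟩
  · by_contra! hlt
    obtain ⟨p, hp⟩ := SimpleGraph.exists_walk_of_edist_ne_top (hlt.ne_top)
    rw [← hp] at hlt
    have key : ∀ {u v : Fin n} (p : G.Walk u v),
        (diffSet (Finset.range d) l u v).card ≤ p.length := by
      intro u v p
      induction p with
      | nil => simp [diffSet_self]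
      | @cons u x v hux p ih =>
        obtain ⟨i, hi⟩ := h.flip (natAdj_coe.2 hux)
        rw [SimpleGraph.Walk.length_cons]
        by_cases hiv : i ∈ diffSet (Finset.range d) l u v
        · have := card_diffSet_of_mem hi hiv
          omega
        · have := card_diffSet_of_notMem hi hiv
          omega
    have := key p
    have := ENat.natCast_lt_natCast.1 hlt
    omega

/-- Isometry implies the local conditions: the first edge of a shortest path flips a coordinate in
which the ends differ. -/
theorem IsPartialCubeLabeling.cubeLabeling {n d : ℕ} {G : SimpleGraph (Fin n)}
    {label : Fin n → Fin d → Bool} (h : IsPartialCubeLabeling G label) :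
    ∃ l, CubeLabeling (Set.Iio n) (natAdj G) (Finset.range d) l := by
  let l : ℕ → ℕ → Bool := fun v i => if h : v < n ∧ i < d then label ⟨v, h.1⟩ ⟨i, h.2⟩ else false
  have hl : ∀ (v : Fin n) (i : Fin d), l v i = label v i := fun v i => by simp [l]
  have hd : ∀ u v : Fin n, G.edist u v = ((diffSet (Finset.range d) l u v).card : ℕ∞) := fun u v => by
    rw [card_diffSet_range label l hl]; exact h u v
  have hflip : ∀ ⦃u v⦄, natAdj G u v → ∃ i, diffSet (Finset.range d) l u v = {i} := by
    rintro u v ⟨hu, hv, huv⟩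
    have := hd ⟨u, hu⟩ ⟨v, hv⟩
    rw [SimpleGraph.edist_eq_one_iff_adj.2 huv] at this
    exact Finset.card_eq_one.1 (by exact_mod_cast this.symm)
  refine ⟨l, hflip, fun u v hu hv huv => ?_⟩
  have hduv := hd ⟨u, hu⟩ ⟨v, hv⟩
  obtain ⟨p, hp⟩ := SimpleGraph.exists_walk_of_edist_ne_top
    (u := (⟨u, hu⟩ : Fin n)) (v := ⟨v, hv⟩) (by rw [hduv]; exact ENat.natCast_ne_top _)
  rw [hduv] at hp
  cases p with
  | nil => exact absurd rfl huv
  | @cons _ x _ hux p =>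
    obtain ⟨i, hi⟩ := hflip (natAdj_coe.2 hux)
    refine ⟨x, i, natAdj_coe.2 hux, hi, ?_⟩
    by_contra hn
    have h1 := card_diffSet_of_notMem hi hn
    have h2 := G.edist_le p
    rw [hd] at h2
    have h2 := ENat.natCast_le_natCast.1 h2
    have h3 := ENat.natCast_inj.1 hp
    rw [SimpleGraph.Walk.length_cons] at h3
    simp only at h1 h2 h3
    omega

/-! ### Partial cubes have few edges -/

/-- By induction on the number of coordinates: a coordinate splits `V` into two parts, and the
number of edges between them is at most the size of the smaller part. -/
theorem card_pairs_diffSet_card_eq_one_le (S : Finset ℕ) (l : ℕ → ℕ → Bool) (V : Finset ℕ)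
    (hinj : ∀ u ∈ V, ∀ v ∈ V, diffSet S l u v = ∅ → u = v) :
    ((V ×ˢ V).filter fun p => (diffSet S l p.1 p.2).card = 1).card ≤
      2 * (V.card * Nat.log 2 V.card) := by
  induction S using Finset.induction generalizing V with
  | empty => simp [diffSet]
  | insert a S ha ih =>
    let W : Bool → Finset ℕ := fun b => V.filter fun v => l v a = b
    have hW : ∀ b v, v ∈ W b ↔ v ∈ V ∧ l v a = b := fun b v => by simp [W]
    have hsame : ∀ u v, l u a = l v a → diffSet (insert a S) l u v = diffSet S l u v := by
      intro u v huv
      ext i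
      simp only [mem_diffSet, Finset.mem_insert]
      constructor
      · rintro ⟨rfl | hi, hne⟩
        · exact absurd huv hne
        · exact ⟨hi, hne⟩
      · exact fun h => ⟨.inr h.1, h.2⟩
    have hcross : ∀ u v, l u a ≠ l v a →
        diffSet (insert a S) l u v = insert a (diffSet S l u v) := by
      intro u v huv
      ext i
      simp only [mem_diffSet, Finset.mem_insert]
      constructor
      · rintro ⟨rfl | hi, hne⟩
        · exact .inl rfl
        · exact .inr ⟨hi, hne⟩
      · rintro (rfl | h)
        · exact ⟨.inl rfl, huv⟩
        · exact ⟨.inr h.1, h.2⟩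
    have hcard : (W true).card + (W false).card = V.card := by
      have := Finset.card_filter_add_card_filter_not (s := V) (fun v => l v a = true)
      simpa [W] using this
    have hWinj : ∀ b, ∀ u ∈ W b, ∀ v ∈ W b, diffSet S l u v = ∅ → u = v := by
      intro b u hu v hv h
      rw [hW] at hu hv
      exact hinj u hu.1 v hv.1 (by rw [hsame u v (hu.2.trans hv.2.symm), h])
    let P : Bool → Finset (ℕ × ℕ) := fun b =>
      (W b ×ˢ W b).filter fun p => (diffSet S l p.1 p.2).card = 1
    let C : Bool → Finset (ℕ × ℕ) := fun b =>
      (W b ×ˢ W (!b)).filter fun p => diffSet S l p.1 p.2 = ∅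
    have hsub : ((V ×ˢ V).filter fun p => (diffSet (insert a S) l p.1 p.2).card = 1) ⊆
        (P true ∪ P false) ∪ (C true ∪ C false) := by
      rintro ⟨u, v⟩ hp
      simp only [Finset.mem_filter, Finset.mem_product] at hp
      by_cases huv : l u a = l v a
      · rw [hsame u v huv] at hp
        apply Finset.mem_union_left
        cases hu : l u a
        · apply Finset.mem_union_right
          simp only [P, Finset.mem_filter, Finset.mem_product, hW]
          exact ⟨⟨⟨hp.1.1, hu⟩, hp.1.2, huv ▸ hu⟩, hp.2⟩
        · apply Finset.mem_union_left
          simp only [P, Finset.mem_filter, Finset.mem_product, hW]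
          exact ⟨⟨⟨hp.1.1, hu⟩, hp.1.2, huv ▸ hu⟩, hp.2⟩
      · have hp2 := hp.2
        rw [hcross u v huv, Finset.card_insert_of_notMem (by simp [mem_diffSet, ha])] at hp2
        have hp2 : diffSet S l u v = ∅ := by
          rw [← Finset.card_eq_zero]; omega
        apply Finset.mem_union_right
        cases hu : l u a
        · apply Finset.mem_union_right
          simp only [C, Finset.mem_filter, Finset.mem_product, hW]
          refine ⟨⟨⟨hp.1.1, hu⟩, hp.1.2, ?_⟩, hp2⟩
          rw [hu] at huv
          simpa using Ne.symm huv
        · apply Finset.mem_union_left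
          simp only [C, Finset.mem_filter, Finset.mem_product, hW]
          refine ⟨⟨⟨hp.1.1, hu⟩, hp.1.2, ?_⟩, hp2⟩
          rw [hu] at huv
          simpa using Ne.symm huv
    -- the pairs across the two parts form a matching
    have hC1 : ∀ b, (C b).card ≤ (W b).card := by
      intro b
      refine Finset.card_le_card_of_injOn Prod.fst (fun p hp => ?_) ?_
      · simp only [C, Finset.coe_filter, Set.mem_ofPred_eq, Finset.mem_product] at hp
        exact hp.1.1
      · rintro ⟨u, v⟩ hp ⟨u', v'⟩ hp' (rfl : u = u')
        simp only [C, Finset.coe_filter, Set.mem_ofPred_eq, Finset.mem_product] at hp hp'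
        rw [hWinj _ v hp.1.2 v' hp'.1.2]
        rw [diffSet_comm, diffSet_congr_right hp'.2] at hp
        exact hp.2
    have hC2 : ∀ b, (C b).card ≤ (W (!b)).card := by
      intro b
      refine Finset.card_le_card_of_injOn Prod.snd (fun p hp => ?_) ?_
      · simp only [C, Finset.coe_filter, Set.mem_ofPred_eq, Finset.mem_product] at hp
        exact hp.1.2
      · rintro ⟨u, v⟩ hp ⟨u', v'⟩ hp' (rfl : v = v')
        simp only [C, Finset.coe_filter, Set.mem_ofPred_eq, Finset.mem_product] at hp hp'
        rw [hWinj _ u hp.1.1 u' hp'.1.1]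
        rw [diffSet_congr_left hp.2, diffSet_comm]
        exact hp'.2
    have hle := (Finset.card_le_card hsub).trans ((Finset.card_union_le _ _).trans
      (add_le_add (Finset.card_union_le _ _) (Finset.card_union_le _ _)))
    have h1 := ih (W true) (hWinj true)
    have h2 := ih (W false) (hWinj false)
    have h3 := hC1 true
    have h4 := hC1 false
    have h5 := hC2 true
    have h6 := hC2 false
    simp only [Bool.not_true, Bool.not_false] at h5 h6
    -- the smaller part is at most half of the whole, so that its logarithm grows at least by one
    have arith : ∀ x y : ℕ, x ≤ y →
        x * Nat.log 2 x + y * Nat.log 2 y + x ≤ (x + y) * Nat.log 2 (x + y) := by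
      intro x y hxy
      rcases Nat.eq_zero_or_pos x with rfl | hx
      · simp
      · have e1 : Nat.log 2 x + 1 ≤ Nat.log 2 (x + y) := by
          rw [← Nat.log_mul_base (by norm_num) (by omega)]
          exact Nat.log_mono_right (by omega)
        have e2 : Nat.log 2 y ≤ Nat.log 2 (x + y) := Nat.log_mono_right (by omega)
        nlinarith [Nat.mul_le_mul_left x e1, Nat.mul_le_mul_left y e2]
    refine hle.trans ?_
    rw [← hcard]
    rcases le_total (W true).card (W false).card with hle | hle
    · have := arith _ _ hle
      simp only [P] at *
      omega
    · have := arith _ _ hle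
      rw [add_comm (W false).card] at this
      simp only [P] at *
      omega

/-! ### Half-spaces and contractions -/

/-- The function `δ` is the distance from `v` in a bipartite graph, and the predicates `T · b` are
propagated along shortest paths from `v`: beyond the neighbors of `v`, a vertex satisfies one of
them if and only if one of its predecessors does. -/
structure Layering (V : Set ℕ) (E : ℕ → ℕ → Prop) (v : ℕ) (δ : ℕ → ℕ) (T : ℕ → ℕ → Prop) :
    Prop where
  zero : δ v = 0
  root : ∀ b, ¬ T v b
  step : ∀ ⦃x y⦄, E x y → δ y = δ x + 1 ∨ δ x = δ y + 1
  pred : ∀ y ∈ V, y ≠ v → ∃ x, E x y ∧ δ x + 1 = δ y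
  bit : ∀ y ∈ V, 2 ≤ δ y → ∀ b, T y b ↔ ∃ x, E x y ∧ δ x + 1 = δ y ∧ T x b

/-- The neighbors of `v` are listed without repetitions as `nb 0, …, nb (m - 1)`. -/
structure IsNbList (E : ℕ → ℕ → Prop) (v : ℕ) (nb : ℕ → ℕ) (m : ℕ) : Prop where
  adj_iff : ∀ y, E v y ↔ ∃ j < m, nb j = y
  inj : ∀ i < m, ∀ j < m, nb i = nb j → i = j

theorem IsNbList.adj {E : ℕ → ℕ → Prop} {v : ℕ} {nb : ℕ → ℕ} {m : ℕ} (h : IsNbList E v nb m)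
    {j : ℕ} (hj : j < m) : E v (nb j) :=
  (h.adj_iff _).2 ⟨j, hj, rfl⟩

theorem IsNbList.le {E : ℕ → ℕ → Prop} {v : ℕ} {nb : ℕ → ℕ} {m j : ℕ}
    (h : IsNbList E v nb m) (hj : ∀ y, E v y → y < j) : m ≤ j := by
  have := Finset.card_le_card_of_injOn (s := Finset.range m) (t := Finset.range j) nb
    (fun i hi => by simpa using hj _ (h.adj (by simpa using hi)))
    (fun i hi i' hi' => h.inj i (by simpa using hi) i' (by simpa using hi'))
  simpa using this

theorem IsNbList.snoc {E E' : ℕ → ℕ → Prop} {v z : ℕ} {nb nb' : ℕ → ℕ} {m : ℕ}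
    (h : IsNbList E v nb m) (hz : ¬ E v z) (h1 : ∀ i < m, nb' i = nb i) (h2 : nb' m = z)
    (hE : ∀ y, E' v y ↔ E v y ∨ y = z) : IsNbList E' v nb' (m + 1) := by
  constructor
  · intro y
    rw [hE, h.adj_iff]
    constructor
    · rintro (⟨j, hj, rfl⟩ | rfl)
      · exact ⟨j, by omega, h1 j hj⟩
      · exact ⟨m, by omega, h2⟩
    · rintro ⟨j, hj, rfl⟩
      rcases Nat.lt_succ_iff_lt_or_eq.1 hj with hj | rfl
      · exact .inl ⟨j, hj, (h1 j hj).symm⟩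
      · exact .inr h2
  · have hne : ∀ i < m, nb i ≠ z := fun i hi he => hz ((h.adj_iff z).2 ⟨i, hi, he⟩)
    intro i hi j hj hij
    rcases Nat.lt_succ_iff_lt_or_eq.1 hi with hi | rfl <;>
      rcases Nat.lt_succ_iff_lt_or_eq.1 hj with hj | rfl
    · rw [h1 i hi, h1 j hj] at hij
      exact h.inj i hi j hj hij
    · rw [h1 i hi, h2] at hij
      exact absurd hij (hne i hi)
    · rw [h1 j hj, h2] at hij
      exact absurd hij.symm (hne j hj)
    · rfl

theorem IsNbList.congr {E E' : ℕ → ℕ → Prop} {v : ℕ} {nb nb' : ℕ → ℕ} {m m' : ℕ}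
    (h : IsNbList E v nb m) (hm : m' = m) (h1 : ∀ i < m, nb' i = nb i)
    (hE : ∀ y, E' v y ↔ E v y) : IsNbList E' v nb' m' := by
  subst hm
  constructor
  · intro y
    rw [hE, h.adj_iff]
    exact exists_congr fun j => and_congr_right fun hj => by rw [h1 j hj]
  · intro i hi j hj hij
    rw [h1 i hi, h1 j hj] at hij
    exact h.inj i hi j hj hij

theorem IsNbList.nil {E : ℕ → ℕ → Prop} {v : ℕ} (nb : ℕ → ℕ) (h : ∀ y, ¬ E v y) :
    IsNbList E v nb 0 :=
  ⟨fun y => by simp [h y], fun i hi => by omega⟩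

section

variable {V : Set ℕ} {E : ℕ → ℕ → Prop} {S : Finset ℕ} {l : ℕ → ℕ → Bool}

/-- The coordinates flipped by the edges at `v` are pairwise different. -/
theorem CubeLabeling.exists_coord (h : CubeLabeling V E S l) (hE : IsGraphOn V E) {v : ℕ}
    {nb : ℕ → ℕ} {m : ℕ} (hnb : IsNbList E v nb m) :
    ∃ co : ℕ → ℕ, (∀ j < m, diffSet S l v (nb j) = {co j}) ∧
      ∀ i < m, ∀ j < m, co i = co j → i = j := by
  have : ∀ j, ∃ i, j < m → diffSet S l v (nb j) = {i} := by
    intro j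
    by_cases hj : j < m
    · obtain ⟨i, hi⟩ := h.flip (hnb.adj hj)
      exact ⟨i, fun _ => hi⟩
    · exact ⟨0, fun h => absurd h hj⟩
  choose co hco using this
  refine ⟨co, hco, fun i hi j hj hij => hnb.inj i hi j hj ?_⟩
  apply h.eq_of_diffSet_eq_empty (hE.right_mem (hnb.adj hi)) (hE.right_mem (hnb.adj hj))
  rw [diffSet_flip (hco i hi), hco j hj, hij]
  simp

/-- The edges at `v` define half-spaces, and the membership of a vertex in these half-spaces is
determined by the membership of its predecessors: if `y` is in the half-space of the edge from `v`
to `u` and is different from `u`, then the next vertex on the way from `y` to `u` is also in it. -/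
theorem CubeLabeling.layering (h : CubeLabeling V E S l) (hE : IsGraphOn V E) {v : ℕ}
    (hv : v ∈ V) {nb : ℕ → ℕ} {m : ℕ} (hnb : IsNbList E v nb m) {co : ℕ → ℕ}
    (hco : ∀ j < m, diffSet S l v (nb j) = {co j}) {c : ℕ} (hc : c ≤ m) :
    Layering V E v (fun y => (diffSet S l v y).card)
      (fun y b => b < c ∧ co b ∈ diffSet S l v y) := by
  constructor
  · simp [diffSet_self]
  · simp [diffSet_self]
  · intro x y hxy
    obtain ⟨i, hi⟩ := h.flip hxy
    simp only [diffSet_comm S l v]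
    by_cases hiv : i ∈ diffSet S l x v
    · exact .inr (card_diffSet_of_mem hi hiv).symm
    · exact .inl (card_diffSet_of_notMem hi hiv)
  · intro y hy hyv
    obtain ⟨x, i, hyx, hi, hiv⟩ := h.toward hy hv hyv
    refine ⟨x, hE.symm hyx, ?_⟩
    simp only [diffSet_comm S l v]
    exact card_diffSet_of_mem hi hiv
  · intro y hy hy2 b
    constructor
    · rintro ⟨hb, hby⟩
      have hu := hco b (by omega)
      have huy : nb b ≠ y := by
        rintro rfl
        simp [hu] at hy2
      obtain ⟨x, i, hyx, hi, hiu⟩ := h.toward hy (hE.right_mem (hnb.adj (by omega : b < m))) huy.symm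
      rw [diffSet_comm, diffSet_flip hu, if_pos hby, Finset.mem_erase] at hiu
      have hiv : i ∈ diffSet S l y v := by rw [diffSet_comm]; exact hiu.2
      have hx : diffSet S l v x = (diffSet S l v y).erase i := by
        rw [diffSet_comm, diffSet_flip hi, if_pos hiv, diffSet_comm]
      refine ⟨x, hE.symm hyx, ?_, hb, ?_⟩
      · rw [hx, Finset.card_erase_add_one hiu.2]
      · rw [hx, Finset.mem_erase]
        exact ⟨hiu.1.symm, hby⟩
    · rintro ⟨x, hxy, hd, hb, hbx⟩
      refine ⟨hb, ?_⟩
      obtain ⟨i, hi⟩ := h.flip (hE.symm hxy)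
      by_cases hiv : i ∈ diffSet S l y v
      · rw [diffSet_comm, diffSet_flip hi, if_pos hiv, diffSet_comm] at hbx
        exact Finset.mem_of_mem_erase hbx
      · have := card_diffSet_of_notMem hi hiv
        simp only [diffSet_comm S l _ v] at this
        omega

/-- The map `rep'` chooses representatives for the equivalence relation generated by `rep` and the
pairs in `M`. -/
structure IsMerged (V : Set ℕ) (M : ℕ → ℕ → Prop) (rep rep' : ℕ → ℕ) : Prop where
  isRep : IsRep V rep'
  coarse : ∀ u ∈ V, rep' (rep u) = rep' u
  fixed : ∀ u ∈ V, rep (rep' u) = rep' u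
  merged : ∀ ⦃x y⦄, M x y → rep' x = rep' y
  least : ∀ R : ℕ → ℕ → Prop, Equivalence R → (∀ u ∈ V, R u (rep u)) →
    (∀ ⦃x y⦄, M x y → R x y) → ∀ u ∈ V, R u (rep' u)

/-- A quotient of the quotient is a quotient of the graph. -/
theorem quotAdj_iff_of_coarse {rep rep' : ℕ → ℕ} (hE : IsGraphOn V E)
    (h : ∀ u ∈ V, rep' (rep u) = rep' u) (a b : ℕ) :
    quotAdj E rep' a b ↔ a ≠ b ∧ ∃ x y, quotAdj E rep x y ∧ rep' x = a ∧ rep' y = b := by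
  refine and_congr_right fun hab => ?_
  constructor
  · rintro ⟨u, v, huv, rfl, rfl⟩
    refine ⟨rep u, rep v, ⟨fun he => hab ?_, u, v, huv, rfl, rfl⟩, h u (hE.left_mem huv),
      h v (hE.right_mem huv)⟩
    rw [← h u (hE.left_mem huv), he, h v (hE.right_mem huv)]
  · rintro ⟨_, _, ⟨-, u, v, huv, rfl, rfl⟩, rfl, rfl⟩
    exact ⟨u, v, huv, (h u (hE.left_mem huv)).symm, (h v (hE.right_mem huv)).symm⟩

/-- The state of the computation of the labels: `rep` identifies the vertices whose labels agree at
the remaining coordinates `T`, and the Hamming distances in the other coordinates are those of the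
labels of length `d` found so far. -/
def LabelProgress (V : Set ℕ) (S : Finset ℕ) (l : ℕ → ℕ → Bool) (rep : ℕ → ℕ) (d : ℕ)
    (L : ℕ → ℕ → Bool) (T : Finset ℕ) : Prop :=
  T ⊆ S ∧ (∀ u ∈ V, ∀ v ∈ V, rep u = rep v ↔ diffSet T l u v = ∅) ∧
    ∀ u ∈ V, ∀ v ∈ V, (diffSet (Finset.range d) L u v).card = (diffSet (S \ T) l u v).card

/-- At the start, no label has been written, and all coordinates remain. -/
theorem LabelProgress.init (h : CubeLabeling V E S l) (L : ℕ → ℕ → Bool) {rep : ℕ → ℕ}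
    (hrep : ∀ u ∈ V, rep u = u) : LabelProgress V S l rep 0 L S := by
  refine ⟨subset_rfl, fun u hu v hv => ?_, fun u _ v _ => by simp [diffSet]⟩
  rw [hrep u hu, hrep v hv]
  exact ⟨fun h => by rw [h, diffSet_self], h.eq_of_diffSet_eq_empty hu hv⟩

/-- One phase of the computation: the half-spaces of `c` edges at `v` are appended to the labels,
and the edges between different half-spaces are contracted. -/
theorem LabelProgress.next {rep rep' : ℕ → ℕ} {d : ℕ} {L L' : ℕ → ℕ → Bool} {T : Finset ℕ}
    (hL : LabelProgress V S l rep d L T) (h : CubeLabeling V E S l) (hE : IsGraphOn V E)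
    (hr : IsRep V rep) {v m c : ℕ} {nb co lab : ℕ → ℕ}
    (hco : ∀ j < m, diffSet T l v (nb j) = {co j})
    (hinj : ∀ i < m, ∀ j < m, co i = co j → i = j) (hc : c ≤ m)
    (hlab : ∀ y ∈ repSet V rep, ∀ b, (lab y).testBit b = true ↔ b < c ∧ co b ∈ diffSet T l v y)
    (hm : IsMerged V (fun x y => quotAdj E rep x y ∧ lab x ≠ lab y) rep rep')
    (hL0 : ∀ z ∈ V, ∀ i < d, L' z i = L z i)
    (hL1 : ∀ z ∈ V, ∀ j < c, L' z (d + j) = (lab (rep z)).testBit j) :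
    LabelProgress V S l rep' (d + c) L' (T \ (Finset.range c).image co) := by
  obtain ⟨hT, hrep, hcard⟩ := hL
  set I := (Finset.range c).image co with hI
  have hQ := h.quot hE hT hr hrep
  have hIT : I ⊆ T := by
    intro i hi
    obtain ⟨j, hj, rfl⟩ := Finset.mem_image.1 hi
    have : co j ∈ diffSet T l v (nb j) := by
      rw [hco j (by have := Finset.mem_range.1 hj; omega)]; simp
    exact (mem_diffSet.1 this).1
  have hbit : ∀ x ∈ repSet V rep, ∀ y ∈ repSet V rep, ∀ j < c,
      (lab x).testBit j ≠ (lab y).testBit j ↔ co j ∈ diffSet T l x y := by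
    intro x hx y hy j hj
    have hjT : co j ∈ T := hIT (Finset.mem_image.2 ⟨j, Finset.mem_range.2 hj, rfl⟩)
    have h1 := hlab x hx j
    have h2 := hlab y hy j
    simp only [mem_diffSet, hj, hjT, true_and] at h1 h2 ⊢
    revert h1 h2
    cases (lab x).testBit j <;> cases (lab y).testBit j <;> cases l v (co j) <;>
      cases l x (co j) <;> cases l y (co j) <;> simp
  have hrepd : ∀ u ∈ V, diffSet T l u (rep u) = ∅ := fun u hu =>
    (hrep u hu _ (hr.mem u hu)).1 (hr.idem u hu).symm
  have hsub : ∀ {A B : Finset ℕ} (u v), A ⊆ B → diffSet A l u v ⊆ diffSet B l u v := fun u v h =>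
    Finset.filter_subset_filter _ h
  have hTI : ∀ u v, diffSet T l u v = ∅ → diffSet (T \ I) l u v = ∅ := fun u v h =>
    Finset.subset_empty.1 (h ▸ hsub u v Finset.sdiff_subset)
  refine ⟨Finset.sdiff_subset.trans hT, fun x hx y hy => ⟨fun hxy => ?_, fun hxy => ?_⟩,
    fun x hx y hy => ?_⟩
  · -- merged edges flip only coordinates in `I`
    have key := hm.least (fun a b => diffSet (T \ I) l a b = ∅)
      ⟨fun a => diffSet_self _ _ _, fun h => by rw [diffSet_comm]; exact h,
        fun h h' => by rw [diffSet_congr_left h]; exact h'⟩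
      (fun u hu => hTI _ _ (hrepd u hu)) (by
        rintro a b ⟨hab, hne⟩
        have ha := (isGraphOn_quotAdj hE hr).left_mem hab
        have hb := (isGraphOn_quotAdj hE hr).right_mem hab
        obtain ⟨i, hi⟩ := hQ.flip hab
        obtain ⟨j, hj⟩ : ∃ j, (lab a).testBit j ≠ (lab b).testBit j := by
          by_contra! hall
          exact hne (Nat.eq_of_testBit_eq hall)
        have hjc : j < c := by
          by_contra hjc
          have h1 := hlab a ha j
          have h2 := hlab b hb j
          simp only [hjc, false_and, iff_false, Bool.not_eq_true] at h1 h2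
          exact hj (h1.trans h2.symm)
        have hji := (hbit a ha b hb j hjc).1 hj
        rw [hi, Finset.mem_singleton] at hji
        ext k
        simp only [mem_diffSet, Finset.mem_sdiff, Finset.notMem_empty, iff_false]
        rintro ⟨⟨hkT, hkI⟩, hk⟩
        have : k ∈ diffSet T l a b := mem_diffSet.2 ⟨hkT, hk⟩
        rw [hi, Finset.mem_singleton] at this
        subst this
        exact hkI (Finset.mem_image.2 ⟨j, Finset.mem_range.2 hjc, hji⟩))
    rw [diffSet_congr_left (key x hx), hxy, diffSet_comm]
    exact key y hy
  · -- induction along a shortest path, all edges of which flip coordinates in `I`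
    have key : ∀ k, ∀ a ∈ repSet V rep, ∀ b ∈ repSet V rep, (diffSet T l a b).card = k →
        diffSet (T \ I) l a b = ∅ → rep' a = rep' b := by
      intro k
      induction k with
      | zero =>
        intro a ha b hb h0 _
        rw [hQ.eq_of_diffSet_eq_empty ha hb (Finset.card_eq_zero.1 h0)]
      | succ k ih =>
        intro a ha b hb hk hab
        obtain ⟨z, i, haz, hi, hib⟩ := hQ.toward ha hb fun h => by
          rw [h, diffSet_self] at hk
          simp at hk
        have hz := (isGraphOn_quotAdj hE hr).right_mem haz
        have hiI : i ∈ I := by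
          by_contra hiI
          have : i ∈ diffSet (T \ I) l a b := by
            rw [mem_diffSet] at hib ⊢
            exact ⟨Finset.mem_sdiff.2 ⟨hib.1, hiI⟩, hib.2⟩
          simp [hab] at this
        obtain ⟨j, hj, rfl⟩ := Finset.mem_image.1 hiI
        have hne : lab a ≠ lab z := fun he => by
          refine (hbit a ha z hz j (Finset.mem_range.1 hj)).2 ?_ (by rw [he])
          simp [hi]
        rw [hm.merged ⟨haz, hne⟩]
        have h0 : diffSet (T \ I) l a z = ∅ := by
          ext k
          simp only [mem_diffSet, Finset.mem_sdiff, Finset.notMem_empty, iff_false]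
          rintro ⟨⟨hkT, hkI⟩, hk⟩
          have : k ∈ diffSet T l a z := mem_diffSet.2 ⟨hkT, hk⟩
          rw [hi, Finset.mem_singleton] at this
          exact hkI (this ▸ hiI)
        refine ih z hz b hb ?_ (by rw [← diffSet_congr_left h0]; exact hab)
        have := card_diffSet_of_mem hi hib
        omega
    rw [← hm.coarse x hx, ← hm.coarse y hy]
    refine key _ _ (hr.mem_repSet hx) _ (hr.mem_repSet hy) rfl ?_
    rw [← diffSet_congr_left (hTI _ _ (hrepd x hx)), ← diffSet_congr_right (hTI _ _ (hrepd y hy))]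
    exact hxy
  · have hS : S \ (T \ I) = (S \ T) ∪ I := by
      ext i
      have := @hIT i
      have := @hT i
      simp only [Finset.mem_sdiff, Finset.mem_union]
      tauto
    have e1 : diffSet (S \ (T \ I)) l x y = diffSet (S \ T) l x y ∪ diffSet I l x y := by
      rw [hS]; exact Finset.filter_union ..
    have hdisj : Disjoint (diffSet (S \ T) l x y) (diffSet I l x y) := by
      refine Finset.disjoint_filter_filter ?_
      rw [Finset.disjoint_left]
      exact fun i hi hi' => (Finset.mem_sdiff.1 hi).2 (hIT hi')
    rw [e1, Finset.card_union_of_disjoint hdisj, ← hcard x hx y hy]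
    have e2 : diffSet (Finset.range (d + c)) L' x y = diffSet (Finset.range d) L x y ∪
        ((Finset.range c).filter fun j => co j ∈ diffSet T l x y).image (d + ·) := by
      ext i
      simp only [mem_diffSet, Finset.mem_range, Finset.mem_union, Finset.mem_image,
        Finset.mem_filter]
      by_cases hi : i < d
      · have : ¬ ∃ a, (a < c ∧ co a ∈ T ∧ l x (co a) ≠ l y (co a)) ∧ d + a = i := by
          rintro ⟨a, -, ha⟩; omega
        simp only [this, or_false, hL0 x hx i hi, hL0 y hy i hi, hi, true_and,
          (by omega : i < d + c)]
      · simp only [hi, false_and, false_or]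
        constructor
        · rintro ⟨hic, hne⟩
          refine ⟨i - d, ⟨by omega, ?_⟩, by omega⟩
          have h1 := hL1 x hx (i - d) (by omega)
          have h2 := hL1 y hy (i - d) (by omega)
          rw [show d + (i - d) = i by omega] at h1 h2
          rw [h1, h2, hbit _ (hr.mem_repSet hx) _ (hr.mem_repSet hy) _ (by omega),
            ← diffSet_congr_left (hrepd x hx), ← diffSet_congr_right (hrepd y hy),
            mem_diffSet] at hne
          exact hne
        · rintro ⟨j, ⟨hj, hne⟩, rfl⟩
          refine ⟨by omega, ?_⟩
          rw [hL1 x hx j hj, hL1 y hy j hj,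
            hbit _ (hr.mem_repSet hx) _ (hr.mem_repSet hy) _ (by omega),
            ← diffSet_congr_left (hrepd x hx), ← diffSet_congr_right (hrepd y hy), mem_diffSet]
          exact hne
    have e3 : diffSet I l x y =
        ((Finset.range c).filter fun j => co j ∈ diffSet T l x y).image co := by
      ext i
      simp only [mem_diffSet, hI, Finset.mem_image, Finset.mem_range, Finset.mem_filter]
      constructor
      · rintro ⟨⟨j, hj, rfl⟩, hne⟩
        exact ⟨j, ⟨hj, hIT (Finset.mem_image.2 ⟨j, Finset.mem_range.2 hj, rfl⟩), hne⟩, rfl⟩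
      · rintro ⟨j, ⟨hj, -, hne⟩, rfl⟩
        exact ⟨⟨j, hj, rfl⟩, hne⟩
    rw [e2, e3, Finset.card_union_of_disjoint, Finset.card_image_of_injective _
      (add_right_injective d), Finset.card_image_of_injOn]
    · intro i hi j hj
      simp only [Finset.coe_filter, Finset.mem_range, Set.mem_ofPred_eq] at hi hj
      exact hinj i (by omega) j (by omega)
    · rw [Finset.disjoint_left]
      intro i hi hi'
      obtain ⟨j, -, rfl⟩ := Finset.mem_image.1 hi'
      simp [mem_diffSet] at hi

/-- When no edge is left after the contractions, the labels are complete. -/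
theorem LabelProgress.cubeLabeling {rep : ℕ → ℕ} {d : ℕ} {L : ℕ → ℕ → Bool} {T : Finset ℕ}
    (hL : LabelProgress V S l rep d L T) (h : CubeLabeling V E S l) (hE : IsGraphOn V E)
    (hr : IsRep V rep) (hno : ∀ a b, ¬ quotAdj E rep a b) :
    CubeLabeling V E (Finset.range d) L := by
  obtain ⟨hT, hrep, hcard⟩ := hL
  refine h.of_card_eq hE fun u hu v hv => ?_
  rw [hcard u hu v hv]
  have huv : rep u = rep v := by
    by_contra hne
    obtain ⟨x, i, hx, -⟩ := (h.quot hE hT hr hrep).toward (hr.mem_repSet hu) (hr.mem_repSet hv) hne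
    exact hno _ _ hx
  have h0 := (hrep u hu v hv).1 huv
  congr 1
  ext i
  simp only [mem_diffSet, Finset.mem_sdiff]
  refine ⟨fun h => ⟨h.1.1, h.2⟩, fun h => ⟨⟨h.1, fun hi => ?_⟩, h.2⟩⟩
  have : i ∈ diffSet T l u v := mem_diffSet.2 ⟨hi, h.2⟩
  simp [h0] at this

end

/-! ### The program -/

namespace WordRAM

attribute [simp] wp Expr.val Expr.Safe BinOp.val BinOp.Safe Test.val Test.Safe Expr.cost Test.cost

infixr:30 " ;; " => Prog.seq
infix:40 " ≔ " => Prog.assign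
infixl:65 " ⊹ " => Expr.op BinOp.add

/- Registers and tables are named by notations and not by definitions, so that `decide` and `simp`
see numerals. Register `1` and the tables `0` and `1` are those of the output and the input. Tables
with one index use column `0`. -/
notation "rD" => (1 : ℕ)
notation "rN" => (2 : ℕ)
notation "rPow" => (3 : ℕ)
notation "rLog" => (4 : ℕ)
notation "rU" => (5 : ℕ)
notation "rV" => (6 : ℕ)
notation "rQuo" => (7 : ℕ)
notation "rRem" => (8 : ℕ)
notation "rPhase" => (9 : ℕ)
notation "rMaxDeg" => (10 : ℕ)
notation "rRoot" => (11 : ℕ)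
notation "rMask" => (12 : ℕ)
notation "rC" => (13 : ℕ)
notation "rH" => (14 : ℕ)
notation "rTail" => (15 : ℕ)
notation "rX" => (16 : ℕ)
notation "rDist" => (17 : ℕ)
notation "rLab" => (18 : ℕ)
notation "rDeg" => (19 : ℕ)
notation "rJ" => (20 : ℕ)
notation "rY" => (21 : ℕ)
notation "rA" => (22 : ℕ)
notation "rB" => (23 : ℕ)
notation "rStamp" => (24 : ℕ)
notation "rOk" => (25 : ℕ)
notation "rCnt" => (26 : ℕ)
notation "rBad" => (27 : ℕ)
notation "rIdx" => (28 : ℕ)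
notation "rXor" => (29 : ℕ)
notation "rAcc" => (30 : ℕ)
notation "rNumBlk" => (31 : ℕ)
notation "rBlk" => (32 : ℕ)

notation "tAdj" => (0 : ℕ)
notation "tLabel" => (1 : ℕ)
notation "tNb" => (2 : ℕ)
notation "tDeg" => (3 : ℕ)
notation "tRep" => (4 : ℕ)
notation "tDist" => (5 : ℕ)
notation "tLab" => (6 : ℕ)
notation "tQueue" => (7 : ℕ)
notation "tStamp" => (8 : ℕ)
notation "tNewNb" => (9 : ℕ)
notation "tNewDeg" => (10 : ℕ)
notation "tRow" => (11 : ℕ)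
notation "tIdx" => (12 : ℕ)
notation "tColOne" => (13 : ℕ)
notation "tColZero" => (14 : ℕ)
notation "tCls" => (15 : ℕ)

/-- Cell `(i, 0)` of table `T`. -/
abbrev Expr.at (T : ℕ) (i : Expr) : Expr := .load T i (.const 0)

/-- Compute `k = log₂ n` and `2 ^ k`. -/
def sizeProg : Prog :=
  rPow ≔ .const 1 ;;
  rLog ≔ .const 0 ;;
  .forLoop rU rN (
    .branch (.not (.lt (.op .sub (.reg rN) (.reg rPow)) (.reg rPow)))
      (rPow ≔ .reg rPow ⊹ .reg rPow ;; rLog ≔ .reg rLog ⊹ .const 1)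
      .nop)

/-- Compute adjacency lists and, as a number in base `n` with the digits `rQuo` and `rRem`, the sum
of the degrees. Every vertex represents itself. -/
def listProg : Prog :=
  rQuo ≔ .const 0 ;;
  rRem ≔ .const 0 ;;
  .forLoop rU rN (
    .store tRep (.reg rU) (.const 0) (.reg rU) ;;
    .forLoop rV rN (
      .branch (.eq (.load tAdj (.reg rU) (.reg rV)) (.const 1))
        (.store tNb (.reg rU) (.at tDeg (.reg rU)) (.reg rV) ;;
         .store tDeg (.reg rU) (.const 0) (.at tDeg (.reg rU) ⊹ .const 1) ;;
         rRem ≔ .reg rRem ⊹ .const 1 ;;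
         .branch (.eq (.reg rRem) (.reg rN))
           (rRem ≔ .const 0 ;; rQuo ≔ .reg rQuo ⊹ .const 1)
           .nop)
        .nop))

/-- Find a vertex of maximal degree. -/
def maxDegProg : Prog :=
  rMaxDeg ≔ .const 0 ;;
  rRoot ≔ .const 0 ;;
  .forLoop rU rN (
    .branch (.lt (.reg rMaxDeg) (.at tDeg (.reg rU)))
      (rMaxDeg ≔ .at tDeg (.reg rU) ;; rRoot ≔ .reg rU)
      .nop)

/-- Prepare the breadth-first search: the neighbors of the root are put into the queue, and the
first `k` of them get the bits `2 ^ 0, …, 2 ^ (k - 1)`. -/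
def bfsInitProg : Prog :=
  .forLoop rU rN (
    .store tDist (.reg rU) (.const 0) (.const 0) ;;
    .store tLab (.reg rU) (.const 0) (.const 0)) ;;
  .store tDist (.reg rRoot) (.const 0) (.const 1) ;;
  rMask ≔ .const 1 ;;
  rC ≔ .const 0 ;;
  .forLoop rJ rMaxDeg (
    rY ≔ .load tNb (.reg rRoot) (.reg rJ) ;;
    .store tDist (.reg rY) (.const 0) (.const 1) ;;
    .store tLab (.reg rY) (.const 0) (.reg rMask) ;;
    .store tQueue (.reg rJ) (.const 0) (.reg rY) ;;
    .branch (.eq (.reg rMask) (.const 0)) .nop (rC ≔ .reg rC ⊹ .const 1) ;;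
    rMask ≔ .reg rMask ⊹ .reg rMask ;;
    .branch (.eq (.reg rMask) (.reg rPow)) (rMask ≔ .const 0) .nop) ;;
  rTail ≔ .reg rMaxDeg

/-- Breadth-first search. Table `tDist` holds the distances from the root, but `1` at the root and
`0` at vertices that have not been reached; the bits of a vertex are those of its predecessors. -/
def bfsProg : Prog :=
  .forLoop rH rN (
    .branch (.lt (.reg rH) (.reg rTail))
      (rX ≔ .at tQueue (.reg rH) ;;
       rDist ≔ .at tDist (.reg rX) ⊹ .const 1 ;;
       rLab ≔ .at tLab (.reg rX) ;;
       rDeg ≔ .at tDeg (.reg rX) ;;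
       .forLoop rJ rDeg (
         rY ≔ .load tNb (.reg rX) (.reg rJ) ;;
         .branch (.eq (.at tDist (.reg rY)) (.const 0))
           (.store tDist (.reg rY) (.const 0) (.reg rDist) ;;
            .store tQueue (.reg rTail) (.const 0) (.reg rY) ;;
            rTail ≔ .reg rTail ⊹ .const 1)
           .nop ;;
         .branch (.eq (.at tDist (.reg rY)) (.reg rDist))
           (.store tLab (.reg rY) (.const 0) (.op .or (.at tLab (.reg rY)) (.reg rLab)))
           .nop))
      .nop)

/-- Append the bits found by the search to the labels of all vertices. -/
def outProg : Prog :=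
  rMask ≔ .const 1 ;;
  .forLoop rJ rC (
    .forLoop rU rN (
      .branch (.eq (.op .and (.at tLab (.at tRep (.reg rU))) (.reg rMask)) (.const 0))
        .nop
        (.store tLabel (.reg rU) (.reg rD) (.const 1))) ;;
    rMask ≔ .reg rMask ⊹ .reg rMask ;;
    rD ≔ .reg rD ⊹ .const 1)

/-- Merge the classes of adjacent vertices whose bits are different. -/
def mergeProg : Prog :=
  .forLoop rU rN (
    rDeg ≔ .at tDeg (.reg rU) ;;
    .forLoop rJ rDeg (
      rY ≔ .load tNb (.reg rU) (.reg rJ) ;;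
      rA ≔ .at tRep (.reg rU) ;;
      rB ≔ .at tRep (.reg rY) ;;
      .branch (.and (.not (.eq (.at tLab (.reg rU)) (.at tLab (.reg rY))))
          (.not (.eq (.reg rA) (.reg rB))))
        (.forLoop rV rN (
          .branch (.eq (.at tRep (.reg rV)) (.reg rA))
            (.store tRep (.reg rV) (.const 0) (.reg rB))
            .nop))
        .nop))

/-- Compute the adjacency lists of the quotient graph. Every pair of adjacent classes is marked with
the number of the phase when it is met for the first time. -/
def rebuildProg : Prog :=
  rStamp ≔ .reg rPhase ⊹ .const 1 ;;
  .forLoop rU rN (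
    rDeg ≔ .at tDeg (.reg rU) ;;
    .forLoop rJ rDeg (
      rA ≔ .at tRep (.reg rU) ;;
      rB ≔ .at tRep (.load tNb (.reg rU) (.reg rJ)) ;;
      .branch (.and (.not (.eq (.reg rA) (.reg rB)))
          (.not (.eq (.load tStamp (.reg rA) (.reg rB)) (.reg rStamp))))
        (.store tStamp (.reg rA) (.reg rB) (.reg rStamp) ;;
         .store tNewNb (.reg rA) (.at tNewDeg (.reg rA)) (.reg rB) ;;
         .store tNewDeg (.reg rA) (.const 0) (.at tNewDeg (.reg rA) ⊹ .const 1))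
        .nop))

/-- Move the new adjacency lists to the place of the old ones. -/
def copyProg : Prog :=
  .forLoop rU rN (
    rDeg ≔ .at tNewDeg (.reg rU) ;;
    .store tDeg (.reg rU) (.const 0) (.reg rDeg) ;;
    .store tNewDeg (.reg rU) (.const 0) (.const 0) ;;
    .forLoop rJ rDeg (
      .store tNb (.reg rU) (.reg rJ) (.load tNewNb (.reg rU) (.reg rJ))))

/-- Search from the root, which has a neighbor, and contract the edges found. -/
def contractProg : Prog :=
  bfsInitProg ;; bfsProg ;; outProg ;; mergeProg ;; rebuildProg ;; copyProg

/-- One phase: contract edges found from a vertex of maximal degree, if there is an edge at all. -/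
def phaseProg : Prog :=
  maxDegProg ;;
  .branch (.lt (.const 0) (.reg rMaxDeg)) contractProg .nop

/-- Compute candidate labels of length `rD`. -/
def labelProg : Prog :=
  rD ≔ .const 0 ;;
  .forLoop rPhase rN phaseProg

/-- Go to the next bit position; every word holds `k` bits. -/
def advanceProg : Prog :=
  rMask ≔ .reg rMask ⊹ .reg rMask ;;
  .branch (.eq (.reg rMask) (.reg rPow)) (rMask ≔ .const 1 ;; rBlk ≔ .reg rBlk ⊹ .const 1) .nop

/-- Pack the label of every vertex into words. Table `tIdx` recovers coordinate `i` from the place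
of bit `i`, as the number `i + 1`. -/
def packRowsProg : Prog :=
  .forLoop rU rN (
    rBlk ≔ .const 0 ;;
    rMask ≔ .const 1 ;;
    .forLoop rJ rD (
      .branch (.eq (.load tLabel (.reg rU) (.reg rJ)) (.const 1))
        (.store tRow (.reg rU) (.reg rBlk)
          (.op .or (.load tRow (.reg rU) (.reg rBlk)) (.reg rMask)))
        .nop ;;
      .store tIdx (.reg rBlk) (.reg rMask) (.reg rJ ⊹ .const 1) ;;
      advanceProg) ;;
    rNumBlk ≔ .reg rBlk ⊹ .const 1)

/-- Pack every coordinate of the labels, and its complement, into words. -/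
def packColsProg : Prog :=
  .forLoop rJ rD (
    rBlk ≔ .const 0 ;;
    rMask ≔ .const 1 ;;
    .forLoop rU rN (
      .branch (.eq (.load tLabel (.reg rU) (.reg rJ)) (.const 1))
        (.store tColOne (.reg rJ) (.reg rBlk)
          (.op .or (.load tColOne (.reg rJ) (.reg rBlk)) (.reg rMask)))
        (.store tColZero (.reg rJ) (.reg rBlk)
          (.op .or (.load tColZero (.reg rJ) (.reg rBlk)) (.reg rMask))) ;;
      advanceProg))

/-- List the coordinates flipped by the edges at vertex `rU`, and check that every such edge flips
exactly one coordinate. -/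
def flipProg : Prog :=
  rCnt ≔ .const 0 ;;
  .forLoop rV rN (
    .branch (.eq (.load tAdj (.reg rU) (.reg rV)) (.const 1))
      (rBad ≔ .const 0 ;;
       rIdx ≔ .const 0 ;;
       .forLoop rJ rNumBlk (
         rXor ≔ .op .xor (.load tRow (.reg rU) (.reg rJ)) (.load tRow (.reg rV) (.reg rJ)) ;;
         .branch (.eq (.reg rXor) (.const 0))
           .nop
           (rBad ≔ .reg rBad ⊹ .const 1 ;;
            rIdx ≔ .load tIdx (.reg rJ) (.reg rXor))) ;;
       .branch (.and (.eq (.reg rBad) (.const 1)) (.not (.eq (.reg rIdx) (.const 0))))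
         (.store tCls (.reg rCnt) (.const 0) (.op .sub (.reg rIdx) (.const 1)) ;;
          rCnt ≔ .reg rCnt ⊹ .const 1)
         (rOk ≔ .const 0))
      .nop)

/-- Collect in the word `rAcc` the vertices of block `rBlk` that differ from vertex `rU` at one of
the coordinates listed. -/
def collectProg : Prog :=
  rAcc ≔ .const 0 ;;
  .forLoop rJ rCnt (
    rIdx ≔ .at tCls (.reg rJ) ;;
    .branch (.eq (.load tLabel (.reg rU) (.reg rIdx)) (.const 1))
      (rAcc ≔ .op .or (.reg rAcc) (.load tColZero (.reg rIdx) (.reg rBlk)))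
      (rAcc ≔ .op .or (.reg rAcc) (.load tColOne (.reg rIdx) (.reg rBlk))))

/-- Check that every vertex but `rU` differs from `rU` at one of the coordinates listed. -/
def towardProg : Prog :=
  rBlk ≔ .const 0 ;;
  rMask ≔ .const 1 ;;
  rAcc ≔ .const 0 ;;
  .forLoop rV rN (
    .branch (.eq (.reg rMask) (.const 1)) collectProg .nop ;;
    .branch (.and (.eq (.op .and (.reg rAcc) (.reg rMask)) (.const 0))
        (.not (.eq (.reg rU) (.reg rV))))
      (rOk ≔ .const 0)
      .nop ;;
    advanceProg)

/-- Check the candidate labels. -/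
def checkProg : Prog :=
  rOk ≔ .const 1 ;;
  .forLoop rU rN (flipProg ;; towardProg)

/-- Recognize partial cubes with at least two vertices. -/
def largeProg : Prog :=
  rN ≔ .reg 0 ;;
  sizeProg ;;
  listProg ;;
  .branch (.lt (.reg rLog ⊹ .reg rLog) (.reg rQuo))
    (0 ≔ .const 0)
    (labelProg ;; packRowsProg ;; packColsProg ;; checkProg ;; 0 ≔ .reg rOk)

/-- Recognize partial cubes. -/
def partialCubeProg : Prog :=
  .branch (.and (.not (.eq (.reg 0) (.const 0))) (.not (.eq (.reg 0) (.const 1))))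
    largeProg
    (0 ≔ .const 1)

end WordRAM

/-! ### Sizes and adjacency lists -/

namespace WordRAM

/-- `rPow` is doubled as long as this does not exceed `n`. The test is written with a subtraction,
since `2 * rPow` might not fit into a word. -/
theorem wp_sizeProg {w n : ℕ} {s : Mem} (hn : 1 ≤ n) (hw : n < 2 ^ w) (hN : s.reg rN = n) :
    wp w sizeProg (fun s' t => t ≤ 30 * n + 20 ∧ s'.reg rPow = 2 ^ s'.reg rLog ∧
      2 ^ s'.reg rLog ≤ n ∧ n < 2 ^ (s'.reg rLog + 1)) s := by
  simp only [sizeProg, wp]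
  refine ⟨by simp, by simp, ?_⟩
  refine wp_forLoop_const (fun j s' => s'.reg rPow = 2 ^ s'.reg rLog ∧ 2 ^ s'.reg rLog ≤ n ∧
    (s'.reg rLog = j ∨ n < 2 ^ (s'.reg rLog + 1))) 15 (by decide) (by decide) (by decide)
    (by simpa [hN] using hw) (by simp; omega) ?_ ?_
  · intro j hj s' hF hr ⟨h1, h2, h3⟩
    have hN' : s'.reg rN = n := by rw [hF.reg _ (by decide)]; simp [hN]
    simp
    have := pow_succ 2 (s'.reg rLog)
    refine ⟨by omega, fun h => ?_, fun h => ?_⟩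
    · rw [pow_succ]
      omega
    · omega
  · intro s' t hF ⟨h1, h2, h3⟩ ht
    simp [hN] at ht h3 ⊢
    have := Nat.lt_two_pow_self (n := s'.reg rLog + 1)
    refine ⟨by omega, h1, h2, ?_⟩
    rcases h3 with h3 | h3
    · rw [h3]; rw [h3] at this; omega
    · exact h3

/-- The tables of the adjacency lists of the relation `E` on `0, …, n - 1`. -/
def HasLists (s : Mem) (n : ℕ) (E : ℕ → ℕ → Prop) : Prop :=
  ∀ u < n, IsNbList E u (s.tab tNb u) (s.tab tDeg u 0)

/-- The sum of the degrees may exceed `2 ^ w`; this is why it is kept as two digits. -/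
theorem wp_listProg {w n : ℕ} {E : ℕ → ℕ → Prop} {s : Mem} (hn : 1 ≤ n) (hw : n < 2 ^ w)
    (hN : s.reg rN = n) (hE : IsGraphOn (Set.Iio n) E)
    (hA : ∀ u < n, ∀ v < n, s.tab tAdj u v = 1 ↔ E u v) (hA1 : ∀ u v, s.tab tAdj u v ≤ 1)
    (hdeg : ∀ u < n, s.tab tDeg u 0 = 0) :
    wp w listProg (fun s' t => t ≤ 100 * n ^ 2 + 100 ∧ HasLists s' n E ∧
      (∀ u < n, s'.tab tRep u 0 = u) ∧ s'.reg rRem < n ∧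
      s'.reg rQuo * n + s'.reg rRem = ∑ u ∈ Finset.range n, s'.tab tDeg u 0) s := by
  have hw0 : w ≠ 0 := by rintro rfl; simp at hw; omega
  simp only [listProg, wp]
  refine ⟨trivial, trivial, ?_⟩
  refine wp_forLoop_const (fun j s' => (∀ u < j, IsNbList E u (s'.tab tNb u) (s'.tab tDeg u 0)) ∧
    (∀ u < n, j ≤ u → s'.tab tDeg u 0 = 0) ∧
    (∀ u < j, s'.tab tRep u 0 = u) ∧ s'.reg rRem < n ∧
      s'.reg rQuo * n + s'.reg rRem = ∑ u ∈ Finset.range j, s'.tab tDeg u 0)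
    (n * 50 + 10) (by decide) (by decide) (by decide) (by simpa [hN] using hw)
    ⟨by simp, by simpa using hdeg, by simp, by simp; omega, by simp⟩ ?_ ?_
  · rintro u hu s1 hF1 hu1 ⟨h1, h2, h3, h4, h5⟩
    simp [hN] at hu
    have hN1 : s1.reg rN = n := by rw [hF1.reg _ (by decide)]; simp [hN]
    simp only [wp]
    refine ⟨⟨trivial, by simp [hu1]; omega⟩, ⟨trivial, by simp⟩, trivial, ?_⟩
    simp only [Expr.val, hu1]
    refine wp_forLoop_const (fun j s' =>
      IsNbList (fun a b => E a b ∧ b < j) u (s'.tab tNb u) (s'.tab tDeg u 0) ∧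
      (∀ v, v ≠ u → s'.tab tNb v = s1.tab tNb v ∧ s'.tab tDeg v 0 = s1.tab tDeg v 0) ∧
      s'.reg rRem < n ∧ s'.reg rQuo * n + s'.reg rRem =
        ∑ v ∈ Finset.range u, s1.tab tDeg v 0 + s'.tab tDeg u 0) 43
      (by decide) (by decide) (by decide) (by simpa [hN1] using hw) ?_ ?_ ?_
    · refine ⟨?_, by simp, by simp [h4], ?_⟩
      · simp [h2 u hu le_rfl]
        exact .nil _ (by simp)
      · simp [h2 u hu le_rfl, h5]
    · rintro j hj s2 hF2 hj2 ⟨g1, g2, g3, g4⟩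
      simp [hN1] at hj
      have hN2 : s2.reg rN = n := by rw [hF2.reg _ (by decide)]; simp [hN1]
      have hU2 : s2.reg rU = u := by rw [hF2.reg _ (by decide)]; simp [hu1]
      have hA2 : s2.tab tAdj u j = 1 ↔ E u j := by
        rw [hF2.tab _ (by decide), ← hA u hu j hj]
        simp
        rw [hF1.tab _ (by decide)]
        simp
      have hA2' : s2.tab tAdj u j < 2 ^ w := by
        rw [hF2.tab _ (by decide)]
        simp
        rw [hF1.tab _ (by decide)]
        have := hA1 u j
        simp
        omega
      have hle := g1.le (j := j) (fun y hy => hy.2)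
      have hE1 : ∀ y, (E u y ∧ y ≤ j) ↔ (E u y ∧ y < j) ∨ (E u y ∧ y = j) := by
        intro y
        rw [Nat.le_iff_lt_or_eq]
        tauto
      simp only [wp, Expr.val, hU2, hj2]
      have hlt : s2.tab tDeg u 0 < 2 ^ w := by omega
      simp [hU2, hj2, hN2, hA2, hw, hw0, hA2', hlt, (by omega : u < 2 ^ w), (by omega : j < 2 ^ w),
        (by omega : s2.reg rRem + 1 < 2 ^ w)]
      refine ⟨fun hE' => ⟨?_, ?_⟩, fun hE' => ?_⟩
      · intro hr
        have hs := g1.snoc (E' := fun a b => E a b ∧ b ≤ j)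
          (nb' := fun i => if i = s2.tab tDeg u 0 then j else s2.tab tNb u i) (z := j)
          (by simp) (fun i hi => by simp; omega) (by simp) (fun y => by rw [hE1]; grind)
        refine ⟨hs, fun v hv => by simpa [hv] using g2 v hv, by omega, ?_⟩
        rw [Nat.add_mul]; omega
      · intro hr
        have hs := g1.snoc (E' := fun a b => E a b ∧ b ≤ j)
          (nb' := fun i => if i = s2.tab tDeg u 0 then j else s2.tab tNb u i) (z := j)
          (by simp) (fun i hi => by simp; omega) (by simp) (fun y => by rw [hE1]; grind)
        refine ⟨hs, fun v hv => by simpa [hv] using g2 v hv, by omega, by omega⟩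
      · refine ⟨g1.congr rfl (fun _ _ => rfl) fun y => by rw [hE1]; grind, g2, g3, g4⟩
    · rintro s2 t hF2 ⟨g1, g2, g3, g4⟩ ht
      simp [hN1] at ht g1
      refine ⟨by simp; omega, ?_, ?_, ?_, g3, ?_⟩
      · intro v hv
        rcases Nat.lt_succ_iff_lt_or_eq.1 hv with hv | rfl
        · have := g2 v (by omega)
          simp only [Mem.tab_setReg]
          rw [this.1, this.2]
          exact h1 v hv
        · exact g1.congr rfl (fun _ _ => rfl) fun y => ⟨fun h => ⟨h, hE.right_mem h⟩, fun h => h.1⟩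
      · intro v hv hv'
        simp only [Mem.tab_setReg]
        rw [(g2 v (by omega)).2]
        exact h2 v hv (by omega)
      · intro v hv
        simp only [Mem.tab_setReg]
        rw [hF2.tab _ (by decide)]
        by_cases hvu : v = u
        · simp [hvu]
        · simpa [hvu] using h3 v (by omega)
      · simp only [Mem.tab_setReg, Mem.reg_setReg]
        rw [Finset.sum_range_succ, ← Finset.sum_congr rfl fun v hv => (g2 v (by
          have := Finset.mem_range.1 hv; omega)).2.symm]
        exact g4
  · rintro s' t hF ⟨h1, h2, h3, h4, h5⟩ ht
    simp [hN] at h1 h3 h5 ht ⊢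
    refine ⟨?_, h1, h3, h4, h5⟩
    nlinarith
end WordRAM

/-! ### Breadth-first search -/

namespace WordRAM

/-- The state of a breadth-first search from `v`: the tables of distances and bits, and the queue.
The bits `lab0` of `v` and of its neighbors are given. -/
structure BfsState (n k v : ℕ) (E : ℕ → ℕ → Prop) (lab0 dist lab que : ℕ → ℕ) (tail : ℕ) :
    Prop where
  que_lt : ∀ i < tail, que i < n
  que_ne : ∀ i < tail, que i ≠ v
  inj : ∀ i < tail, ∀ j < tail, que i = que j → i = j
  dist_pos : ∀ i < tail, 1 ≤ dist (que i)
  dist_le : ∀ i < tail, dist (que i) ≤ i + 1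
  visited : ∀ y < n, dist y ≠ 0 → y = v ∨ ∃ i < tail, que i = y
  root : dist v = 1 ∧ lab v = lab0 v
  first : ∀ y, E v y → dist y = 1 ∧ lab y = lab0 y
  lab_lt : ∀ y < n, lab y < 2 ^ k
  lab_zero : ∀ y < n, dist y = 0 → lab y = 0

namespace BfsState

variable {n k v : ℕ} {E : ℕ → ℕ → Prop} {lab0 dist lab que : ℕ → ℕ} {tail : ℕ}

theorem tail_lt (h : BfsState n k v E lab0 dist lab que tail) (hv : v < n) : tail < n := by
  have := Finset.card_le_card_of_injOn (s := Finset.range tail) (t := (Finset.range n).erase v) que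
    (fun i hi => by
      have hi : i < tail := by simpa using hi
      simpa [and_comm] using And.intro (h.que_ne i hi) (h.que_lt i hi))
    (fun i hi j hj => h.inj i (by simpa using hi) j (by simpa using hj))
  rw [Finset.card_range, Finset.card_erase_of_mem (by simpa using hv), Finset.card_range] at this
  omega

/-- A search goes through every adjacency list at most once. -/
theorem sum_deg_le (h : BfsState n k v E lab0 dist lab que tail) (deg : ℕ → ℕ) {m : ℕ}
    (hm : m ≤ tail) : ∑ i ∈ Finset.range m, deg (que i) ≤ ∑ u ∈ Finset.range n, deg u := by
  have hinj : Set.InjOn que (Finset.range m : Finset ℕ) := fun i hi j hj => by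
    simp only [Finset.coe_range, Set.mem_Iio] at hi hj
    exact h.inj i (by omega) j (by omega)
  rw [← Finset.sum_image (f := deg) hinj]
  refine Finset.sum_le_sum_of_subset fun u hu => ?_
  obtain ⟨i, hi, rfl⟩ := Finset.mem_image.1 hu
  have := Finset.mem_range.1 hi
  exact Finset.mem_range.2 (h.que_lt i (by omega))

/-- An edge from `x` leads to a new vertex `y`. -/
theorem push (h : BfsState n k v E lab0 dist lab que tail) (hv : v < n) {i y : ℕ} (hi : i < tail)
    (hy : y < n) (hy0 : dist y = 0) {dist' lab' que' : ℕ → ℕ}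
    (hd : ∀ z, dist' z = if z = y then dist (que i) + 1 else dist z)
    (hl : ∀ z, lab' z = if z = y then lab y ||| lab (que i) else lab z)
    (hq : ∀ j, que' j = if j = tail then y else que j) :
    BfsState n k v E lab0 dist' lab' que' (tail + 1) := by
  have hyv : y ≠ v := fun he => by rw [he, h.root.1] at hy0; omega
  have hyq : ∀ j < tail, que j ≠ y := fun j hj he => by
    have := h.dist_pos j hj
    rw [he] at this
    omega
  have hq' : ∀ j < tail, que' j = que j := fun j hj => by rw [hq, if_neg (by omega)]
  have hqt : que' tail = y := by simp [hq]
  constructor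
  · intro j hj
    rcases Nat.lt_succ_iff_lt_or_eq.1 hj with hj | rfl
    · rw [hq' j hj]; exact h.que_lt j hj
    · rwa [hqt]
  · intro j hj
    rcases Nat.lt_succ_iff_lt_or_eq.1 hj with hj | rfl
    · rw [hq' j hj]; exact h.que_ne j hj
    · rwa [hqt]
  · intro j hj j' hj' he
    rcases Nat.lt_succ_iff_lt_or_eq.1 hj with hj | rfl <;>
      rcases Nat.lt_succ_iff_lt_or_eq.1 hj' with hj' | rfl
    · rw [hq' j hj, hq' j' hj'] at he
      exact h.inj j hj j' hj' he
    · rw [hq' j hj, hqt] at he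
      exact absurd he (hyq j hj)
    · rw [hq' j' hj', hqt] at he
      exact absurd he.symm (hyq j' hj')
    · rfl
  · intro j hj
    rcases Nat.lt_succ_iff_lt_or_eq.1 hj with hj | rfl
    · rw [hq' j hj, hd, if_neg (hyq j hj)]; exact h.dist_pos j hj
    · rw [hqt, hd, if_pos rfl]; omega
  · intro j hj
    rcases Nat.lt_succ_iff_lt_or_eq.1 hj with hj | rfl
    · rw [hq' j hj, hd, if_neg (hyq j hj)]; exact h.dist_le j hj
    · rw [hqt, hd, if_pos rfl]
      have := h.dist_le i hi
      omega
  · intro z hz hz0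
    by_cases hzy : z = y
    · exact .inr ⟨tail, by omega, by rw [hqt, hzy]⟩
    · rw [hd, if_neg hzy] at hz0
      rcases h.visited z hz hz0 with rfl | ⟨j, hj, rfl⟩
      · exact .inl rfl
      · exact .inr ⟨j, by omega, hq' j hj⟩
  · rw [hd, hl, if_neg hyv.symm, if_neg hyv.symm]
    exact h.root
  · intro z hz
    have hzy : z ≠ y := fun he => by
      have := (h.first z hz).1
      rw [he] at this
      omega
    rw [hd, hl, if_neg hzy, if_neg hzy]
    exact h.first z hz
  · intro z hz
    rw [hl]
    split_ifs
    · exact Nat.or_lt_two_pow (h.lab_lt y hy) (h.lab_lt _ (h.que_lt i hi))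
    · exact h.lab_lt z hz
  · intro z hz
    rw [hd, hl]
    split_ifs
    · simp
    · exact h.lab_zero z hz

/-- An edge from `x` leads to a vertex `y` in the next layer. -/
theorem mark (h : BfsState n k v E lab0 dist lab que tail) {i y : ℕ} (hi : i < tail)
    (hy : y < n) (hyd : dist y = dist (que i) + 1) {lab' : ℕ → ℕ}
    (hl : ∀ z, lab' z = if z = y then lab y ||| lab (que i) else lab z) :
    BfsState n k v E lab0 dist lab' que tail := by
  have hpos := h.dist_pos i hi
  refine { h with root := ?_, first := ?_, lab_lt := ?_, lab_zero := ?_ }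
  · rw [hl, if_neg]
    · exact h.root
    · rintro rfl
      have := h.root.1
      omega
  · intro z hz
    rw [hl, if_neg]
    · exact h.first z hz
    · rintro rfl
      have := (h.first _ hz).1
      omega
  · intro z hz
    rw [hl]
    split_ifs
    · exact Nat.or_lt_two_pow (h.lab_lt y hy) (h.lab_lt _ (h.que_lt i hi))
    · exact h.lab_lt z hz
  · intro z hz hz0
    rw [hl, if_neg]
    · exact h.lab_zero z hz hz0
    · rintro rfl
      omega

end BfsState

/-- The state of a breadth-first search that has gone through the edges in `A` and works at queue
position `h`, in a graph with a layering `δ`, `T`. -/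
structure BfsCorrect (δ : ℕ → ℕ) (T : ℕ → ℕ → Prop) (A : ℕ → ℕ → Prop)
    (dist lab que : ℕ → ℕ) (h tail : ℕ) : Prop where
  dist_eq : ∀ i < tail, dist (que i) = δ (que i)
  sorted : ∀ i j, i ≤ j → j < tail → δ (que i) ≤ δ (que j)
  near : h < tail → ∀ j < tail, δ (que j) ≤ δ (que h) + 1
  closed : ∀ x y, A x y → dist y ≠ 0
  bits : ∀ i < tail, 2 ≤ δ (que i) → ∀ b,
    (lab (que i)).testBit b = true ↔ ∃ x, A x (que i) ∧ δ x + 1 = δ (que i) ∧ T x b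

namespace BfsCorrect

variable {n k v : ℕ} {V : Set ℕ} {E : ℕ → ℕ → Prop} {lab0 dist lab que : ℕ → ℕ} {h tail : ℕ}
  {δ : ℕ → ℕ} {T A : ℕ → ℕ → Prop}

theorem _root_.Layering.adj_of_eq_one (hL : Layering V E v δ T) (hE : IsGraphOn V E) {y : ℕ}
    (hy : y ∈ V) (hy1 : δ y = 1) : E v y := by
  obtain ⟨x, hxy, hx⟩ := hL.pred y hy (by rintro rfl; rw [hL.zero] at hy1; omega)
  by_cases hxv : x = v
  · exact hxv ▸ hxy
  · obtain ⟨z, -, hz⟩ := hL.pred x (hE.left_mem hxy) hxv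
    omega

/-- The layers up to that of the current vertex have been found completely. -/
theorem visited_of_le (hC : BfsCorrect δ T A dist lab que h tail)
    (hB : BfsState n k v E lab0 dist lab que tail) (hL : Layering V E v δ T) (hE : IsGraphOn V E)
    (hVn : ∀ y ∈ V, y < n) {m : ℕ} (hm : ∀ i < tail, δ (que i) < m → ∀ y, E (que i) y → A (que i) y)
    {y : ℕ} (hy : y ∈ V) (hym : δ y ≤ m) : dist y ≠ 0 := by
  generalize hd : δ y = d at hym
  induction d generalizing y with
  | zero =>
    have : y = v := by
      by_contra hyv
      obtain ⟨z, -, hz⟩ := hL.pred y hy hyv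
      omega
    rw [this, hB.root.1]; omega
  | succ d ih =>
    obtain ⟨z, hzy, hz⟩ := hL.pred y hy (by rintro rfl; rw [hL.zero] at hd; omega)
    have hzV := hE.left_mem hzy
    rcases hB.visited z (hVn z hzV) (ih hzV (by omega) (by omega)) with rfl | ⟨i, hi, rfl⟩
    · rw [(hB.first y hzy).1]; omega
    · exact hC.closed _ _ (hm i hi (by omega) y hzy)

/-- The bits of a vertex are correct when all edges from its predecessors have been used. -/
theorem bits_iff (hC : BfsCorrect δ T A dist lab que h tail)
    (hB : BfsState n k v E lab0 dist lab que tail) (hL : Layering V E v δ T) (hE : IsGraphOn V E)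
    (hVn : ∀ y ∈ V, y < n) (hAE : ∀ x y, A x y → E x y)
    (h0 : ∀ y, E v y → ∀ b, (lab0 y).testBit b = true ↔ T y b) {i : ℕ} (hi : i < tail)
    (hiV : que i ∈ V)
    (hm : ∀ j < tail, δ (que j) < δ (que i) → ∀ y, E (que j) y → A (que j) y) (b : ℕ) :
    (lab (que i)).testBit b = true ↔ T (que i) b := by
  have hpos : 1 ≤ δ (que i) := hC.dist_eq i hi ▸ hB.dist_pos i hi
  rcases Nat.lt_or_ge (δ (que i)) 2 with h2 | h2
  · have hadj := hL.adj_of_eq_one hE hiV (by omega)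
    rw [(hB.first _ hadj).2, h0 _ hadj]
  · rw [hC.bits i hi h2, hL.bit _ hiV h2]
    refine exists_congr fun x => ⟨fun ⟨h1, h3⟩ => ⟨hAE _ _ h1, h3⟩, fun ⟨h1, h3, h4⟩ => ⟨?_, h3, h4⟩⟩
    have hxV := hE.left_mem h1
    have hx0 := hC.visited_of_le hB hL hE hVn hm hxV (by omega)
    rcases hB.visited x (hVn x hxV) hx0 with rfl | ⟨j, hj, rfl⟩
    · have := hL.zero
      omega
    · exact hm j hj (by omega) _ h1

theorem push (hC : BfsCorrect δ T A dist lab que h tail)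
    (hB : BfsState n k v E lab0 dist lab que tail) (hh : h < tail) {y : ℕ} (hyn : y < n)
    (hδ : δ y = δ (que h) + 1) (hbx : ∀ b, (lab (que h)).testBit b = true ↔ T (que h) b)
    (hy0 : dist y = 0) {dist' lab' que' : ℕ → ℕ} {A' : ℕ → ℕ → Prop}
    (hd : ∀ z, dist' z = if z = y then dist (que h) + 1 else dist z)
    (hl : ∀ z, lab' z = if z = y then lab y ||| lab (que h) else lab z)
    (hq : ∀ j, que' j = if j = tail then y else que j)
    (hA : ∀ a b, A' a b ↔ A a b ∨ a = que h ∧ b = y) :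
    BfsCorrect δ T A' dist' lab' que' h (tail + 1) := by
  have hyq : ∀ j < tail, que j ≠ y := fun j hj he => by
    have := hB.dist_pos j hj
    rw [he] at this
    omega
  have hq' : ∀ j < tail, que' j = que j := fun j hj => by rw [hq, if_neg (by omega)]
  have hqt : que' tail = y := by simp [hq]
  have hnear := hC.near hh
  constructor
  · intro j hj
    rcases Nat.lt_succ_iff_lt_or_eq.1 hj with hj | rfl
    · rw [hq' j hj, hd, if_neg (hyq j hj)]; exact hC.dist_eq j hj
    · rw [hqt, hd, if_pos rfl, hδ, hC.dist_eq h hh]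
  · intro i j hij hj
    rcases Nat.lt_succ_iff_lt_or_eq.1 hj with hj | rfl
    · rw [hq' j hj, hq' i (by omega)]; exact hC.sorted i j hij hj
    · rcases Nat.lt_or_eq_of_le hij with hij | rfl
      · rw [hqt, hq' i hij, hδ]; exact hnear i hij
      · exact le_rfl
  · intro _ j hj
    rw [hq' h hh]
    rcases Nat.lt_succ_iff_lt_or_eq.1 hj with hj | rfl
    · rw [hq' j hj]; exact hnear j hj
    · rw [hqt, hδ]
  · intro a b hab
    rw [hd]
    split_ifs with hb
    · omega
    · rcases (hA a b).1 hab with hab | ⟨-, rfl⟩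
      · exact hC.closed a b hab
      · exact absurd rfl hb
  · intro i hi h2 b
    rcases Nat.lt_succ_iff_lt_or_eq.1 hi with hi | rfl
    · rw [hq' i hi] at h2 ⊢
      rw [hl, if_neg (hyq i hi), hC.bits i hi h2]
      refine exists_congr fun x => ?_
      rw [hA]
      have := hyq i hi
      tauto
    · rw [hqt, hl, if_pos rfl, hB.lab_zero y hyn hy0, Nat.zero_or, hbx]
      constructor
      · exact fun hT => ⟨que h, (hA _ _).2 (.inr ⟨rfl, rfl⟩), hδ.symm, hT⟩
      · rintro ⟨x, hx, -, hT⟩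
        rcases (hA _ _).1 hx with hx | ⟨rfl, -⟩
        · exact absurd hy0 (hC.closed _ _ hx)
        · exact hT

theorem mark (hC : BfsCorrect δ T A dist lab que h tail)
    (hB : BfsState n k v E lab0 dist lab que tail) (hh : h < tail) {y : ℕ} (hyn : y < n)
    (hbx : ∀ b, (lab (que h)).testBit b = true ↔ T (que h) b)
    (hyd : dist y = dist (que h) + 1) {lab' : ℕ → ℕ} {A' : ℕ → ℕ → Prop}
    (hl : ∀ z, lab' z = if z = y then lab y ||| lab (que h) else lab z)
    (hA : ∀ a b, A' a b ↔ A a b ∨ a = que h ∧ b = y) :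
    BfsCorrect δ T A' dist lab' que h tail := by
  refine ⟨hC.dist_eq, hC.sorted, hC.near, fun a b hab => ?_, fun i hi h2 b => ?_⟩
  · rcases (hA a b).1 hab with hab | ⟨-, rfl⟩
    · exact hC.closed a b hab
    · omega
  · by_cases hiy : que i = y
    · have hδ : δ (que h) + 1 = δ (que i) := by
        rw [← hC.dist_eq h hh, ← hC.dist_eq i hi, hiy, hyd]
      rw [hl, if_pos hiy, ← hiy, Nat.testBit_or, Bool.or_eq_true, hbx, hC.bits i hi h2]
      constructor
      · rintro (⟨x, hx, hx'⟩ | hT)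
        · exact ⟨x, (hA _ _).2 (.inl hx), hx'⟩
        · exact ⟨que h, (hA _ _).2 (.inr ⟨rfl, hiy⟩), hδ, hT⟩
      · rintro ⟨x, hx, hx', hT⟩
        rcases (hA _ _).1 hx with hx | ⟨rfl, -⟩
        · exact .inl ⟨x, hx, hx', hT⟩
        · exact .inr hT
    · rw [hl, if_neg hiy, hC.bits i hi h2]
      refine exists_congr fun x => ?_
      rw [hA]
      tauto

theorem skip (hC : BfsCorrect δ T A dist lab que h tail) (hh : h < tail) {y : ℕ}
    (hy0 : dist y ≠ 0) (hyd : dist y ≠ dist (que h) + 1) {A' : ℕ → ℕ → Prop}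
    (hA : ∀ a b, A' a b ↔ A a b ∨ a = que h ∧ b = y) :
    BfsCorrect δ T A' dist lab que h tail := by
  refine ⟨hC.dist_eq, hC.sorted, hC.near, fun a b hab => ?_, fun i hi h2 b => ?_⟩
  · rcases (hA a b).1 hab with hab | ⟨-, rfl⟩
    · exact hC.closed a b hab
    · exact hy0
  · rw [hC.bits i hi h2]
    refine exists_congr fun x => ?_
    rw [hA]
    constructor
    · exact fun ⟨h1, h2⟩ => ⟨.inl h1, h2⟩
    · rintro ⟨h1 | ⟨rfl, rfl⟩, h2⟩
      · exact ⟨h1, h2⟩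
      · have := hC.dist_eq i hi
        have := hC.dist_eq h hh
        omega

end BfsCorrect


theorem wp_maxDegProg {w n : ℕ} {s : Mem} (hw : n < 2 ^ w) (hN : s.reg rN = n)
    (hdeg : ∀ u < n, s.tab tDeg u 0 ≤ n) :
    wp w maxDegProg (fun s' t => t ≤ 30 * n + 20 ∧ (∀ u < n, s.tab tDeg u 0 ≤ s'.reg rMaxDeg) ∧
      (0 < s'.reg rMaxDeg → s'.reg rRoot < n ∧ s.tab tDeg (s'.reg rRoot) 0 = s'.reg rMaxDeg) ∧
      s'.reg rMaxDeg ≤ n) s := by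
  simp only [maxDegProg, wp]
  refine ⟨trivial, trivial, ?_⟩
  refine wp_forLoop_const (fun j s' => (∀ u < j, s.tab tDeg u 0 ≤ s'.reg rMaxDeg) ∧
      (0 < s'.reg rMaxDeg → s'.reg rRoot < n ∧ s.tab tDeg (s'.reg rRoot) 0 = s'.reg rMaxDeg) ∧
      s'.reg rMaxDeg ≤ n) 15 (by decide) (by decide) (by decide)
    (by simpa [hN] using hw) (by simp) ?_ ?_
  · rintro u hu s' hF hr ⟨h1, h2, h3⟩
    simp [hN] at hu
    have htab : s'.tab tDeg = s.tab tDeg := by rw [hF.tab _ (by decide)]; simp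
    have := hdeg u hu
    simp [hr, htab, (by omega : u < 2 ^ w), (by omega : s'.reg rMaxDeg < 2 ^ w),
      (by omega : s.tab tDeg u 0 < 2 ^ w), (by omega : 0 < 2 ^ w)]
    refine ⟨fun h => ⟨fun x hx => ?_, fun _ => hu, this⟩, fun h => ⟨fun x hx => ?_, h2, h3⟩⟩
    · rcases Nat.lt_or_eq_of_le hx with hx | rfl
      · exact (h1 x hx).trans h.le
      · exact le_rfl
    · rcases Nat.lt_or_eq_of_le hx with hx | rfl
      · exact h1 x hx
      · exact h
  · rintro s' t hF ⟨h1, h2, h3⟩ ht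
    simp [hN] at h1 ht
    exact ⟨by simp; omega, h1, h2, h3⟩

/-- The first `j` neighbors of `v` have been put into the queue. -/
structure BfsInitInv (n k v : ℕ) (nb : ℕ → ℕ) (j : ℕ) (s : Mem) : Prop where
  mask : s.reg rMask = if j < k then 2 ^ j else 0
  count : s.reg rC = min k j
  queue : ∀ i < j, s.tab tQueue i 0 = nb i
  dist_le : ∀ y < n, s.tab tDist y 0 ≤ 1
  dist_ne : ∀ y < n, s.tab tDist y 0 ≠ 0 ↔ y = v ∨ ∃ i < j, nb i = y
  lab : ∀ i < j, s.tab tLab (nb i) 0 = if i < k then 2 ^ i else 0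
  lab_zero : ∀ y < n, (¬ ∃ i < j, nb i = y) → s.tab tLab y 0 = 0

theorem BfsInitInv.next {n k v m j : ℕ} {nb : ℕ → ℕ} {s s' : Mem} (h : BfsInitInv n k v nb j s)
    (hj : j < m) (hn : ∀ j < m, nb j < n) (hinj : ∀ i < m, ∀ j < m, nb i = nb j → i = j)
    (hmask : s'.reg rMask = if s.reg rMask + s.reg rMask = 2 ^ k then 0
      else s.reg rMask + s.reg rMask)
    (hc : s'.reg rC = if s.reg rMask = 0 then s.reg rC else s.reg rC + 1)
    (hq : ∀ i, s'.tab tQueue i 0 = if i = j then nb j else s.tab tQueue i 0)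
    (hd : ∀ y, s'.tab tDist y 0 = if y = nb j then 1 else s.tab tDist y 0)
    (hl : ∀ y, s'.tab tLab y 0 = if y = nb j then s.reg rMask else s.tab tLab y 0) :
    BfsInitInv n k v nb (j + 1) s' := by
  have hne : ∀ i < j, nb i ≠ nb j := fun i hi he => by
    have := hinj i (by omega) j hj he
    omega
  have hpow : 2 ^ j + 2 ^ j = 2 ^ (j + 1) := by rw [pow_succ]; omega
  have hk : 0 < 2 ^ k := by positivity
  constructor
  · rw [hmask, h.mask]
    by_cases hjk : j < k
    · rw [if_pos hjk, hpow]
      by_cases hjk' : j + 1 < k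
      · have : 2 ^ (j + 1) < 2 ^ k := Nat.pow_lt_pow_right (by norm_num) hjk'
        rw [if_neg (by omega), if_pos hjk']
      · rw [show j + 1 = k by omega]; simp
    · rw [if_neg hjk, if_neg (by omega : ¬ j + 1 < k), if_neg (by omega)]
  · rw [hc, h.mask, h.count]
    by_cases hjk : j < k
    · rw [if_pos hjk, if_neg (by positivity)]; omega
    · rw [if_neg hjk, if_pos rfl]; omega
  · intro i hi
    rw [hq]
    split_ifs with h'
    · rw [h']
    · exact h.queue i (by omega)
  · intro y hy
    rw [hd]
    split_ifs
    · exact le_rfl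
    · exact h.dist_le y hy
  · intro y hy
    rw [hd]
    split_ifs with h'
    · simp only [ne_eq, one_ne_zero, not_false_eq_true, true_iff]
      exact .inr ⟨j, by omega, h'.symm⟩
    · rw [h.dist_ne y hy]
      refine or_congr_right ⟨fun ⟨i, hi, e⟩ => ⟨i, by omega, e⟩, fun ⟨i, hi, e⟩ => ⟨i, ?_, e⟩⟩
      rcases Nat.lt_succ_iff_lt_or_eq.1 hi with hi | rfl
      · exact hi
      · exact absurd e.symm h'
  · intro i hi
    rcases Nat.lt_succ_iff_lt_or_eq.1 hi with hi | rfl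
    · rw [hl, if_neg (hne i hi), h.lab i hi]
    · rw [hl, if_pos rfl, h.mask]
  · intro y hy hn
    rw [hl, if_neg (fun h => hn ⟨j, by omega, h.symm⟩)]
    exact h.lab_zero y hy fun ⟨i, hi, h⟩ => hn ⟨i, by omega, h⟩

/-- After the preparation the search is in a valid state, and the bits of the first `k` neighbors of
`v` are different powers of two. -/
theorem wp_bfsInitProg {w n k v m : ℕ} {E : ℕ → ℕ → Prop} {V : Set ℕ} {s : Mem} (hw : n < 2 ^ w)
    (hk : 1 ≤ k) (hkn : 2 ^ k ≤ n) (hN : s.reg rN = n) (hP : s.reg rPow = 2 ^ k)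
    (hv : v < n) (hroot : s.reg rRoot = v) (hm : s.reg rMaxDeg = m) (hE : IsGraphOn V E)
    (hVn : ∀ y ∈ V, y < n) (hnb : IsNbList E v (s.tab tNb v) m) :
    wp w bfsInitProg (fun s' t => t ≤ 100 * n + 100 ∧
      BfsState n k v E (fun y => s'.tab tLab y 0) (fun y => s'.tab tDist y 0)
        (fun y => s'.tab tLab y 0) (fun i => s'.tab tQueue i 0) m ∧
      s'.reg rTail = m ∧ s'.reg rC = min k m ∧ (∀ j < m, s'.tab tQueue j 0 = s.tab tNb v j) ∧
      (∀ j < m, s'.tab tLab (s.tab tNb v j) 0 = if j < k then 2 ^ j else 0) ∧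
      s'.tab tLab v 0 = 0) s := by
  have hnbn : ∀ j < m, s.tab tNb v j < n := fun j hj => hVn _ (hE.right_mem (hnb.adj hj))
  have hnbv : ∀ j < m, s.tab tNb v j ≠ v := fun j hj he => hE.irrefl v (by
    have := hnb.adj hj
    rwa [he] at this)
  have hmn : m ≤ n := hnb.le fun y hy => hVn _ (hE.right_mem hy)
  simp only [bfsInitProg, wp]
  refine wp_forLoop_const (fun j s' => ∀ u < j, s'.tab tDist u 0 = 0 ∧ s'.tab tLab u 0 = 0)
    15 (by decide) (by decide) (by decide) (by simpa [hN] using hw) (by simp) ?_ ?_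
  · intro u hu s' hF hr hI
    simp [hN] at hu
    simp [hr, (by omega : u < 2 ^ w)]
    grind
  intro s1 t1 hF1 hI1 ht1
  rw [hN] at hI1 ht1
  have hroot1 : s1.reg rRoot = v := by rw [hF1.reg _ (by decide), hroot]
  have hm1 : s1.reg rMaxDeg = m := by rw [hF1.reg _ (by decide), hm]
  have hP1 : s1.reg rPow = 2 ^ k := by rw [hF1.reg _ (by decide), hP]
  have hT1 : s1.tab tNb = s.tab tNb := hF1.tab _ (by decide)
  clear hF1
  simp only [Expr.val, Expr.Safe, hroot1]
  refine ⟨⟨trivial, by omega⟩, ⟨trivial, by omega⟩, trivial, trivial, trivial, ?_⟩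
  refine wp_forLoop_const (BfsInitInv n k v (s.tab tNb v)) 50 (by decide) (by decide) (by decide)
    (by simp [hm1]; omega) ?_ ?_ ?_
  · constructor
    · simp; omega
    · simp
    · simp
    · intro y hy
      simp
      split_ifs <;> simp [(hI1 y hy).1]
    · intro y hy
      have := (hI1 y hy).1
      simp
      grind
    · simp
    · intro y hy _
      simpa using (hI1 y hy).2
  · rintro j hj s2 hF2 hr2 hI
    simp [hm1] at hj
    have hroot2 : s2.reg rRoot = v := by rw [hF2.reg _ (by decide)]; simp [hroot1]
    have hP2 : s2.reg rPow = 2 ^ k := by rw [hF2.reg _ (by decide)]; simp [hP1]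
    have hT2 : ∀ i, s2.tab tNb v i = s.tab tNb v i := fun i => by
      rw [hF2.tab _ (by decide)]
      simp [hT1]
    have hy := hnbn j hj
    have hmask : s2.reg rMask + s2.reg rMask ≤ 2 ^ k := by
      rw [hI.mask]
      split_ifs with h
      · have : 2 ^ (j + 1) ≤ 2 ^ k := Nat.pow_le_pow_right (by norm_num) h
        rw [pow_succ] at this
        omega
      · simp
    have hnext : ∀ s3, _ := fun s3 => hI.next (s' := s3) hj hnbn hnb.inj
    generalize BfsInitInv n k v (s.tab tNb v) (j + 1) = I at hnext ⊢
    simp [hroot2, hr2, hP2, hT2, (by omega : v < 2 ^ w), (by omega : j < 2 ^ w),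
      (by omega : s.tab tNb v j < 2 ^ w), (by omega : s2.reg rMask < 2 ^ w),
      (by omega : s2.reg rMask + s2.reg rMask < 2 ^ w), (by omega : 2 ^ k < 2 ^ w),
      (by omega : 0 < 2 ^ w)]
    refine ⟨fun h0 => ⟨fun hK => ?_, fun hK => ?_⟩, fun h0 => ⟨fun hK => ?_, fun hK => ?_⟩⟩ <;>
      apply hnext <;> simp [h0, hK]
  · intro s2 t2 hF2 hI ht2
    simp [hm1] at hI ht2 ⊢
    have hdist : ∀ y < n, s2.tab tDist y 0 ≠ 0 → s2.tab tDist y 0 = 1 := fun y hy h0 => by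
      have := hI.dist_le y hy
      omega
    have hm2 : s2.reg rMaxDeg = m := by rw [hF2.reg _ (by decide)]; simp [hm1]
    have hlab0 : s2.tab tLab v 0 = 0 := hI.lab_zero v hv fun ⟨i, hi, h⟩ => hnbv i hi h
    refine ⟨by omega, ?_, hm2, hI.count, hI.queue, hI.lab, hlab0⟩
    constructor
    · intro i hi
      rw [hI.queue i hi]; exact hnbn i hi
    · intro i hi
      rw [hI.queue i hi]; exact hnbv i hi
    · intro i hi j hj he
      simp only [hI.queue i hi, hI.queue j hj] at he
      exact hnb.inj i hi j hj he
    · intro i hi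
      simp only [hI.queue i hi]
      exact Nat.one_le_iff_ne_zero.2 ((hI.dist_ne _ (hnbn i hi)).2 (.inr ⟨i, hi, rfl⟩))
    · intro i hi
      simp only [hI.queue i hi]
      exact (hI.dist_le _ (hnbn i hi)).trans (by omega)
    · intro y hy h0
      refine ((hI.dist_ne y hy).1 h0).imp_right fun ⟨i, hi, h⟩ => ⟨i, hi, ?_⟩
      rw [← h]; exact hI.queue i hi
    · exact ⟨hdist v hv ((hI.dist_ne v hv).2 (.inl rfl)), rfl⟩
    · intro y hy
      obtain ⟨i, hi, rfl⟩ := (hnb.adj_iff y).1 hy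
      exact ⟨hdist _ (hnbn i hi) ((hI.dist_ne _ (hnbn i hi)).2 (.inr ⟨i, hi, rfl⟩)), rfl⟩
    · intro y hy
      by_cases h : ∃ i < m, s.tab tNb v i = y
      · obtain ⟨i, hi, rfl⟩ := h
        rw [hI.lab i hi]
        split_ifs with hik
        · exact Nat.pow_lt_pow_right (by norm_num) hik
        · positivity
      · rw [hI.lab_zero y hy h]; positivity
    · intro y hy h0
      refine hI.lab_zero y hy fun h => ?_
      exact (hI.dist_ne y hy).2 (.inr h) h0


theorem BfsState.dist_le_tail {n k v : ℕ} {E : ℕ → ℕ → Prop} {lab0 dist lab que : ℕ → ℕ}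
    {tail : ℕ} (h : BfsState n k v E lab0 dist lab que tail) {y : ℕ} (hy : y < n) :
    dist y ≤ tail + 1 := by
  by_cases h0 : dist y = 0
  · omega
  rcases h.visited y hy h0 with rfl | ⟨i, hi, rfl⟩
  · rw [h.root.1]; omega
  · have := h.dist_le i hi
    omega

theorem BfsCorrect.next {δ : ℕ → ℕ} {T A A' : ℕ → ℕ → Prop} {dist lab que : ℕ → ℕ} {h tail : ℕ}
    (hC : BfsCorrect δ T A dist lab que h tail) (hA : ∀ a b, A' a b ↔ A a b) :
    BfsCorrect δ T A' dist lab que (h + 1) tail := by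
  obtain rfl : A' = A := by
    funext a b
    exact propext (hA a b)
  refine ⟨hC.dist_eq, hC.sorted, fun hh j hj => ?_, hC.closed, hC.bits⟩
  have := hC.near (by omega) j hj
  have := hC.sorted h (h + 1) (by omega) hh
  omega

/-- The edges from the first `h` vertices in the queue. -/
def queueArcs (E : ℕ → ℕ → Prop) (que : ℕ → ℕ) (h tail x y : ℕ) : Prop :=
  E x y ∧ ∃ i < h, i < tail ∧ que i = x

/-- The breadth-first search takes time linear in the size of the graph, for every graph. If a
condition `P` provides a layering, then it also finds the bits `T`; the program itself does not know
whether `P` holds. -/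
theorem wp_bfsProg {w n k v m : ℕ} {E : ℕ → ℕ → Prop} {V : Set ℕ} {s : Mem} {P : Prop}
    {δ : ℕ → ℕ} {T : ℕ → ℕ → Prop} {lab0 : ℕ → ℕ} (hw : n < 2 ^ w) (hkn : 2 ^ k ≤ n)
    (hN : s.reg rN = n) (hv : v < n) (hE : IsGraphOn V E) (hVn : ∀ y ∈ V, y < n)
    (hl : HasLists s n E) (hL : P → Layering V E v δ T)
    (h0 : P → ∀ y, E v y → ∀ b, (lab0 y).testBit b = true ↔ T y b) (h0v : lab0 v = 0)
    (hS : BfsState n k v E lab0 (fun y => s.tab tDist y 0) (fun y => s.tab tLab y 0)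
      (fun i => s.tab tQueue i 0) m)
    (hm : s.reg rTail = m) (hq : ∀ j < m, E v (s.tab tQueue j 0)) :
    wp w bfsProg (fun s' t =>
      t ≤ 100 * n + 100 * ∑ u ∈ Finset.range n, s.tab tDeg u 0 + 100 ∧
      BfsState n k v E lab0 (fun y => s'.tab tDist y 0) (fun y => s'.tab tLab y 0)
        (fun i => s'.tab tQueue i 0) (s'.reg rTail) ∧
      (P → ∀ y ∈ V, ∀ b, (s'.tab tLab y 0).testBit b = true ↔ T y b)) s := by
  have hw0 : 0 < 2 ^ w := by omega
  unfold bfsProg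
  refine wp_forLoop (fun h s' t =>
    BfsState n k v E lab0 (fun y => s'.tab tDist y 0) (fun y => s'.tab tLab y 0)
      (fun i => s'.tab tQueue i 0) (s'.reg rTail) ∧
    (P → BfsCorrect δ T (queueArcs E (fun i => s'.tab tQueue i 0) h (s'.reg rTail))
      (fun y => s'.tab tDist y 0) (fun y => s'.tab tLab y 0)
      (fun i => s'.tab tQueue i 0) h (s'.reg rTail)) ∧
    t ≤ 5 + 100 * h + 100 * ∑ i ∈ Finset.range (min h (s'.reg rTail)),
      s.tab tDeg (s'.tab tQueue i 0) 0) (by decide) (by decide) (by decide)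
    (by simpa [hN] using hw) ?_ ?_ ?_
  · simp only [Mem.reg_setReg, Mem.tab_setReg, Nat.reduceEqDiff,
      ↓reduceIte, hm]
    refine ⟨hS, fun hP => ?_, by simp⟩
    have h1 : ∀ j < m, δ (s.tab tQueue j 0) = 1 := fun j hj => by
      have := (hL hP).step (hq j hj)
      rw [(hL hP).zero] at this
      omega
    refine ⟨fun i hi => ?_, fun i j hij hj => ?_, fun hh j hj => ?_, ?_, fun i hi h2 => ?_⟩
    · simp only [h1 i hi]
      exact (hS.first _ (hq i hi)).1
    · simp only [h1 i (by omega), h1 j hj, le_refl]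
    · simp only [h1 j hj, h1 0 hh]
      omega
    · rintro x y ⟨-, i, hi, -⟩
      omega
    · simp only [h1 i hi] at h2
      omega
  · rintro h hh s1 t1 hF1 hr1 ⟨hB, hC, ht1⟩
    rw [hN] at hh
    have hD1 : ∀ u, s1.tab tDeg u 0 = s.tab tDeg u 0 := fun u => by
      rw [hF1.tab _ (by decide)]
    have hNb1 : ∀ u i, s1.tab tNb u i = s.tab tNb u i := fun u i => by
      rw [hF1.tab _ (by decide)]
    have htn := hB.tail_lt hv
    clear hF1
    simp only [wp, Test.Safe, Expr.Safe, Expr.val, Test.val, hr1]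
    refine ⟨⟨trivial, trivial, by omega, by omega⟩, fun hlt => ?_, fun hge => ?_⟩
    swap
    · -- the queue is exhausted
      have harcs : ∀ a b, queueArcs E (fun i => s1.tab tQueue i 0) (h + 1) (s1.reg rTail) a b ↔
          queueArcs E (fun i => s1.tab tQueue i 0) h (s1.reg rTail) a b := fun a b =>
        and_congr_right fun _ => ⟨fun ⟨i, _, h2, h3⟩ => ⟨i, by omega, h2, h3⟩,
          fun ⟨i, _, h2, h3⟩ => ⟨i, by omega, h2, h3⟩⟩
      refine ⟨by simpa using hB, fun hP => by simpa using (hC hP).next harcs, ?_⟩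
      simp only [Mem.reg_setReg, Mem.tab_setReg, Nat.reduceEqDiff,
        ↓reduceIte, Test.cost, Expr.cost]
      rw [min_eq_right (by omega)] at ht1 ⊢
      omega
    set x := s1.tab tQueue h 0 with hx
    have hxn : x < n := hB.que_lt h hlt
    have hnb := hl x hxn
    have hdx := hB.dist_le h hlt
    have hdx1 := hB.dist_pos h hlt
    simp only [← hx] at hdx hdx1
    have hnbE : ∀ j < s.tab tDeg x 0, E x (s.tab tNb x j) := fun j hj => hnb.adj hj
    have hnbn : ∀ j < s.tab tDeg x 0, s.tab tNb x j < n := fun j hj =>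
      hVn _ (hE.right_mem (hnbE j hj))
    have hdeg : s.tab tDeg x 0 ≤ n := hnb.le fun y hy => hVn _ (hE.right_mem hy)
    simp [hD1, hw0, (by omega : h < 2 ^ w), (by omega : x < 2 ^ w)]
    refine wp_forLoop_const (fun j s' =>
      BfsState n k v E lab0 (fun y => s'.tab tDist y 0) (fun y => s'.tab tLab y 0)
        (fun i => s'.tab tQueue i 0) (s'.reg rTail) ∧
      (P → BfsCorrect δ T
        (fun a b => queueArcs E (fun i => s1.tab tQueue i 0) h (s1.reg rTail) a b ∨
          a = x ∧ ∃ i < j, s.tab tNb x i = b)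
        (fun y => s'.tab tDist y 0) (fun y => s'.tab tLab y 0)
        (fun i => s'.tab tQueue i 0) h (s'.reg rTail)) ∧
      s1.reg rTail ≤ s'.reg rTail ∧ (∀ i < s1.reg rTail, s'.tab tQueue i 0 = s1.tab tQueue i 0) ∧
      s'.tab tDist x 0 = s1.tab tDist x 0 ∧ s'.tab tLab x 0 = s1.tab tLab x 0)
      50 (by decide) (by decide) (by decide) (by simp; omega) ?_ ?_ ?_
    · refine ⟨by simpa using hB, fun hP => ?_, by simp, by simp, by simp, by simp⟩
      simpa using hC hP
    · rintro j hj s2 hF2 hr2 ⟨gB, gC, g1, g2, g3, g4⟩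
      simp at hj
      have hX2 : s2.reg rX = x := by rw [hF2.reg _ (by decide)]; simp
      have hDist2 : s2.reg rDist = s1.tab tDist x 0 + 1 := by rw [hF2.reg _ (by decide)]; simp
      have hLab2 : s2.reg rLab = s1.tab tLab x 0 := by rw [hF2.reg _ (by decide)]; simp
      have hNb2 : s2.tab tNb x j = s.tab tNb x j := by rw [hF2.tab _ (by decide)]; simp [hNb1]
      clear hF2
      set y := s.tab tNb x j with hy
      have hxy : E x y := hnbE j hj
      have hyn : y < n := hnbn j hj
      have htn2 := gB.tail_lt hv
      have hque : s2.tab tQueue h 0 = x := g2 h hlt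
      have hh2 : h < s2.reg rTail := by omega
      have hdy := gB.dist_le_tail hyn
      have hyx : y ≠ x := fun he => hE.irrefl x (he ▸ hxy)
      have hA : ∀ a b, (queueArcs E (fun i => s1.tab tQueue i 0) h (s1.reg rTail) a b ∨
          a = x ∧ ∃ i < j + 1, s.tab tNb x i = b) ↔
          (queueArcs E (fun i => s1.tab tQueue i 0) h (s1.reg rTail) a b ∨
          a = x ∧ ∃ i < j, s.tab tNb x i = b) ∨ a = s2.tab tQueue h 0 ∧ b = y := by
        intro a b
        rw [hque, or_assoc]
        refine or_congr_right ?_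
        rw [← and_or_left]
        refine and_congr_right fun _ => ?_
        constructor
        · rintro ⟨i, hi, rfl⟩
          rcases Nat.lt_succ_iff_lt_or_eq.1 hi with hi | rfl
          · exact .inl ⟨i, hi, rfl⟩
          · exact .inr hy.symm
        · rintro (⟨i, hi, rfl⟩ | rfl)
          · exact ⟨i, by omega, rfl⟩
          · exact ⟨j, by omega, hy.symm⟩
      have hAE : ∀ a b, (queueArcs E (fun i => s1.tab tQueue i 0) h (s1.reg rTail) a b ∨
          a = x ∧ ∃ i < j, s.tab tNb x i = b) → E a b := by
        rintro a b (h | ⟨rfl, i, hi, rfl⟩)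
        · exact h.1
        · exact hnbE i (by omega)
      have hprev : P → ∀ i < s2.reg rTail, δ (s2.tab tQueue i 0) < δ (s2.tab tQueue h 0) →
          ∀ z, E (s2.tab tQueue i 0) z →
          (queueArcs E (fun i => s1.tab tQueue i 0) h (s1.reg rTail) (s2.tab tQueue i 0) z ∨
          s2.tab tQueue i 0 = x ∧ ∃ i < j, s.tab tNb x i = z) := by
        intro hP i hi hδ z hz
        have hih : i < h := by
          by_contra hih
          have := (gC hP).sorted h i (by omega) hi
          omega
        exact .inl ⟨hz, i, hih, by omega, (g2 i (by omega)).symm⟩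
      have hbits : P → ∀ b, (s2.tab tLab (s2.tab tQueue h 0) 0).testBit b = true ↔
          T (s2.tab tQueue h 0) b := fun hP =>
        (gC hP).bits_iff gB (hL hP) hE hVn hAE (h0 hP) hh2 (by
          simp only [hque]; exact hE.left_mem hxy) (hprev hP)
      have hnew : P → s2.tab tDist y 0 = 0 → δ y = δ (s2.tab tQueue h 0) + 1 := by
        intro hP hy0
        rcases (hL hP).step hxy with h1 | h1
        · rw [hque, h1]
        · exact absurd hy0 ((gC hP).visited_of_le gB (hL hP) hE hVn (hprev hP)
            (hE.right_mem hxy) (by rw [hque]; omega))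
      simp only [wp, Test.Safe, Expr.Safe, Expr.val, Test.val]
      simp [hX2, hr2, hNb2, hDist2, hLab2, (by omega : x < 2 ^ w), hw0,
        (by omega : j < 2 ^ w), (by omega : y < 2 ^ w), (by omega : s2.tab tDist y 0 < 2 ^ w),
        (by omega : s1.tab tDist x 0 + 1 < 2 ^ w), (by omega : s2.reg rTail < 2 ^ w)]
      refine ⟨fun hy0 => ?_, fun hy0 => ⟨fun hyd => ?_, fun hyd => ?_⟩⟩
      · have hd : ∀ z, (if z = y then s1.tab tDist x 0 + 1 else s2.tab tDist z 0) =
            if z = y then s2.tab tDist (s2.tab tQueue h 0) 0 + 1 else s2.tab tDist z 0 := by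
          rw [hque, g3]; simp
        have hl' : ∀ z, (if z = y then s2.tab tLab y 0 ||| s1.tab tLab x 0 else s2.tab tLab z 0) =
            if z = y then s2.tab tLab y 0 ||| s2.tab tLab (s2.tab tQueue h 0) 0
              else s2.tab tLab z 0 := by
          rw [hque, g4]; simp
        refine ⟨gB.push hv hh2 hyn hy0 hd hl' (fun _ => rfl), fun hP => ?_, by omega,
          fun i hi => ?_, ?_, ?_⟩
        · simp only [Nat.lt_succ_iff] at hA
          exact (gC hP).push gB hh2 hyn (hnew hP hy0) (hbits hP) hy0 hd hl' (fun _ => rfl) hA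
        · rw [if_neg (by omega)]; exact g2 i hi
        · rw [if_neg hyx.symm]; exact g3
        · rw [if_neg hyx.symm]; exact g4
      · have hyd' : s2.tab tDist y 0 = s2.tab tDist (s2.tab tQueue h 0) 0 + 1 := by
          rw [hque, g3, hyd]
        have hl' : ∀ z, (if z = y then s2.tab tLab y 0 ||| s1.tab tLab x 0 else s2.tab tLab z 0) =
            if z = y then s2.tab tLab y 0 ||| s2.tab tLab (s2.tab tQueue h 0) 0
              else s2.tab tLab z 0 := by
          rw [hque, g4]; simp
        refine ⟨gB.mark hh2 hyn hyd' hl', fun hP => ?_, g1, g2, g3, ?_⟩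
        · simp only [Nat.lt_succ_iff] at hA
          exact (gC hP).mark gB hh2 hyn (hbits hP) hyd' hl' hA
        · rw [if_neg hyx.symm]; exact g4
      · refine ⟨gB, fun hP => ?_, g1, g2, g3, g4⟩
        simp only [Nat.lt_succ_iff] at hA
        exact (gC hP).skip hh2 hy0 (by rw [hque, g3]; exact hyd) hA
    · rintro s2 t2 hF2 ⟨gB, gC, g1, g2, g3, g4⟩ ht2
      simp at gC ht2
      have hque : s2.tab tQueue h 0 = x := g2 h hlt
      have harcs : ∀ a b, queueArcs E (fun i => s2.tab tQueue i 0) (h + 1) (s2.reg rTail) a b ↔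
          queueArcs E (fun i => s1.tab tQueue i 0) h (s1.reg rTail) a b ∨
            a = x ∧ ∃ i < s.tab tDeg x 0, s.tab tNb x i = b := by
        intro a b
        rw [← hnb.adj_iff]
        constructor
        · rintro ⟨hab, i, hi, hi', rfl⟩
          rcases Nat.lt_succ_iff_lt_or_eq.1 hi with hi | rfl
          · exact .inl ⟨hab, i, hi, by omega, (g2 i (by omega)).symm⟩
          · simp only [hque] at hab ⊢
            exact .inr ⟨trivial, hab⟩
        · rintro (⟨hab, i, hi, hi', rfl⟩ | ⟨rfl, hab⟩)
          · exact ⟨hab, i, by omega, by omega, g2 i hi'⟩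
          · exact ⟨hab, h, by omega, by omega, hque⟩
      refine ⟨by simpa using gB, fun hP => by simpa using (gC hP).next harcs, ?_⟩
      rw [min_eq_left (by omega)] at ht1 ⊢
      rw [Finset.sum_range_succ, hque, Finset.sum_congr rfl fun i hi => by
        rw [g2 i (by have := Finset.mem_range.1 hi; omega)]]
      omega
  · rintro s1 t1 hF1 ⟨hB, hC, ht1⟩
    rw [hN] at ht1 hC
    have htn := hB.tail_lt hv
    rw [min_eq_right (by omega)] at ht1
    have hsum := hB.sum_deg_le (fun u => s.tab tDeg u 0) (le_refl (s1.reg rTail))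
    refine ⟨by omega, hB, fun hP y hy b => ?_⟩
    have hC := hC hP
    have hall : ∀ i < s1.reg rTail, ∀ z, E (s1.tab tQueue i 0) z →
        queueArcs E (fun i => s1.tab tQueue i 0) n (s1.reg rTail) (s1.tab tQueue i 0) z :=
      fun i hi z hz => ⟨hz, i, by omega, hi, rfl⟩
    rcases hB.visited y (hVn y hy) (hC.visited_of_le hB (hL hP) hE hVn (m := δ y)
      (fun i hi _ => hall i hi) hy le_rfl) with rfl | ⟨i, hi, rfl⟩
    · have := hB.root.2
      rw [this, h0v]
      simp [(hL hP).root b]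
    · exact hC.bits_iff hB (hL hP) hE hVn (fun _ _ h => h.1) (h0 hP) hi hy
        (fun j hj _ => hall j hj) b

end WordRAM

/-! ### Contraction -/

namespace WordRAM

/-- The number of representatives. -/
def numRep (n : ℕ) (rep : ℕ → ℕ) : ℕ := ((Finset.range n).filter fun u => rep u = u).card

theorem numRep_le (n : ℕ) (rep : ℕ → ℕ) : numRep n rep ≤ n :=
  (Finset.card_filter_le _ _).trans (Finset.card_range n).le

theorem _root_.IsMerged.refl {V : Set ℕ} {rep : ℕ → ℕ} (h : IsRep V rep) :
    IsMerged V (fun _ _ => False) rep rep :=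
  ⟨h, h.idem, h.idem, fun _ _ h => h.elim, fun _ _ hR _ => hR⟩

theorem _root_.IsMerged.congr {V : Set ℕ} {rep rep' rep'' : ℕ → ℕ} {A A' : ℕ → ℕ → Prop}
    (h : IsMerged V A rep rep') (hV : ∀ u ∈ V, rep'' u = rep' u) (hA : ∀ x y, A' x y ↔ A x y)
    (hAV : ∀ x y, A x y → x ∈ V ∧ y ∈ V) (hr : IsRep V rep) : IsMerged V A' rep rep'' where
  isRep :=
    ⟨fun u hu => by rw [hV u hu]; exact h.isRep.mem u hu,
      fun u hu => by rw [hV u hu, hV _ (h.isRep.mem u hu)]; exact h.isRep.idem u hu⟩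
  coarse u hu := by rw [hV u hu, hV _ (hr.mem u hu)]; exact h.coarse u hu
  fixed u hu := by rw [hV u hu]; exact h.fixed u hu
  merged x y hxy := by
    rw [hA] at hxy
    rw [hV x (hAV x y hxy).1, hV y (hAV x y hxy).2]
    exact h.merged hxy
  least R hR h1 h2 u hu := by
    rw [hV u hu]
    exact h.least R hR h1 (fun x y hxy => h2 ((hA x y).2 hxy)) u hu

/-- Two classes are merged. -/
theorem _root_.IsMerged.insert {V : Set ℕ} {rep rep' rep'' : ℕ → ℕ} {A A' : ℕ → ℕ → Prop}
    (h : IsMerged V A rep rep') {x y : ℕ} (hx : x ∈ V) (hy : y ∈ V) (hr : IsRep V rep)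
    (hne : rep' x ≠ rep' y) (hV : ∀ u ∈ V, rep'' u = if rep' u = rep' x then rep' y else rep' u)
    (hA : ∀ a b, A' a b ↔ A a b ∨ a = x ∧ b = y) (hAV : ∀ x y, A x y → x ∈ V ∧ y ∈ V) :
    IsMerged V A' rep rep'' where
  isRep := by
    refine ⟨fun u hu => ?_, fun u hu => ?_⟩
    · rw [hV u hu]
      split_ifs
      · exact h.isRep.mem y hy
      · exact h.isRep.mem u hu
    · rw [hV u hu]
      split_ifs with hu'
      · rw [hV _ (h.isRep.mem y hy), h.isRep.idem y hy, if_neg hne.symm]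
      · rw [hV _ (h.isRep.mem u hu), h.isRep.idem u hu, if_neg hu']
  coarse u hu := by rw [hV u hu, hV _ (hr.mem u hu), h.coarse u hu]
  fixed u hu := by
    rw [hV u hu]
    split_ifs
    · exact h.fixed y hy
    · exact h.fixed u hu
  merged a b hab := by
    rcases (hA a b).1 hab with hab | ⟨rfl, rfl⟩
    · rw [hV a (hAV a b hab).1, hV b (hAV a b hab).2, h.merged hab]
    · rw [hV a hx, hV b hy, if_pos rfl, if_neg hne.symm]
  least R hR h1 h2 u hu := by
    have key := h.least R hR h1 (fun a b hab => h2 ((hA a b).2 (.inl hab)))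
    rw [hV u hu]
    split_ifs with hu'
    · have e1 := key u hu
      rw [hu'] at e1
      exact hR.trans e1 (hR.trans (hR.symm (key x hx))
        (hR.trans (h2 ((hA x y).2 (.inr ⟨rfl, rfl⟩))) (key y hy)))
    · exact key u hu

/-- A merging makes one representative disappear. -/
theorem numRep_insert {n : ℕ} {rep' rep'' : ℕ → ℕ} (h : IsRep (Set.Iio n) rep') {x y : ℕ}
    (hx : x < n) (hy : y < n) (hne : rep' x ≠ rep' y)
    (hV : ∀ u < n, rep'' u = if rep' u = rep' x then rep' y else rep' u) :
    numRep n rep'' + 1 = numRep n rep' := by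
  unfold numRep
  rw [← Finset.card_erase_add_one (a := rep' x)
    (s := (Finset.range n).filter fun u => rep' u = u)]
  · congr 2
    ext u
    simp only [Finset.mem_filter, Finset.mem_range, Finset.mem_erase]
    constructor
    · rintro ⟨hu, hu'⟩
      rw [hV u hu] at hu'
      split_ifs at hu' with h1
      · subst hu'
        rw [h.idem y hy] at h1
        exact absurd h1.symm hne
      · exact ⟨fun he => h1 (by rw [hu', he]), hu, hu'⟩
    · rintro ⟨h1, hu, hu'⟩
      refine ⟨hu, ?_⟩
      rw [hV u hu, hu', if_neg h1]
  · simp only [Finset.mem_filter, Finset.mem_range]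
    exact ⟨h.mem x hx, h.idem x hx⟩

/-- If `v` is merged with `c` further representatives, then at least `c` representatives
disappear. -/
theorem _root_.IsMerged.numRep_add_le {n : ℕ} {M : ℕ → ℕ → Prop} {rep rep' : ℕ → ℕ}
    (h : IsMerged (Set.Iio n) M rep rep') {v c : ℕ} {nb : ℕ → ℕ} (hv : v < n) (hrv : rep v = v)
    (hnb : ∀ j < c, nb j < n ∧ rep (nb j) = nb j ∧ nb j ≠ v ∧ M v (nb j))
    (hinj : ∀ i < c, ∀ j < c, nb i = nb j → i = j) :
    numRep n rep' + c ≤ numRep n rep := by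
  unfold numRep
  set B := insert v ((Finset.range c).image nb) with hB
  have hBcard : B.card = c + 1 := by
    rw [hB, Finset.card_insert_of_notMem, Finset.card_image_of_injOn, Finset.card_range]
    · intro i hi j hj
      simp only [Finset.coe_range, Set.mem_Iio] at hi hj
      exact hinj i hi j hj
    · intro hmem
      obtain ⟨j, hj, he⟩ := Finset.mem_image.1 hmem
      exact (hnb j (Finset.mem_range.1 hj)).2.2.1 he
  have hBmem : ∀ u ∈ B, u < n ∧ rep u = u ∧ rep' u = rep' v := by
    intro u hu
    rcases Finset.mem_insert.1 hu with rfl | hu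
    · exact ⟨hv, hrv, rfl⟩
    · obtain ⟨j, hj, rfl⟩ := Finset.mem_image.1 hu
      obtain ⟨h1, h2, -, h4⟩ := hnb j (Finset.mem_range.1 hj)
      exact ⟨h1, h2, (h.merged h4).symm⟩
  have hdisj : Disjoint ((Finset.range n).filter fun u => rep' u = u) (B.erase (rep' v)) := by
    rw [Finset.disjoint_left]
    intro u hu hu'
    simp only [Finset.mem_filter, Finset.mem_erase] at hu hu'
    exact hu'.1 (by rw [← (hBmem u hu'.2).2.2, hu.2])
  have hsub : ((Finset.range n).filter fun u => rep' u = u) ∪ (B.erase (rep' v)) ⊆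
      (Finset.range n).filter fun u => rep u = u := by
    intro u hu
    simp only [Finset.mem_union, Finset.mem_filter, Finset.mem_range, Finset.mem_erase] at hu ⊢
    rcases hu with ⟨h1, h2⟩ | ⟨-, hu⟩
    · refine ⟨h1, ?_⟩
      have := h.fixed u h1
      rwa [h2] at this
    · exact ⟨(hBmem u hu).1, (hBmem u hu).2.1⟩
  have h1 := Finset.card_le_card hsub
  rw [Finset.card_union_of_disjoint hdisj] at h1
  have h2 := Finset.pred_card_le_card_erase (s := B) (a := rep' v)
  omega

/-- Bit `j` of the word found for the class of a vertex becomes coordinate `d + j` of its label. -/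
theorem wp_outProg {w n k c d : ℕ} {s : Mem} (hw : n < 2 ^ w) (hkn : 2 ^ k ≤ n)
    (hN : s.reg rN = n) (hc : s.reg rC = c) (hck : c ≤ k) (hd : s.reg rD = d) (hdn : d + c ≤ n)
    (hlab : ∀ u < n, s.tab tLab u 0 < 2 ^ k) (hrep : ∀ u < n, s.tab tRep u 0 < n)
    (hL0 : ∀ u < n, ∀ i, d ≤ i → s.tab tLabel u i = 0) :
    wp w outProg (fun s' t => t ≤ c * (100 * n + 100) + 100 ∧ s'.reg rD = d + c ∧
      (∀ u < n, ∀ i, s'.tab tLabel u i = if i < d then s.tab tLabel u i else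
        if i < d + c ∧ (s.tab tLab (s.tab tRep u 0) 0).testBit (i - d) then 1 else 0)) s := by
  have hkw : k < 2 ^ w := by
    have := Nat.lt_two_pow_self (n := k)
    omega
  simp only [outProg, wp]
  refine ⟨trivial, ?_⟩
  refine wp_forLoop_const (fun j s' => s'.reg rMask = 2 ^ j ∧ s'.reg rD = d + j ∧
    (∀ u < n, ∀ i, s'.tab tLabel u i = if i < d then s.tab tLabel u i else
        if i < d + j ∧ (s.tab tLab (s.tab tRep u 0) 0).testBit (i - d) then 1 else 0))
    (n * 30 + 30) (by decide) (by decide) (by decide) (by simp [hc]; omega) ?_ ?_ ?_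
  · simp [hd]
    intro u hu i
    by_cases h1 : i < d
    · simp [h1]
    · simp [h1, hL0 u hu i (by omega)]
  · rintro j hj s1 hF1 hr1 ⟨h1, h2, h3⟩
    simp [hc] at hj
    have hN1 : s1.reg rN = n := by rw [hF1.reg _ (by decide)]; simp [hN]
    have hlab1 : s1.tab tLab = s.tab tLab := by rw [hF1.tab _ (by decide)]; simp
    have hrep1 : s1.tab tRep = s.tab tRep := by rw [hF1.tab _ (by decide)]; simp
    clear hF1
    simp only [wp]
    refine wp_forLoop_const (fun v s' => ∀ u < n, ∀ i, s'.tab tLabel u i =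
      if i = d + j ∧ u < v then (if (s.tab tLab (s.tab tRep u 0) 0).testBit j then 1 else 0)
        else s1.tab tLabel u i) 20 (by decide) (by decide) (by decide) (by simp [hN1, hw]) ?_ ?_ ?_
    · simp
    · intro v hv s2 hF2 hr2 hI
      simp [hN1] at hv
      have hlab2 : s2.tab tLab = s.tab tLab := by rw [hF2.tab _ (by decide), hlab1]
      have hrep2 : s2.tab tRep = s.tab tRep := by rw [hF2.tab _ (by decide), hrep1]
      have hD2 : s2.reg rD = d + j := by rw [hF2.reg _ (by decide)]; simp [h2]
      have hM2 : s2.reg rMask = 2 ^ j := by rw [hF2.reg _ (by decide)]; simp [h1]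
      have hr := hrep v hv
      have hl := hlab _ hr
      have hand := Nat.and_le_left (n := s.tab tLab (s.tab tRep v 0) 0) (m := 2 ^ j)
      simp only [wp, Test.Safe, Expr.Safe, Expr.val, Test.val, BinOp.Safe, BinOp.val, hr2, hlab2,
        hrep2, hD2, hM2]
      have hand0 : s.tab tLab (s.tab tRep v 0) 0 &&& 2 ^ j = 0 ↔
          ¬ (s.tab tLab (s.tab tRep v 0) 0).testBit j = true := by
        rw [Nat.and_two_pow]
        cases (s.tab tLab (s.tab tRep v 0) 0).testBit j <;> simp
      simp only [hand0]
      refine ⟨⟨⟨⟨⟨trivial, trivial, by omega, by omega⟩, trivial, by omega, by omega⟩, trivial,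
        trivial⟩, trivial, by omega, by omega⟩, fun hb => ⟨by simp, ?_⟩,
        fun hb => ⟨⟨trivial, by omega⟩, ⟨trivial, by omega⟩, trivial, by simp, ?_⟩⟩
      · intro u hu i
        simp only [Mem.tab_setReg]
        rw [hI u hu i]
        by_cases huv : u = v
        · subst huv
          by_cases hi : i = d + j
          · subst hi
            have := h3 u hu (d + j)
            simp at this
            simp [hb, this]
          · simp [hi]
        · have : u < v + 1 ↔ u < v := by omega
          simp only [this]
      · intro u hu i
        simp only [Mem.tab_setReg, Mem.tab_setCell, true_and]
        rw [hI u hu i]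
        by_cases huv : u = v
        · subst huv
          by_cases hi : i = d + j
          · subst hi
            rw [not_not] at hb
            simp [hb]
          · simp [hi]
        · have : u < v + 1 ↔ u < v := by omega
          simp only [this, huv, false_and, if_false]
    · intro s2 t2 hF2 hI ht2
      have hD2 : s2.reg rD = d + j := by rw [hF2.reg _ (by decide)]; simp [h2]
      have hM2 : s2.reg rMask = 2 ^ j := by rw [hF2.reg _ (by decide)]; simp [h1]
      simp [hN1] at ht2 hI
      simp [hD2, hM2, pow_succ]
      refine ⟨by omega, by omega, by omega, fun u hu i => ?_⟩
      rw [hI u hu i, h3 u hu i]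
      by_cases hi : i = d + j
      · subst hi
        simp [hu]
      · have : i < d + (j + 1) ↔ i < d + j := by omega
        simp only [hi, false_and, if_false, this]
  · rintro s1 t1 hF1 ⟨h1, h2, h3⟩ ht1
    simp [hc] at ht1 h2 h3
    refine ⟨?_, h2, h3⟩
    simp
    nlinarith


/-- A pair within a class changes nothing. -/
theorem _root_.IsMerged.insert_of_eq {V : Set ℕ} {rep rep' : ℕ → ℕ} {A A' : ℕ → ℕ → Prop}
    (h : IsMerged V A rep rep') {x y : ℕ} (he : rep' x = rep' y)
    (hA : ∀ a b, A' a b ↔ A a b ∨ a = x ∧ b = y) : IsMerged V A' rep rep' where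
  isRep := h.isRep
  coarse := h.coarse
  fixed := h.fixed
  merged a b hab := by
    rcases (hA a b).1 hab with hab | ⟨rfl, rfl⟩
    · exact h.merged hab
    · exact he
  least R hR h1 h2 := h.least R hR h1 fun a b hab => h2 ((hA a b).2 (.inl hab))

theorem HasLists.deg_le {s : Mem} {n : ℕ} {E : ℕ → ℕ → Prop} (h : HasLists s n E)
    (hE : ∀ x y, E x y → x < n ∧ y < n) {u : ℕ} (hu : u < n) : s.tab tDeg u 0 ≤ n :=
  (h u hu).le fun _ hy => (hE _ _ hy).2

/-- The relation of the classes is coarsened by the edges between different bits. Apart from a pass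
over the adjacency lists, the time is paid for by the decrease of the number of classes: a merging
rewrites all representatives in `O(n)` steps, and it happens only for two different classes. -/
theorem wp_mergeProg {w n : ℕ} {Q : ℕ → ℕ → Prop} {s : Mem} (hw : n < 2 ^ w)
    (hN : s.reg rN = n) (hl : HasLists s n Q) (hQ : ∀ x y, Q x y → x < n ∧ y < n)
    (hr : IsRep (Set.Iio n) fun u => s.tab tRep u 0) (hlab : ∀ u < n, s.tab tLab u 0 < 2 ^ w) :
    wp w mergeProg (fun s' t => IsMerged (Set.Iio n)
        (fun x y => Q x y ∧ s.tab tLab x 0 ≠ s.tab tLab y 0)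
        (fun u => s.tab tRep u 0) (fun u => s'.tab tRep u 0) ∧
      t + (30 * n + 30) * numRep n (fun u => s'.tab tRep u 0) ≤
        100 * (n + ∑ u ∈ Finset.range n, s.tab tDeg u 0) + 100 +
        (30 * n + 30) * numRep n (fun u => s.tab tRep u 0)) s := by
  set rep : ℕ → ℕ := fun u => s.tab tRep u 0 with hrepd
  set lab : ℕ → ℕ := fun u => s.tab tLab u 0 with hlabd
  simp only [mergeProg]
  refine wp_forLoop (fun u s' t => IsMerged (Set.Iio n) (fun x y => (Q x y ∧ lab x ≠ lab y) ∧ x < u)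
      rep (fun u => s'.tab tRep u 0) ∧
      t + (30 * n + 30) * numRep n (fun u => s'.tab tRep u 0) ≤
        100 * (u + ∑ v ∈ Finset.range u, s.tab tDeg v 0) + 10 + (30 * n + 30) * numRep n rep)
      (by decide) (by decide) (by decide) (by simpa [hN] using hw) ?_ ?_ ?_
  · refine ⟨?_, by simp [hrepd]⟩
    exact (IsMerged.refl hr).congr (fun _ _ => rfl) (by simp) (by simp) hr
  · rintro u hu s1 t1 hF1 hr1 ⟨h1, ht1⟩
    rw [hN] at hu
    have hN1 : s1.reg rN = n := by rw [hF1.reg _ (by decide)]; exact hN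
    have hDeg1 : s1.tab tDeg = s.tab tDeg := by rw [hF1.tab _ (by decide)]
    have hNb1 : s1.tab tNb = s.tab tNb := by rw [hF1.tab _ (by decide)]
    have hLab1 : s1.tab tLab = s.tab tLab := by rw [hF1.tab _ (by decide)]
    clear hF1
    have hdeg := hl.deg_le hQ hu
    simp only [wp, Expr.Safe, Expr.val, hr1, hDeg1]
    refine ⟨⟨trivial, trivial, by omega, by omega⟩, ?_⟩
    refine wp_forLoop (fun j s' t => IsMerged (Set.Iio n) (fun x y => (Q x y ∧ lab x ≠ lab y) ∧
        (x < u ∨ x = u ∧ ∃ i < j, s.tab tNb u i = y)) rep (fun u => s'.tab tRep u 0) ∧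
      t + (30 * n + 30) * numRep n (fun u => s'.tab tRep u 0) ≤
        60 * j + 10 + (30 * n + 30) * numRep n (fun u => s1.tab tRep u 0))
      (by decide) (by decide) (by decide) (by simp; omega) ?_ ?_ ?_
    · refine ⟨?_, by simp⟩
      exact h1.congr (fun _ _ => rfl) (by simp) (fun x y h => hQ x y h.1.1) hr
    · rintro j hj s2 t2 hF2 hr2 ⟨h2, ht2⟩
      simp at hj
      have hN2 : s2.reg rN = n := by rw [hF2.reg _ (by decide)]; simp [hN1]
      have hU2 : s2.reg rU = u := by rw [hF2.reg _ (by decide)]; simp [hr1]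
      have hNb2 : s2.tab tNb = s.tab tNb := by rw [hF2.tab _ (by decide)]; exact hNb1
      have hLab2 : s2.tab tLab = s.tab tLab := by rw [hF2.tab _ (by decide)]; exact hLab1
      clear hF2
      have hadj := (hl u hu).adj hj
      set y := s.tab tNb u j with hy
      have hyn := (hQ _ _ hadj).2
      have hA : ∀ a b, ((Q a b ∧ lab a ≠ lab b) ∧
          (a < u ∨ a = u ∧ ∃ i < j + 1, s.tab tNb u i = b)) ↔
          ((Q a b ∧ lab a ≠ lab b) ∧ (a < u ∨ a = u ∧ ∃ i < j, s.tab tNb u i = b)) ∨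
          lab u ≠ lab y ∧ a = u ∧ b = y := by
        intro a b
        constructor
        · rintro ⟨h3, h4 | ⟨rfl, i, hi, rfl⟩⟩
          · exact .inl ⟨h3, .inl h4⟩
          · rcases Nat.lt_succ_iff_lt_or_eq.1 hi with hi | rfl
            · exact .inl ⟨h3, .inr ⟨rfl, i, hi, rfl⟩⟩
            · exact .inr ⟨h3.2, rfl, rfl⟩
        · rintro (⟨h3, h4 | ⟨rfl, i, hi, rfl⟩⟩ | ⟨h3, rfl, rfl⟩)
          · exact ⟨h3, .inl h4⟩
          · exact ⟨h3, .inr ⟨rfl, i, by omega, rfl⟩⟩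
          · exact ⟨⟨hadj, h3⟩, .inr ⟨rfl, j, by omega, rfl⟩⟩
      have hru := h2.isRep.mem u hu
      have hry := h2.isRep.mem y hyn
      simp only [Set.mem_Iio] at hru hry
      have hlu := hlab u hu
      have hly := hlab y hyn
      simp only [wp, Test.Safe, Expr.Safe, Expr.val, Test.val, Mem.reg_setReg, Mem.tab_setReg,
        Nat.reduceEqDiff, ↓reduceIte, hU2, hr2, hNb2, hLab2, ← hy]
      refine ⟨⟨trivial, trivial, by omega, by omega⟩, ⟨trivial, trivial, by omega, by omega⟩,
        ⟨trivial, trivial, by omega, by omega⟩, ⟨⟨⟨trivial, trivial, by omega, by omega⟩,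
        ⟨trivial, trivial, by omega, by omega⟩, by omega, by omega⟩, trivial, trivial, by omega,
        by omega⟩, ?_, ?_⟩
      · rintro ⟨hne1, hne2⟩
        refine wp_forLoop_const (fun v s' => ∀ z < n, s'.tab tRep z 0 =
          if z < v ∧ s2.tab tRep z 0 = s2.tab tRep u 0 then s2.tab tRep y 0 else s2.tab tRep z 0)
          20 (by decide) (by decide) (by decide) (by simp [hN2]; omega) (by simp) ?_ ?_
        · intro v hv s3 hF3 hr3 hI
          simp [hN2] at hv
          have hA3 : s3.reg rA = s2.tab tRep u 0 := by rw [hF3.reg _ (by decide)]; simp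
          have hB3 : s3.reg rB = s2.tab tRep y 0 := by rw [hF3.reg _ (by decide)]; simp
          have hv3 : s3.tab tRep v 0 = s2.tab tRep v 0 := by simpa using hI v hv
          have hvn := h2.isRep.mem v hv
          simp only [Set.mem_Iio] at hvn
          simp only [wp, Test.Safe, Expr.Safe, Expr.val, Test.val, hr3, hA3, hB3, hv3]
          refine ⟨⟨⟨trivial, trivial, by omega, by omega⟩, trivial, by omega, by omega⟩, ?_, ?_⟩
          · intro he
            refine ⟨⟨trivial, by omega⟩, ⟨trivial, by omega⟩, trivial, by simp, fun z hz => ?_⟩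
            simp only [Mem.tab_setReg, Mem.tab_setCell, and_true, true_and]
            by_cases hzv : z = v
            · subst hzv; simp [he]
            · rw [if_neg hzv, hI z hz]
              simp only [show z < v + 1 ↔ z < v by omega]
          · intro he
            refine ⟨by simp, fun z hz => ?_⟩
            simp only [Mem.tab_setReg]
            rw [hI z hz]
            by_cases hzv : z = v
            · subst hzv; simp [he]
            · simp only [show z < v + 1 ↔ z < v by omega]
        · intro s3 t3 hF3 hI ht3
          simp [hN2] at hI ht3
          have hI' : ∀ z < n, s3.tab tRep z 0 = if s2.tab tRep z 0 = s2.tab tRep u 0 then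
              s2.tab tRep y 0 else s2.tab tRep z 0 := fun z hz => by rw [hI z hz]; simp [hz]
          have hnum := numRep_insert (rep'' := fun u => s3.tab tRep u 0) h2.isRep hu hyn hne2 hI'
          refine ⟨h2.insert (x := u) (y := y) hu hyn hr hne2 hI'
            (fun a b => by rw [hA]; simp [hlabd, hne1]) (fun x y h => hQ x y h.1.1), ?_⟩
          simp only [Test.cost, Expr.cost]
          rw [← hnum, Nat.mul_succ] at ht2
          omega
      · intro hne
        simp only [Test.cost, Expr.cost]
        refine ⟨?_, by omega⟩
        by_cases hne1 : lab u = lab y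
        · exact h2.congr (fun _ _ => rfl) (fun a b => by rw [hA]; simp [hne1])
            (fun x y h => hQ x y h.1.1) hr
        · refine h2.insert_of_eq (x := u) (y := y) ?_ (fun a b => by rw [hA]; simp [hne1])
          by_contra hne2
          exact hne ⟨hne1, hne2⟩
    · rintro s2 t2 hF2 ⟨h2, ht2⟩
      simp at h2 ht2
      refine ⟨h2.congr (fun _ _ => rfl) (fun a b => ?_) (fun x y h => hQ x y h.1.1) hr, ?_⟩
      · refine and_congr_right fun hab => ?_
        rw [Nat.lt_succ_iff_lt_or_eq]
        refine or_congr_right ⟨fun h => ⟨h, ?_⟩, fun h => h.1⟩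
        subst h
        exact ((hl a hu).adj_iff b).1 hab.1
      · simp only [Mem.tab_setReg, Expr.cost]
        rw [Finset.sum_range_succ]
        omega
  · rintro s1 t1 hF1 ⟨h1, ht1⟩
    rw [hN] at h1 ht1
    exact ⟨h1.congr (fun _ _ => rfl) (fun a b => ⟨fun h => ⟨h, (hQ _ _ h.1).1⟩, fun h => h.1⟩)
      (fun x y h => hQ x y h.1.1) hr, by omega⟩


theorem _root_.quotAdj_congr {A A' : ℕ → ℕ → Prop} (h : ∀ x y, A' x y ↔ A x y) (rep : ℕ → ℕ)
    (a b : ℕ) : quotAdj A' rep a b ↔ quotAdj A rep a b := by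
  simp only [quotAdj, h]

theorem _root_.quotAdj_insert {A A' : ℕ → ℕ → Prop} {x y : ℕ}
    (h : ∀ a b, A' a b ↔ A a b ∨ a = x ∧ b = y) (rep : ℕ → ℕ) (a b : ℕ) :
    quotAdj A' rep a b ↔ quotAdj A rep a b ∨ rep x ≠ rep y ∧ a = rep x ∧ b = rep y := by
  constructor
  · rintro ⟨hne, u, v, huv, rfl, rfl⟩
    rcases (h u v).1 huv with huv | ⟨rfl, rfl⟩
    · exact .inl ⟨hne, u, v, huv, rfl, rfl⟩
    · exact .inr ⟨hne, rfl, rfl⟩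
  · rintro (⟨hne, u, v, huv, rfl, rfl⟩ | ⟨hne, rfl, rfl⟩)
    · exact ⟨hne, u, v, (h u v).2 (.inl huv), rfl, rfl⟩
    · exact ⟨hne, x, y, (h x y).2 (.inr ⟨rfl, rfl⟩), rfl, rfl⟩

/-- The new adjacency lists are those of the quotient of the arcs `A`, and the pairs of adjacent
classes are marked with `q`. -/
structure RebuildInv (s : Mem) (n q : ℕ) (rep : ℕ → ℕ) (A : ℕ → ℕ → Prop) : Prop where
  stamp_le : ∀ a < n, ∀ b < n, s.tab tStamp a b ≤ q
  stamp_eq : ∀ a < n, ∀ b < n, s.tab tStamp a b = q ↔ quotAdj A rep a b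
  list : ∀ a < n, IsNbList (quotAdj A rep) a (s.tab tNewNb a) (s.tab tNewDeg a 0)

theorem RebuildInv.congr {s s' : Mem} {n q : ℕ} {rep : ℕ → ℕ} {A A' : ℕ → ℕ → Prop}
    (h : RebuildInv s n q rep A) (hs : s'.tab = s.tab)
    (hA : ∀ a b, quotAdj A' rep a b ↔ quotAdj A rep a b) : RebuildInv s' n q rep A' where
  stamp_le := by rw [hs]; exact h.stamp_le
  stamp_eq a ha b hb := by rw [hs, hA]; exact h.stamp_eq a ha b hb
  list a ha := by rw [hs]; exact (h.list a ha).congr rfl (fun _ _ => rfl) (hA a)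

/-- A new pair of adjacent classes is met. -/
theorem RebuildInv.push {s s' : Mem} {n q : ℕ} {rep : ℕ → ℕ} {A A' : ℕ → ℕ → Prop}
    (h : RebuildInv s n q rep A) {a b : ℕ} (hab : ¬ quotAdj A rep a b)
    (hA : ∀ c d, quotAdj A' rep c d ↔ quotAdj A rep c d ∨ c = a ∧ d = b)
    (h1 : ∀ c d, s'.tab tStamp c d = if c = a ∧ d = b then q else s.tab tStamp c d)
    (h2 : ∀ c i, s'.tab tNewNb c i =
      if c = a ∧ i = s.tab tNewDeg a 0 then b else s.tab tNewNb c i)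
    (h3 : ∀ c, s'.tab tNewDeg c 0 = if c = a then s.tab tNewDeg a 0 + 1 else s.tab tNewDeg c 0) :
    RebuildInv s' n q rep A' where
  stamp_le c hc d hd := by
    rw [h1]
    split_ifs
    · exact le_rfl
    · exact h.stamp_le c hc d hd
  stamp_eq c hc d hd := by
    rw [h1, hA, ← h.stamp_eq c hc d hd]
    split_ifs with hcd <;> simp [hcd]
  list c hc := by
    by_cases hca : c = a
    · subst hca
      rw [h3, if_pos rfl]
      refine (h.list c hc).snoc hab (fun i hi => ?_) ?_ fun d => by rw [hA]; simp
      · rw [h2, if_neg (by omega)]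
      · rw [h2, if_pos ⟨rfl, rfl⟩]
    · rw [h3, if_neg hca]
      refine (h.list c hc).congr rfl (fun i hi => ?_) fun d => by rw [hA]; simp [hca]
      rw [h2, if_neg (by tauto)]

/-- All marks of earlier phases are at most `ph`. Hence the table of the marks need not be cleared,
which would take `n ^ 2` steps in every phase. -/
theorem wp_rebuildProg {w n ph : ℕ} {Q : ℕ → ℕ → Prop} {s : Mem} (hw : n < 2 ^ w)
    (hN : s.reg rN = n) (hph : s.reg rPhase = ph) (hphn : ph < n) (hl : HasLists s n Q)
    (hQ : ∀ x y, Q x y → x < n ∧ y < n) (hr : ∀ u < n, s.tab tRep u 0 < n)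
    (hst : ∀ a < n, ∀ b < n, s.tab tStamp a b ≤ ph) (hnd : ∀ a < n, s.tab tNewDeg a 0 = 0) :
    wp w rebuildProg (fun s' t => RebuildInv s' n (ph + 1) (fun u => s.tab tRep u 0) Q ∧
      t ≤ 100 * (n + ∑ u ∈ Finset.range n, s.tab tDeg u 0) + 100) s := by
  set rep : ℕ → ℕ := fun u => s.tab tRep u 0 with hrepd
  simp only [rebuildProg, wp, Expr.Safe, Expr.val, BinOp.Safe, BinOp.val, hph]
  refine ⟨⟨trivial, trivial, trivial⟩, ?_⟩
  refine wp_forLoop_sum (fun u s' => RebuildInv s' n (ph + 1) rep (fun x y => Q x y ∧ x < u))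
    (fun u => 60 * s.tab tDeg u 0 + 20)
    (by decide) (by decide) (by decide) (by simpa [hN] using hw) ?_ ?_ ?_
  · refine ⟨fun a ha b hb => ?_, fun a ha b hb => ?_, fun a ha => ?_⟩
    · have := hst a ha b hb
      simp only [Mem.tab_setReg]
      omega
    · have := hst a ha b hb
      simp only [Mem.tab_setReg]
      refine iff_of_false (by omega) ?_
      rintro ⟨-, x, y, ⟨-, hx⟩, -⟩
      omega
    · simp only [Mem.tab_setReg, hnd a ha]
      refine .nil _ ?_
      rintro b ⟨-, x, y, ⟨-, hx⟩, -⟩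
      omega
  · rintro u hu s1 hF1 hr1 h1
    simp [hN] at hu
    have hN1 : s1.reg rN = n := by rw [hF1.reg _ (by decide)]; simp [hN]
    have hSt1 : s1.reg rStamp = ph + 1 := by rw [hF1.reg _ (by decide)]; simp
    have hDeg1 : s1.tab tDeg = s.tab tDeg := by rw [hF1.tab _ (by decide)]; rfl
    have hNb1 : s1.tab tNb = s.tab tNb := by rw [hF1.tab _ (by decide)]; rfl
    have hRep1 : s1.tab tRep = s.tab tRep := by rw [hF1.tab _ (by decide)]; rfl
    clear hF1
    have hdeg := hl.deg_le hQ hu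
    simp only [wp, Expr.Safe, Expr.val, hr1, hDeg1]
    refine ⟨⟨trivial, trivial, by omega, by omega⟩, ?_⟩
    refine wp_forLoop_const (fun j s' => RebuildInv s' n (ph + 1) rep
        (fun x y => Q x y ∧ (x < u ∨ x = u ∧ ∃ i < j, s.tab tNb u i = y)))
      50 (by decide) (by decide) (by decide) (by simp; omega) ?_ ?_ ?_
    · exact h1.congr rfl (quotAdj_congr (by simp) _)
    · rintro j hj s2 hF2 hr2 h2
      simp at hj
      have hU2 : s2.reg rU = u := by rw [hF2.reg _ (by decide)]; simp [hr1]
      have hSt2 : s2.reg rStamp = ph + 1 := by rw [hF2.reg _ (by decide)]; simp [hSt1]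
      have hNb2 : s2.tab tNb = s.tab tNb := by rw [hF2.tab _ (by decide)]; exact hNb1
      have hRep2 : s2.tab tRep = s.tab tRep := by rw [hF2.tab _ (by decide)]; exact hRep1
      clear hF2
      have hadj := (hl u hu).adj hj
      set y := s.tab tNb u j with hy
      have hyn := (hQ _ _ hadj).2
      have hA : ∀ a b, (Q a b ∧ (a < u ∨ a = u ∧ ∃ i < j + 1, s.tab tNb u i = b)) ↔
          (Q a b ∧ (a < u ∨ a = u ∧ ∃ i < j, s.tab tNb u i = b)) ∨ a = u ∧ b = y := by
        intro a b
        constructor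
        · rintro ⟨h3, h4 | ⟨rfl, i, hi, rfl⟩⟩
          · exact .inl ⟨h3, .inl h4⟩
          · rcases Nat.lt_succ_iff_lt_or_eq.1 hi with hi | rfl
            · exact .inl ⟨h3, .inr ⟨rfl, i, hi, rfl⟩⟩
            · exact .inr ⟨rfl, rfl⟩
        · rintro (⟨h3, h4 | ⟨rfl, i, hi, rfl⟩⟩ | ⟨rfl, rfl⟩)
          · exact ⟨h3, .inl h4⟩
          · exact ⟨h3, .inr ⟨rfl, i, by omega, rfl⟩⟩
          · exact ⟨hadj, .inr ⟨rfl, j, by omega, rfl⟩⟩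
      have hru : rep u < n := hr u hu
      have hry : rep y < n := hr y hyn
      have hdn : s2.tab tNewDeg (rep u) 0 ≤ n := (h2.list _ hru).le (by
        rintro _ ⟨-, x, z, h, -, rfl⟩
        exact hr z (hQ _ _ h.1).2)
      have hstl := h2.stamp_le _ hru _ hry
      have hste := h2.stamp_eq _ hru _ hry
      have eu : s.tab tRep u 0 = rep u := rfl
      have ey : s.tab tRep y 0 = rep y := rfl
      simp only [wp, Test.Safe, Expr.Safe, Expr.val, Test.val, BinOp.Safe, BinOp.val,
        Mem.reg_setReg, Mem.tab_setReg, Mem.reg_setCell,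
        Nat.reduceEqDiff, ↓reduceIte, hU2, hr2, hNb2, hRep2, ← hy, eu, ey, hSt2]
      refine ⟨⟨trivial, trivial, by omega, by omega⟩, ⟨⟨trivial, trivial, by omega, by omega⟩,
        trivial, by omega, by omega⟩, ⟨⟨trivial, trivial, by omega, by omega⟩, ⟨trivial, trivial,
        by omega, by omega⟩, trivial, by omega, by omega⟩, ?_, ?_⟩
      · rintro ⟨hne1, hne2⟩
        have hpush : ∀ s', _ → _ → _ → RebuildInv s' n (ph + 1) rep
            (fun x y => Q x y ∧ (x < u ∨ x = u ∧ ∃ i < j + 1, s.tab tNb u i = y)) := fun s' =>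
          h2.push (s' := s') (a := rep u) (b := rep y) (fun h => hne2 (hste.2 h))
          (fun a b => by rw [quotAdj_insert hA]; simp [hne1])
        simp only [Nat.lt_succ_iff] at hpush
        simp [(by omega : rep u < 2 ^ w), (by omega : rep y < 2 ^ w),
          (by omega : s2.tab tNewDeg (rep u) 0 < 2 ^ w), (by omega : 0 < 2 ^ w)]
        apply hpush <;> simp
      · intro hne
        simp only [Test.cost, Expr.cost]
        refine ⟨by omega, h2.congr rfl fun a b => ?_⟩
        rw [quotAdj_insert hA]
        refine or_iff_left_of_imp ?_
        rintro ⟨hne1, rfl, rfl⟩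
        rw [← hste]
        by_contra hne2
        exact hne ⟨hne1, hne2⟩
    · rintro s2 t2 hF2 h2 ht2
      simp at h2 ht2
      refine ⟨by simp only [Expr.cost]; omega, h2.congr rfl (quotAdj_congr (fun a b => ?_) _)⟩
      refine and_congr_right fun hab => ?_
      rw [Nat.lt_succ_iff_lt_or_eq]
      refine or_congr_right ⟨fun h => ⟨h, ?_⟩, fun h => h.1⟩
      subst h
      exact ((hl a hu).adj_iff b).1 hab
  · rintro s1 t1 hF1 h1 ht1
    simp only [Mem.reg_setReg, Nat.reduceEqDiff, ↓reduceIte, hN] at h1 ht1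
    refine ⟨h1.congr rfl (quotAdj_congr (fun a b => ⟨fun h => ⟨h, (hQ _ _ h).1⟩, fun h => h.1⟩) _),
      ?_⟩
    rw [Finset.sum_add_distrib, Finset.sum_add_distrib, ← Finset.mul_sum] at ht1
    simp [Expr.cost] at ht1 ⊢
    omega

theorem wp_copyProg {w n : ℕ} {Q : ℕ → ℕ → Prop} {s : Mem} (hw : n < 2 ^ w)
    (hN : s.reg rN = n) (hl : ∀ a < n, IsNbList Q a (s.tab tNewNb a) (s.tab tNewDeg a 0))
    (hQ : ∀ x y, Q x y → x < n ∧ y < n) :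
    wp w copyProg (fun s' t => HasLists s' n Q ∧ (∀ a < n, s'.tab tNewDeg a 0 = 0) ∧
      (∀ a < n, s'.tab tDeg a 0 = s.tab tNewDeg a 0) ∧
      t ≤ 100 * (n + ∑ u ∈ Finset.range n, s.tab tNewDeg u 0) + 100) s := by
  simp only [copyProg]
  refine wp_forLoop_sum (fun u s' => (∀ a < u, IsNbList Q a (s'.tab tNb a) (s'.tab tDeg a 0)) ∧
      (∀ a < u, s'.tab tDeg a 0 = s.tab tNewDeg a 0) ∧
      ∀ a, s'.tab tNewDeg a 0 = if a < u then 0 else s.tab tNewDeg a 0)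
    (fun u => 60 * s.tab tNewDeg u 0 + 50)
    (by decide) (by decide) (by decide) (by simpa [hN] using hw) (by simp) ?_ ?_
  · rintro u hu s1 hF1 hr1 ⟨h1, h1d, h1'⟩
    simp [hN] at hu
    have hNb1 : s1.tab tNewNb = s.tab tNewNb := by rw [hF1.tab _ (by decide)]
    clear hF1
    have hlu := hl u hu
    have hdeg : s.tab tNewDeg u 0 ≤ n := hlu.le fun _ hy => (hQ _ _ hy).2
    have hdu : s1.tab tNewDeg u 0 = s.tab tNewDeg u 0 := by simp [h1']
    simp only [wp, Expr.Safe, Expr.val, hr1, hdu, Mem.reg_setReg,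
      Mem.reg_setCell, Nat.reduceEqDiff, ↓reduceIte]
    refine ⟨⟨trivial, trivial, by omega, by omega⟩, ⟨trivial, by omega⟩, ⟨trivial, by omega⟩,
      trivial, ⟨trivial, by omega⟩, ⟨trivial, by omega⟩, trivial, ?_⟩
    refine wp_forLoop_const (fun j s' => (∀ a < u, s'.tab tNb a = s1.tab tNb a) ∧
        ∀ i < j, s'.tab tNb u i = s.tab tNewNb u i)
      50 (by decide) (by decide) (by decide) (by simp; omega) (by simp) ?_ ?_
    · rintro j hj s2 hF2 hr2 ⟨h2, h2'⟩
      simp at hj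
      have hU2 : s2.reg rU = u := by rw [hF2.reg _ (by decide)]; simp [hr1]
      have hNb2 : s2.tab tNewNb = s.tab tNewNb := by rw [hF2.tab _ (by decide), ← hNb1]; rfl
      clear hF2
      simp [hU2, hr2, hNb2, (by omega : u < 2 ^ w), (by omega : j < 2 ^ w)]
      refine ⟨fun a ha => ?_, fun i hi => ?_⟩
      · rw [← h2 a ha]
        ext i
        simp [show a ≠ u by omega]
      · by_cases hij : i = j
        · simp [hij]
        · simp [hij, h2' i (by omega)]
    · rintro s2 t2 hF2 ⟨h2, h2'⟩ ht2
      simp at ht2 h2'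
      have hD2 : ∀ a, s2.tab tDeg a 0 =
          if a = u then s.tab tNewDeg u 0 else s1.tab tDeg a 0 := by
        intro a; rw [hF2.tab _ (by decide)]; simp
      have hND2 : ∀ a, s2.tab tNewDeg a 0 = if a = u then 0 else s1.tab tNewDeg a 0 := by
        intro a; rw [hF2.tab _ (by decide)]; simp
      simp only [Expr.cost, Mem.tab_setReg]
      refine ⟨by omega, fun a ha => ?_, fun a ha => ?_, fun a => ?_⟩
      · rcases Nat.lt_succ_iff_lt_or_eq.1 ha with ha | rfl
        · rw [h2 a ha, hD2, if_neg (by omega)]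
          exact h1 a ha
        · rw [hD2, if_pos rfl]
          exact hlu.congr rfl h2' fun _ => Iff.rfl
      · rcases Nat.lt_succ_iff_lt_or_eq.1 ha with ha | rfl
        · rw [hD2, if_neg (by omega), h1d a ha]
        · rw [hD2, if_pos rfl]
      · rw [hND2, h1']
        split_ifs <;> first | rfl | omega
  · rintro s1 t1 hF1 ⟨h1, h1d, h1'⟩ ht1
    rw [hN] at h1 h1' ht1 h1d
    rw [Finset.sum_add_distrib, Finset.sum_add_distrib, ← Finset.mul_sum] at ht1
    simp at ht1
    exact ⟨h1, fun a ha => by simp [h1', ha], h1d, by omega⟩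

end WordRAM

/-! ### Phases -/

namespace WordRAM

theorem HasLists.congr {s s' : Mem} {n : ℕ} {E : ℕ → ℕ → Prop} (h : HasLists s n E)
    (h1 : s'.tab tNb = s.tab tNb) (h2 : s'.tab tDeg = s.tab tDeg) : HasLists s' n E := by
  intro u hu
  rw [h1, h2]
  exact h u hu

/-- A quotient graph has at most as many edges as the graph. -/
theorem sum_deg_quot_le {n : ℕ} {Q : ℕ → ℕ → Prop} {rep : ℕ → ℕ} {nb nb' : ℕ → ℕ → ℕ}
    {deg deg' : ℕ → ℕ} (hQ : ∀ x y, Q x y → x < n)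
    (h : ∀ u < n, IsNbList Q u (nb u) (deg u))
    (h' : ∀ u < n, IsNbList (quotAdj Q rep) u (nb' u) (deg' u)) :
    ∑ u ∈ Finset.range n, deg' u ≤ ∑ u ∈ Finset.range n, deg u := by
  have hc : ∀ d : ℕ → ℕ, ∑ u ∈ Finset.range n, d u =
      ((Finset.range n).sigma fun u => Finset.range (d u)).card := fun d => by simp
  rw [hc, hc]
  refine Finset.card_le_card_of_forall_subsingleton
    (fun p q => rep q.1 = p.1 ∧ rep (nb q.1 q.2) = nb' p.1 p.2) ?_ ?_
  · rintro ⟨a, i⟩ hp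
    simp only [Finset.mem_sigma, Finset.mem_range] at hp
    obtain ⟨-, x, y, hxy, hx, hy⟩ := (h' a hp.1).adj hp.2
    obtain ⟨j, hj, rfl⟩ := ((h x (hQ _ _ hxy)).adj_iff y).1 hxy
    exact ⟨⟨x, j⟩, by simp [hQ _ _ hxy, hj], hx, hy⟩
  · rintro ⟨x, j⟩ _ ⟨a, i⟩ ⟨ha, ha1, ha2⟩ ⟨b, i'⟩ ⟨hb, hb1, hb2⟩
    simp only [Finset.mem_sigma, Finset.mem_range] at ha hb ha1 ha2 hb1 hb2
    obtain rfl : a = b := ha1.symm.trans hb1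
    obtain rfl := (h' a ha.1).inj i ha.2 i' hb.2 (ha2.symm.trans hb2)
    rfl

/-- The labels in the memory. -/
def labels (s : Mem) (u i : ℕ) : Bool := s.tab tLabel u i = 1

/-- The state before phase `ph` of the computation of the labels. The claims about the labels are
made under a condition `P`, which provides a labeling `l` of the graph. -/
structure LabelInv (n k : ℕ) (E : ℕ → ℕ → Prop) (P : Prop) (S : Finset ℕ) (l : ℕ → ℕ → Bool)
    (ph : ℕ) (s : Mem) : Prop where
  isRep : IsRep (Set.Iio n) fun u => s.tab tRep u 0
  lists : HasLists s n (quotAdj E fun u => s.tab tRep u 0)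
  stamp_le : ∀ a < n, ∀ b < n, s.tab tStamp a b ≤ ph
  newDeg : ∀ a < n, s.tab tNewDeg a 0 = 0
  label_le : ∀ u < n, ∀ i, s.tab tLabel u i ≤ 1
  label_zero : ∀ u < n, ∀ i, s.reg rD ≤ i → s.tab tLabel u i = 0
  length_le : s.reg rD + numRep n (fun u => s.tab tRep u 0) ≤ n
  sum_deg_le : ∑ u ∈ Finset.range n, s.tab tDeg u 0 ≤ (2 * k + 1) * n
  progress : P → ∃ T, LabelProgress (Set.Iio n) S l (fun u => s.tab tRep u 0) (s.reg rD) (labels s) T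
  done : (∀ u < n, s.tab tDeg u 0 = 0) ∨ numRep n (fun u => s.tab tRep u 0) + ph ≤ n

theorem LabelInv.congr {n k : ℕ} {E : ℕ → ℕ → Prop} {P : Prop} {S : Finset ℕ} {l : ℕ → ℕ → Bool}
    {ph : ℕ} {s s' : Mem} (h : LabelInv n k E P S l ph s) (ht : s'.tab = s.tab)
    (hd : s'.reg rD = s.reg rD) : LabelInv n k E P S l ph s' := by
  have hl : labels s' = labels s := by funext u i; simp only [labels, ht]
  refine ⟨?_, ?_, ?_, ?_, ?_, ?_, ?_, ?_, ?_, ?_⟩ <;> simp only [ht, hd, hl]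
  exacts [h.isRep, h.lists.congr (by rw [ht]) (by rw [ht]), h.stamp_le, h.newDeg, h.label_le,
    h.label_zero, h.length_le, h.sum_deg_le, h.progress, h.done]

/-- The time of a phase that contracts edges is paid for by the number of classes that disappear, up
to `O(n)` steps. -/
theorem wp_contractProg {w n k ph m v : ℕ} {E : ℕ → ℕ → Prop} {P : Prop} {S : Finset ℕ}
    {l : ℕ → ℕ → Bool} {s : Mem} (hw : n < 2 ^ w) (hk : 1 ≤ k) (hkn : 2 ^ k ≤ n)
    (hE : IsGraphOn (Set.Iio n) E) (hP : P → CubeLabeling (Set.Iio n) E S l)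
    (hI : LabelInv n k E P S l ph s) (hph : s.reg rPhase = ph) (hphn : ph < n)
    (hN : s.reg rN = n) (hPow : s.reg rPow = 2 ^ k) (hv : v < n) (hroot : s.reg rRoot = v)
    (hm : s.reg rMaxDeg = m) (hm1 : 1 ≤ m) (hmv : s.tab tDeg v 0 = m)
    (hmax : ∀ u < n, s.tab tDeg u 0 ≤ m) :
    wp w contractProg (fun s' t =>
      LabelInv n k E P S l (ph + 1) s' ∧
      t + 1500 * n * numRep n (fun u => s'.tab tRep u 0) ≤
        1200 * n + 1500 * n * numRep n (fun u => s.tab tRep u 0)) s := by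
  set rep : ℕ → ℕ := fun u => s.tab tRep u 0 with hrep
  set Q := quotAdj E rep with hQd
  set c := min k m with hc
  have hr := hI.isRep
  have hQ : IsGraphOn (repSet (Set.Iio n) rep) Q := isGraphOn_quotAdj hE hr
  have hVn : ∀ y ∈ repSet (Set.Iio n) rep, y < n := fun y hy => hy.1
  have hQn : ∀ x y, Q x y → x < n ∧ y < n := fun x y h =>
    ⟨hVn _ (hQ.left_mem h), hVn _ (hQ.right_mem h)⟩
  have hnb : IsNbList Q v (s.tab tNb v) m := hmv ▸ hI.lists v hv
  have hvQ : v ∈ repSet (Set.Iio n) rep := hQ.left_mem (hnb.adj (by omega : 0 < m))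
  have hmath : ∃ (T : Finset ℕ) (co : ℕ → ℕ), P →
      LabelProgress (Set.Iio n) S l rep (s.reg rD) (labels s) T ∧
      (∀ j < m, diffSet T l v (s.tab tNb v j) = {co j}) ∧
      (∀ i < m, ∀ j < m, co i = co j → i = j) ∧
      Layering (repSet (Set.Iio n) rep) Q v (fun y => (diffSet T l v y).card)
        (fun y b => b < c ∧ co b ∈ diffSet T l v y) := by
    by_cases hp : P
    · obtain ⟨T, hT⟩ := hI.progress hp
      have hq := (hP hp).quot hE hT.1 hr hT.2.1
      obtain ⟨co, h1, h2⟩ := hq.exists_coord hQ hnb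
      exact ⟨T, co, fun _ => ⟨hT, h1, h2, hq.layering hQ hvQ hnb h1 (by omega)⟩⟩
    · exact ⟨∅, id, fun h => absurd h hp⟩
  obtain ⟨T, co, hmath⟩ := hmath
  -- the sum of the degrees is at most `n * m`, as `m` is the maximal degree, and `(2 * k + 1) * n`
  have hsum : ∑ u ∈ Finset.range n, s.tab tDeg u 0 ≤ 3 * n * c := by
    have h1 : ∑ u ∈ Finset.range n, s.tab tDeg u 0 ≤ n * m := by
      refine (Finset.sum_le_card_nsmul _ _ m fun u hu => hmax u (Finset.mem_range.1 hu)).trans ?_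
      simp
    have h2 := hI.sum_deg_le
    rcases le_total k m with h | h
    · rw [hc, min_eq_left h]; nlinarith
    · rw [hc, min_eq_right h]; nlinarith
  simp only [contractProg, wp]
  refine wp_frame (wp_bfsInitProg hw hk hkn hN hPow hv hroot hm hQ hVn hnb) ?_
  rintro s2 t2 hF2 ⟨ht2, hS2, hTail2, hC2, hque2, hlab2, hlabv2⟩
  have hN2 : s2.reg rN = n := by rw [hF2.reg _ (by decide)]; exact hN
  have hD2 : s2.reg rD = s.reg rD := hF2.reg _ (by decide)
  have hph2 : s2.reg rPhase = ph := by rw [hF2.reg _ (by decide)]; exact hph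
  have hNb2 : s2.tab tNb = s.tab tNb := hF2.tab _ (by decide)
  have hDeg2 : s2.tab tDeg = s.tab tDeg := hF2.tab _ (by decide)
  have hRep2 : s2.tab tRep = s.tab tRep := hF2.tab _ (by decide)
  have hSt2 : s2.tab tStamp = s.tab tStamp := hF2.tab _ (by decide)
  have hND2 : s2.tab tNewDeg = s.tab tNewDeg := hF2.tab _ (by decide)
  have hL2 : s2.tab tLabel = s.tab tLabel := hF2.tab _ (by decide)
  clear hF2
  have hbits0 : P → ∀ y, Q v y → ∀ b, (s2.tab tLab y 0).testBit b = true ↔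
      b < c ∧ co b ∈ diffSet T l v y := by
    intro hp y hy b
    obtain ⟨-, hco, hinj, -⟩ := hmath hp
    obtain ⟨j, hj, rfl⟩ := (hnb.adj_iff y).1 hy
    rw [hlab2 j hj, hco j hj, Finset.mem_singleton]
    have h1 : b < c ∧ co b = co j ↔ b < c ∧ b = j :=
      and_congr_right fun hb => ⟨hinj b (by omega) j hj, fun h => by rw [h]⟩
    rw [h1]
    split_ifs with hjk
    · rw [Nat.testBit_two_pow]
      simp only [decide_eq_true_eq]
      omega
    · simp only [Nat.zero_testBit, Bool.false_eq_true, false_iff]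
      omega
  refine wp_frame (wp_bfsProg (P := P) hw hkn hN2 hv hQ hVn (hI.lists.congr hNb2 hDeg2)
    (fun hp => (hmath hp).2.2.2) hbits0 hlabv2 hS2 hTail2
    (fun j hj => by rw [hque2 j hj]; exact hnb.adj hj)) ?_
  rintro s3 t3 hF3 ⟨ht3, hS3, hbits3⟩
  have hN3 : s3.reg rN = n := by rw [hF3.reg _ (by decide)]; exact hN2
  have hC3 : s3.reg rC = c := by rw [hF3.reg _ (by decide)]; exact hC2
  have hD3 : s3.reg rD = s.reg rD := by rw [hF3.reg _ (by decide)]; exact hD2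
  have hph3 : s3.reg rPhase = ph := by rw [hF3.reg _ (by decide)]; exact hph2
  have hNb3 : s3.tab tNb = s.tab tNb := by rw [hF3.tab _ (by decide)]; exact hNb2
  have hDeg3 : s3.tab tDeg = s.tab tDeg := by rw [hF3.tab _ (by decide)]; exact hDeg2
  have hRep3 : s3.tab tRep = s.tab tRep := by rw [hF3.tab _ (by decide)]; exact hRep2
  have hSt3 : s3.tab tStamp = s.tab tStamp := by rw [hF3.tab _ (by decide)]; exact hSt2
  have hND3 : s3.tab tNewDeg = s.tab tNewDeg := by rw [hF3.tab _ (by decide)]; exact hND2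
  have hL3 : s3.tab tLabel = s.tab tLabel := by rw [hF3.tab _ (by decide)]; exact hL2
  clear hF3
  rw [hDeg2] at ht3
  have hrn : ∀ u < n, s.tab tRep u 0 < n := hr.mem
  have hlabv3 : s3.tab tLab v 0 = 0 := by rw [hS3.root.2, hlabv2]
  have hlabnb3 : ∀ j < c, s3.tab tLab (s.tab tNb v j) 0 = 2 ^ j := fun j hj => by
    rw [(hS3.first _ (hnb.adj (by omega))).2, hlab2 j (by omega), if_pos (by omega)]
  -- the neighbors of `v` used in this phase will be merged with `v`
  have hmerge : ∀ rep', IsMerged (Set.Iio n)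
      (fun x y => Q x y ∧ s3.tab tLab x 0 ≠ s3.tab tLab y 0) rep rep' →
      numRep n rep' + c ≤ numRep n rep := by
    intro rep' h
    refine h.numRep_add_le hv hvQ.2 (nb := s.tab tNb v) (fun j hj => ?_) fun i hi j hj =>
      hnb.inj i (by omega) j (by omega)
    have hadj := hnb.adj (by omega : j < m)
    refine ⟨(hQn _ _ hadj).2, (hQ.right_mem hadj).2, fun h => hQ.irrefl v (by rwa [h] at hadj),
      hadj, ?_⟩
    rw [hlabv3, hlabnb3 j hj]
    exact (Nat.two_pow_pos j).ne
  -- the `c` neighbors are representatives, so that the length of the labels remains at most `n`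
  have hcn : s.reg rD + c ≤ n := by
    have h1 : s.reg rD + numRep n rep ≤ n := hI.length_le
    have h2 : c ≤ numRep n rep := by
      have hsub : (Finset.range c).image (s.tab tNb v) ⊆
          (Finset.range n).filter fun u => rep u = u := by
        intro y hy
        obtain ⟨j, hj, rfl⟩ := Finset.mem_image.1 hy
        have hadj := hnb.adj (by have := Finset.mem_range.1 hj; omega : j < m)
        exact Finset.mem_filter.2 ⟨Finset.mem_range.2 (hQn _ _ hadj).2, (hQ.right_mem hadj).2⟩
      have := Finset.card_le_card hsub
      rwa [Finset.card_image_of_injOn, Finset.card_range] at this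
      intro i hi j hj
      simp only [Finset.coe_range, Set.mem_Iio] at hi hj
      exact hnb.inj i (by omega) j (by omega)
    omega
  refine wp_frame (wp_outProg (k := k) (d := s.reg rD) hw hkn hN3 hC3 (by omega) hD3 hcn hS3.lab_lt
    (by rw [hRep3]; exact hrn) (by rw [hL3]; exact hI.label_zero)) ?_
  rintro s4 t4 hF4 ⟨ht4, hD4, hL4⟩
  have hN4 : s4.reg rN = n := by rw [hF4.reg _ (by decide)]; exact hN3
  have hph4 : s4.reg rPhase = ph := by rw [hF4.reg _ (by decide)]; exact hph3
  have hNb4 : s4.tab tNb = s.tab tNb := by rw [hF4.tab _ (by decide)]; exact hNb3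
  have hDeg4 : s4.tab tDeg = s.tab tDeg := by rw [hF4.tab _ (by decide)]; exact hDeg3
  have hRep4 : s4.tab tRep = s.tab tRep := by rw [hF4.tab _ (by decide)]; exact hRep3
  have hSt4 : s4.tab tStamp = s.tab tStamp := by rw [hF4.tab _ (by decide)]; exact hSt3
  have hND4 : s4.tab tNewDeg = s.tab tNewDeg := by rw [hF4.tab _ (by decide)]; exact hND3
  have hLab4 : s4.tab tLab = s3.tab tLab := hF4.tab _ (by decide)
  clear hF4
  rw [hRep3, hL3] at hL4
  refine wp_frame (wp_mergeProg hw hN4 (hI.lists.congr hNb4 hDeg4) hQn (by rw [hRep4]; exact hr)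
    (by
      intro u hu
      rw [hLab4]
      have := hS3.lab_lt u hu
      omega)) ?_
  rintro s5 t5 hF5 ⟨hM5, ht5⟩
  rw [hRep4, hLab4] at hM5
  rw [hRep4, hDeg4] at ht5
  change _ ≤ _ + (30 * n + 30) * numRep n rep at ht5
  have hN5 : s5.reg rN = n := by rw [hF5.reg _ (by decide)]; exact hN4
  have hD5 : s5.reg rD = s.reg rD + c := by rw [hF5.reg _ (by decide)]; exact hD4
  have hph5 : s5.reg rPhase = ph := by rw [hF5.reg _ (by decide)]; exact hph4
  have hNb5 : s5.tab tNb = s.tab tNb := by rw [hF5.tab _ (by decide)]; exact hNb4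
  have hDeg5 : s5.tab tDeg = s.tab tDeg := by rw [hF5.tab _ (by decide)]; exact hDeg4
  have hSt5 : s5.tab tStamp = s.tab tStamp := by rw [hF5.tab _ (by decide)]; exact hSt4
  have hND5 : s5.tab tNewDeg = s.tab tNewDeg := by rw [hF5.tab _ (by decide)]; exact hND4
  have hL5 : s5.tab tLabel = s4.tab tLabel := hF5.tab _ (by decide)
  clear hF5
  refine wp_frame (wp_rebuildProg hw hN5 hph5 hphn (hI.lists.congr hNb5 hDeg5) hQn hM5.isRep.mem
    (by rw [hSt5]; exact hI.stamp_le) (by rw [hND5]; exact hI.newDeg)) ?_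
  rintro s6 t6 hF6 ⟨hR6, ht6⟩
  rw [hDeg5] at ht6
  have hN6 : s6.reg rN = n := by rw [hF6.reg _ (by decide)]; exact hN5
  have hD6 : s6.reg rD = s.reg rD + c := by rw [hF6.reg _ (by decide)]; exact hD5
  have hRep6 : s6.tab tRep = s5.tab tRep := hF6.tab _ (by decide)
  have hL6 : s6.tab tLabel = s4.tab tLabel := by rw [hF6.tab _ (by decide)]; exact hL5
  clear hF6
  have hQ'n : ∀ x y, quotAdj Q (fun u => s5.tab tRep u 0) x y → x < n ∧ y < n := by
    rintro _ _ ⟨-, x, y, h, rfl, rfl⟩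
    exact ⟨hM5.isRep.mem _ (hQn _ _ h).1, hM5.isRep.mem _ (hQn _ _ h).2⟩
  refine wp_frame (wp_copyProg hw hN6 hR6.list hQ'n) ?_
  rintro s7 t7 hF7 ⟨hH7, hND7, hDeg7, ht7⟩
  have hD7 : s7.reg rD = s.reg rD + c := by rw [hF7.reg _ (by decide)]; exact hD6
  have hRep7 : s7.tab tRep = s5.tab tRep := by rw [hF7.tab _ (by decide)]; exact hRep6
  have hL7 : s7.tab tLabel = s4.tab tLabel := by rw [hF7.tab _ (by decide)]; exact hL6
  have hSt7 : s7.tab tStamp = s6.tab tStamp := hF7.tab _ (by decide)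
  clear hF7
  have hsum' := sum_deg_quot_le (fun x y h => (hQn x y h).1) hI.lists hR6.list
  have hnum := hmerge _ hM5
  have hlabels : labels s7 = fun u i => decide (s4.tab tLabel u i = 1) := by
    funext u i; simp only [labels, hL7]
  refine ⟨⟨?_, ?_, ?_, hND7, ?_, ?_, ?_, ?_, fun hp => ?_, .inr ?_⟩, ?_⟩
  · rw [hRep7]; exact hM5.isRep
  · rw [hRep7]
    intro u hu
    exact (hH7 u hu).congr rfl (fun _ _ => rfl) fun y => quotAdj_iff_of_coarse hE hM5.coarse u y
  · rw [hSt7]; exact hR6.stamp_le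
  · intro u hu i
    rw [hL7, hL4 u hu]
    split_ifs
    exacts [hI.label_le u hu i, le_rfl, Nat.zero_le _]
  · intro u hu i hi
    rw [hD7] at hi
    rw [hL7, hL4 u hu, if_neg (by omega), if_neg (by omega)]
  · have h1 : s.reg rD + numRep n rep ≤ n := hI.length_le
    rw [hD7, hRep7]
    omega
  · rw [Finset.sum_congr rfl fun u hu => hDeg7 u (Finset.mem_range.1 hu)]
    exact hsum'.trans hI.sum_deg_le
  · obtain ⟨hT, hco, hinj, -⟩ := hmath hp
    refine ⟨T \ (Finset.range c).image co, ?_⟩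
    rw [hD7, hRep7, hlabels]
    refine hT.next (hP hp) hE hr (lab := fun y => s3.tab tLab y 0) hco hinj (by omega) (hbits3 hp)
      hM5 (fun z hz i hi => ?_) fun z hz j hj => ?_
    · simp only [hL4 z hz, if_pos hi, labels]
    · rw [hL4 z hz, if_neg (by omega)]
      simp [hj, hrep]
  · have h1 : s.reg rD + numRep n rep ≤ n := hI.length_le
    have h2 : numRep n rep + ph ≤ n := by
      refine hI.done.resolve_left fun h => ?_
      have := h v hv
      omega
    rw [hRep7]
    omega
  · rw [hRep7]
    -- `Δ ≥ c` is the number of representatives that disappear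
    obtain ⟨Δ, hΔ⟩ := Nat.exists_eq_add_of_le (hnum.trans' (Nat.le_add_right _ c))
    set R' := numRep n fun u => s5.tab tRep u 0
    have hcΔ : c ≤ Δ := by omega
    have hn1 : 1 ≤ n := by omega
    have e1 : n * c ≤ n * Δ := Nat.mul_le_mul_left n hcΔ
    have e2 : Δ ≤ n * Δ := Nat.le_mul_of_pos_left _ hn1
    have e3 : c * (100 * n + 100) = 100 * (n * c) + 100 * c := by ring
    have e4 : 3 * n * c = 3 * (n * c) := by ring
    have e5 : (30 * n + 30) * numRep n rep =
        (30 * n + 30) * R' + (30 * (n * Δ) + 30 * Δ) := by rw [hΔ]; ring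
    have e6 : 1500 * n * numRep n rep = 1500 * n * R' + 1500 * (n * Δ) := by rw [hΔ]; ring
    rw [e5] at ht5
    rw [e3] at ht4
    rw [e4] at hsum
    rw [e6]
    omega


/-- If no edge is left, a phase only takes the time of the search for a vertex of maximal degree. -/
theorem wp_phaseProg {w n k ph : ℕ} {E : ℕ → ℕ → Prop} {P : Prop} {S : Finset ℕ}
    {l : ℕ → ℕ → Bool} {s : Mem} (hw : n < 2 ^ w) (hk : 1 ≤ k) (hkn : 2 ^ k ≤ n)
    (hE : IsGraphOn (Set.Iio n) E) (hP : P → CubeLabeling (Set.Iio n) E S l)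
    (hI : LabelInv n k E P S l ph s) (hph : s.reg rPhase = ph) (hphn : ph < n)
    (hN : s.reg rN = n) (hPow : s.reg rPow = 2 ^ k) :
    wp w phaseProg (fun s' t => LabelInv n k E P S l (ph + 1) s' ∧
      t + 1500 * n * numRep n (fun u => s'.tab tRep u 0) ≤
        1300 * n + 1500 * n * numRep n (fun u => s.tab tRep u 0)) s := by
  have hQn : ∀ x y, quotAdj E (fun u => s.tab tRep u 0) x y → x < n ∧ y < n := fun x y h =>
    ⟨((isGraphOn_quotAdj hE hI.isRep).left_mem h).1, ((isGraphOn_quotAdj hE hI.isRep).right_mem h).1⟩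
  simp only [phaseProg, wp]
  refine wp_frame (wp_maxDegProg hw hN fun u hu => hI.lists.deg_le hQn hu) ?_
  rintro s1 t1 hF1 ⟨ht1, hmax, hroot, hmn⟩
  have hN1 : s1.reg rN = n := by rw [hF1.reg _ (by decide)]; exact hN
  have hD1 : s1.reg rD = s.reg rD := hF1.reg _ (by decide)
  have hph1 : s1.reg rPhase = ph := by rw [hF1.reg _ (by decide)]; exact hph
  have hPow1 : s1.reg rPow = 2 ^ k := by rw [hF1.reg _ (by decide)]; exact hPow
  have htab : s1.tab = s.tab := by
    funext T
    exact hF1.tab _ (by simp [maxDegProg, Prog.forLoop, Prog.tabs])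
  clear hF1
  have hI1 := hI.congr htab hD1
  simp only [Test.Safe, Expr.Safe, Expr.val, Test.val, Test.cost, Expr.cost]
  refine ⟨⟨trivial, trivial, by omega, by omega⟩, fun h0 => ?_, fun h0 => ?_⟩
  · obtain ⟨hr, hdr⟩ := hroot h0
    refine wp_mono (wp_contractProg hw hk hkn hE hP hI1 hph1 hphn hN1 hPow1 hr rfl rfl h0
      (by rw [htab]; exact hdr) (by rw [htab]; exact hmax)) ?_
    rintro s' t ⟨h1, h2⟩
    refine ⟨h1, ?_⟩
    rw [htab] at h2
    omega
  · refine ⟨{ hI1 with stamp_le := fun a ha b hb => (hI1.stamp_le a ha b hb).trans (by omega),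
                       done := .inl fun u hu => ?_ }, ?_⟩
    · rw [htab]
      have := hmax u hu
      omega
    · rw [htab]
      omega

/-- If the graph has a labeling, then the program finds one. -/
theorem wp_labelProg {w n k : ℕ} {E : ℕ → ℕ → Prop} {P : Prop} {S : Finset ℕ}
    {l : ℕ → ℕ → Bool} {s : Mem} (hw : n < 2 ^ w) (hk : 1 ≤ k) (hkn : 2 ^ k ≤ n)
    (hE : IsGraphOn (Set.Iio n) E) (hP : P → CubeLabeling (Set.Iio n) E S l)
    (hN : s.reg rN = n) (hPow : s.reg rPow = 2 ^ k) (hl : HasLists s n E)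
    (hrep : ∀ u < n, s.tab tRep u 0 = u)
    (hdeg : ∑ u ∈ Finset.range n, s.tab tDeg u 0 ≤ (2 * k + 1) * n)
    (hst : ∀ a < n, ∀ b < n, s.tab tStamp a b = 0) (hnd : ∀ a < n, s.tab tNewDeg a 0 = 0)
    (hL : ∀ u < n, ∀ i, s.tab tLabel u i = 0) :
    wp w labelProg (fun s' t => t ≤ 3000 * n ^ 2 + 100 ∧ s'.reg rD < n ∧
      (∀ u < n, ∀ i, s'.tab tLabel u i ≤ 1) ∧
      (P → CubeLabeling (Set.Iio n) E (Finset.range (s'.reg rD)) (labels s'))) s := by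
  simp only [labelProg, wp]
  refine ⟨trivial, ?_⟩
  refine wp_forLoop (fun ph s' t => LabelInv n k E P S l ph s' ∧
    t + 1500 * n * numRep n (fun u => s'.tab tRep u 0) ≤ 5 + (1300 * n + 7) * ph +
      1500 * n * n) (by decide) (by decide) (by decide) (by simpa [hN] using hw) ?_ ?_ ?_
  · have hr : IsRep (Set.Iio n) fun u => s.tab tRep u 0 :=
      ⟨fun u hu => by rw [hrep u hu]; exact hu, fun u hu => by rw [hrep u hu, hrep u hu]⟩
    have hle : numRep n (fun u => s.tab tRep u 0) ≤ n := numRep_le _ _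
    refine ⟨⟨?_, ?_, ?_, ?_, ?_, ?_, ?_, ?_, fun hp => ?_, .inr ?_⟩, ?_⟩ <;>
      simp only [Mem.tab_setReg, Mem.reg_setReg, Nat.reduceEqDiff, ↓reduceIte, Expr.val]
    · exact hr
    · intro u hu
      refine (hl u hu).congr rfl (fun _ _ => rfl) fun y => ⟨?_, fun h => ?_⟩
      · rintro ⟨-, a, b, h, ha, hb⟩
        simp only at ha hb
        rw [hrep a (hE.left_mem h)] at ha
        rw [hrep b (hE.right_mem h)] at hb
        rwa [← ha, ← hb]
      · refine ⟨?_, u, y, h, hrep u hu, hrep y (hE.right_mem h)⟩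
        rintro rfl
        exact hE.irrefl _ h
    · intro a ha b hb
      rw [hst a ha b hb]
    · exact hnd
    · intro u hu i
      rw [hL u hu i]
      omega
    · intro u hu i _
      exact hL u hu i
    · omega
    · exact hdeg
    · exact ⟨S, .init (hP hp) _ hrep⟩
    · omega
    · have := Nat.mul_le_mul_left (1500 * n) hle
      omega
  · rintro ph hph s1 t1 hF1 hr1 ⟨hI, ht1⟩
    simp only [Mem.reg_setReg, Nat.reduceEqDiff, ↓reduceIte, hN] at hph
    have hN1 : s1.reg rN = n := by rw [hF1.reg _ (by decide)]; simp [hN]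
    have hPow1 : s1.reg rPow = 2 ^ k := by rw [hF1.reg _ (by decide)]; simp [hPow]
    refine wp_mono (wp_phaseProg hw hk hkn hE hP hI hr1 hph hN1 hPow1) ?_
    rintro s2 t2 ⟨hI2, ht2⟩
    refine ⟨hI2.congr rfl rfl, ?_⟩
    simp only [Mem.tab_setReg]
    rw [Nat.mul_succ]
    omega
  · rintro s1 t1 hF1 ⟨hI, ht1⟩
    simp only [Mem.reg_setReg, Nat.reduceEqDiff, ↓reduceIte, hN] at hI ht1
    have hn : 0 < n := by
      have := Nat.two_pow_pos k
      omega
    have hpos : 0 < numRep n fun u => s1.tab tRep u 0 :=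
      Finset.card_pos.2 ⟨s1.tab tRep 0 0, Finset.mem_filter.2
        ⟨Finset.mem_range.2 (hI.isRep.mem 0 hn), hI.isRep.idem 0 hn⟩⟩
    refine ⟨?_, by have := hI.length_le; omega, hI.label_le, fun hp => ?_⟩
    · simp only [Expr.cost]
      nlinarith
    · obtain ⟨T, hT⟩ := hI.progress hp
      refine hT.cubeLabeling (hP hp) hE hI.isRep fun a b hab => ?_
      have ha := ((isGraphOn_quotAdj hE hI.isRep).left_mem hab).1
      rcases hI.done with h | h
      · obtain ⟨j, hj, -⟩ := ((hI.lists a ha).adj_iff b).1 hab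
        rw [h a ha] at hj
        omega
      · omega

end WordRAM

/-! ### Packed bits -/

namespace WordRAM

/-- The next bit position is in the same word, or at the start of the next one. -/
theorem succ_div_mod (i : ℕ) {k : ℕ} (hk : 1 ≤ k) :
    (i % k + 1 = k ∧ (i + 1) % k = 0 ∧ (i + 1) / k = i / k + 1) ∨
      (i % k + 1 < k ∧ (i + 1) % k = i % k + 1 ∧ (i + 1) / k = i / k) := by
  have h1 := Nat.mod_lt i hk
  have h2 := Nat.div_add_mod i k
  rcases Nat.lt_or_ge (i % k + 1) k with h | h
  · right
    have h3 : i + 1 = (i % k + 1) + k * (i / k) := by omega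
    refine ⟨h, ?_, ?_⟩
    · rw [h3, Nat.add_mul_mod_self_left, Nat.mod_eq_of_lt h]
    · conv_lhs => rw [h3]
      rw [Nat.add_mul_div_left _ _ hk, Nat.div_eq_of_lt h, Nat.zero_add]
  · left
    have h3 : i + 1 = k * (i / k + 1) := by rw [Nat.mul_add]; omega
    refine ⟨by omega, ?_, ?_⟩
    · rw [h3, Nat.mul_mod_right]
    · conv_lhs => rw [h3]
      rw [Nat.mul_div_cancel_left _ hk]

theorem mul_add_eq_iff {b j k i : ℕ} (hj : j < k) : b * k + j = i ↔ b = i / k ∧ j = i % k := by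
  constructor
  · rintro rfl
    rw [Nat.mul_comm, Nat.mul_add_div (by omega), Nat.mul_add_mod, Nat.div_eq_of_lt hj,
      Nat.mod_eq_of_lt hj]
    simp
  · rintro ⟨rfl, rfl⟩
    rw [Nat.mul_comm]
    exact Nat.div_add_mod i k

/-- The truth values of `f` at the positions below `d` are packed into words of `k` bits. -/
def Packed (k d : ℕ) (f : ℕ → Prop) (row : ℕ → ℕ) : Prop :=
  ∀ b j, (row b).testBit j = true ↔ j < k ∧ b * k + j < d ∧ f (b * k + j)

theorem Packed.nil (k : ℕ) (f : ℕ → Prop) {row : ℕ → ℕ} (h : ∀ b, row b = 0) :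
    Packed k 0 f row := by
  intro b j
  simp [h]

theorem Packed.lt {k d : ℕ} {f : ℕ → Prop} {row : ℕ → ℕ} (h : Packed k d f row) (b : ℕ) :
    row b < 2 ^ k := by
  refine Nat.lt_pow_two_of_testBit _ fun j hj => ?_
  rw [← Bool.not_eq_true, h b j]
  omega

theorem Packed.testBit {k d : ℕ} {f : ℕ → Prop} {row : ℕ → ℕ} (h : Packed k d f row) (hk : 1 ≤ k)
    (i : ℕ) : (row (i / k)).testBit (i % k) = true ↔ i < d ∧ f i := by
  have e : i / k * k + i % k = i := (mul_add_eq_iff (Nat.mod_lt i hk)).2 ⟨rfl, rfl⟩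
  rw [h, e]
  simp [Nat.mod_lt i hk]

/-- A position at which `f` is false is passed without a change. -/
theorem Packed.skip {k i : ℕ} {f : ℕ → Prop} {row row' : ℕ → ℕ} (h : Packed k i f row) (hf : ¬ f i)
    (hr : ∀ b, row' b = row b) : Packed k (i + 1) f row' := by
  intro b j
  rw [hr, h b j]
  refine and_congr_right fun _ => ⟨fun h => ⟨by omega, h.2⟩, fun h => ⟨?_, h.2⟩⟩
  have : b * k + j ≠ i := fun he => hf (he ▸ h.2)
  omega

/-- The bit of a position at which `f` is true is set. -/
theorem Packed.push {k i : ℕ} {f : ℕ → Prop} {row row' : ℕ → ℕ} (h : Packed k i f row)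
    (hk : 1 ≤ k) (hf : f i)
    (hr : ∀ b, row' b = if b = i / k then row b ||| 2 ^ (i % k) else row b) :
    Packed k (i + 1) f row' := by
  intro b j
  have h1 : (row' b).testBit j = true ↔ (row b).testBit j = true ∨ b = i / k ∧ j = i % k := by
    rw [hr]
    split_ifs with hb
    · rw [Nat.testBit_or, Nat.testBit_two_pow]
      rw [Bool.or_eq_true, decide_eq_true_iff, eq_comm (a := i % k)]
      simp [hb]
    · simp [hb]
  rw [h1, h b j]
  constructor
  · rintro (⟨h2, h3, h4⟩ | ⟨rfl, rfl⟩)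
    · exact ⟨h2, by omega, h4⟩
    · have e : i / k * k + i % k = i := (mul_add_eq_iff (Nat.mod_lt i hk)).2 ⟨rfl, rfl⟩
      rw [e]
      exact ⟨Nat.mod_lt i hk, by omega, hf⟩
  · rintro ⟨h2, h3, h4⟩
    rcases Nat.lt_succ_iff_lt_or_eq.1 h3 with h3 | h3
    · exact .inl ⟨h2, h3, h4⟩
    · exact .inr ((mul_add_eq_iff h2).1 h3)

theorem Packed.congr {k d : ℕ} {f f' : ℕ → Prop} {row row' : ℕ → ℕ} (h : Packed k d f row)
    (hf : ∀ i < d, f' i ↔ f i) (hr : ∀ b, row' b = row b) : Packed k d f' row' := by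
  intro b j
  rw [hr, h b j]
  exact and_congr_right fun _ => and_congr_right fun hd => (hf _ hd).symm

theorem two_pow_mod_lt {k i n w : ℕ} (hk : 1 ≤ k) (hkn : 2 ^ k ≤ n) (hw : n < 2 ^ w) :
    2 ^ (i % k) + 2 ^ (i % k) ≤ 2 ^ k ∧ 2 ^ (i % k) < 2 ^ w ∧ 2 ^ k < 2 ^ w := by
  have h1 : 2 ^ (i % k + 1) ≤ 2 ^ k := Nat.pow_le_pow_right (by norm_num) (Nat.mod_lt i hk)
  rw [pow_succ] at h1
  have := Nat.two_pow_pos (i % k)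
  omega

theorem wp_advanceProg {w n k i : ℕ} {s : Mem} (hk : 1 ≤ k) (hkn : 2 ^ k ≤ n) (hw : n < 2 ^ w)
    (hm : s.reg rMask = 2 ^ (i % k)) (hb : s.reg rBlk = i / k) (hp : s.reg rPow = 2 ^ k) :
    wp w advanceProg (fun s' t => t ≤ 20 ∧ s'.tab = s.tab ∧ s'.reg rMask = 2 ^ ((i + 1) % k) ∧
      s'.reg rBlk = (i + 1) / k) s := by
  obtain ⟨h1, h2, h3⟩ := two_pow_mod_lt (i := i) hk hkn hw
  simp only [advanceProg, wp, Test.Safe, Expr.Safe, Expr.val, Test.val, BinOp.Safe, BinOp.val,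
    Test.cost, Expr.cost, hm, hb, hp, Mem.reg_setReg, Mem.tab_setReg, Nat.reduceEqDiff, ↓reduceIte]
  have e : 2 ^ (i % k) + 2 ^ (i % k) = 2 ^ (i % k + 1) := by rw [pow_succ]; omega
  refine ⟨by simp, ⟨by simp, by simp, by omega, by omega⟩, fun h => ⟨by simp, by simp, by omega, ?_⟩,
    fun h => ⟨by omega, ?_⟩⟩
  · rw [e] at h
    have hik := Nat.pow_right_injective le_rfl h
    rcases succ_div_mod i hk with ⟨-, h4, h5⟩ | ⟨h4, -⟩
    · simp [h4, h5]
    · omega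
  · rw [e] at h ⊢
    rcases succ_div_mod i hk with ⟨h4, -⟩ | ⟨-, h4, h5⟩
    · exact absurd (by rw [h4]) h
    · simp [h4, h5]

/-- Table `tIdx` recovers the positions below `d` from the words and bits where they are packed. An
entry is larger by one than the position, so that `0` stands for a word that names no position. -/
def IsIdx (k d : ℕ) (s : Mem) : Prop :=
  ∀ b m i, s.tab tIdx b m = i + 1 ↔ i < d ∧ b = i / k ∧ m = 2 ^ (i % k)

theorem IsIdx.le {k d : ℕ} {s : Mem} (h : IsIdx k d s) (b m : ℕ) : s.tab tIdx b m ≤ d := by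
  by_contra hd
  have := (h b m (s.tab tIdx b m - 1)).1 (by omega)
  omega

theorem eq_of_div_mod {k i j : ℕ} (h1 : i / k = j / k) (h2 : i % k = j % k) : i = j := by
  rw [← Nat.div_add_mod i k, ← Nat.div_add_mod j k, h1, h2]

/-- The labels of all vertices are packed. Row `i / k`, column `2 ^ (i % k)` of table `tIdx` names
coordinate `i`; this replaces the computation of a logarithm, for which the machine has no
instruction. -/
theorem wp_packRowsProg {w n k d : ℕ} {s : Mem} (hk : 1 ≤ k) (hkn : 2 ^ k ≤ n) (hw : n < 2 ^ w)
    (hN : s.reg rN = n) (hD : s.reg rD = d) (hdn : d < n) (hp : s.reg rPow = 2 ^ k)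
    (hL : ∀ u < n, ∀ i, s.tab tLabel u i ≤ 1) (hrow : ∀ u b, s.tab tRow u b = 0)
    (hidx : ∀ b m, s.tab tIdx b m = 0) :
    wp w packRowsProg (fun s' t => t ≤ 200 * n ^ 2 ∧
      (∀ u < n, Packed k d (fun i => labels s u i = true) (s'.tab tRow u)) ∧ IsIdx k d s' ∧
      s'.reg rNumBlk = d / k + 1) s := by
  simp only [packRowsProg]
  have hw0 : 1 < 2 ^ w := by
    have := Nat.pow_le_pow_right (n := 2) (by norm_num) hk
    omega
  refine wp_forLoop_const (fun u s' =>
    (∀ v < u, Packed k d (fun i => labels s v i = true) (s'.tab tRow v)) ∧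
    (∀ v, u ≤ v → ∀ b, s'.tab tRow v b = 0) ∧
    (∀ b m i, s'.tab tIdx b m = i + 1 → i < d ∧ b = i / k ∧ m = 2 ^ (i % k)) ∧
    (0 < u → (∀ i < d, s'.tab tIdx (i / k) (2 ^ (i % k)) = i + 1) ∧ s'.reg rNumBlk = d / k + 1))
    (d * 80 + 50) (by decide) (by decide) (by decide) (by simpa [hN] using hw)
    ⟨by simp, by simpa using hrow, by simp [hidx], by simp⟩ ?_ ?_
  · rintro u hu s1 hF1 hr1 ⟨h1, h2, h3, h4⟩
    rw [hN] at hu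
    have hD1 : s1.reg rD = d := by rw [hF1.reg _ (by decide)]; exact hD
    have hP1 : s1.reg rPow = 2 ^ k := by rw [hF1.reg _ (by decide)]; exact hp
    have hL1 : s1.tab tLabel = s.tab tLabel := hF1.tab _ (by decide)
    clear hF1
    simp only [wp]
    refine ⟨trivial, trivial, ?_⟩
    refine wp_forLoop_const (fun j s' => s'.reg rMask = 2 ^ (j % k) ∧ s'.reg rBlk = j / k ∧
      (∀ v < u, s'.tab tRow v = s1.tab tRow v) ∧ (∀ v, u < v → ∀ b, s'.tab tRow v b = 0) ∧
      Packed k j (fun i => labels s u i = true) (s'.tab tRow u) ∧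
      (∀ b m i, s'.tab tIdx b m = i + 1 → i < d ∧ b = i / k ∧ m = 2 ^ (i % k)) ∧
      (∀ i < j, s'.tab tIdx (i / k) (2 ^ (i % k)) = i + 1))
      70 (by decide) (by decide) (by decide) (by simp [hD1]; omega) ?_ ?_ ?_
    · refine ⟨by simp, by simp, by simp, fun v hv b => by simpa using h2 v (by omega) b,
        .nil _ _ fun b => by simpa using h2 u le_rfl b, by simpa using h3, by simp⟩
    · rintro j hj s2 hF2 hr2 ⟨g1, g2, g3, g4, g5, g6, g7⟩
      simp [hD1] at hj
      have hU2 : s2.reg rU = u := by rw [hF2.reg _ (by decide)]; simp [hr1]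
      have hP2 : s2.reg rPow = 2 ^ k := by rw [hF2.reg _ (by decide)]; simp [hP1]
      have hL2 : s2.tab tLabel = s.tab tLabel := by rw [hF2.tab _ (by decide)]; exact hL1
      clear hF2
      obtain ⟨e1, e2, e3⟩ := two_pow_mod_lt (i := j) hk hkn hw
      have hjk := Nat.div_le_self j k
      have hlab := hL u hu j
      have hrow2 : Packed k (j + 1) (fun i => labels s u i = true) (fun b =>
          if b = j / k ∧ s.tab tLabel u j = 1 then s2.tab tRow u b ||| 2 ^ (j % k)
          else s2.tab tRow u b) := by
        by_cases hb : s.tab tLabel u j = 1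
        · exact g5.push hk (by simp [labels, hb]) fun b => by simp [hb]
        · exact g5.skip (by simp [labels, hb]) fun b => by simp [hb]
      -- the state after the two assignments to the tables
      have key : ∀ s3 : Mem, (∀ v < u, s3.tab tRow v = s2.tab tRow v) →
          (∀ v, u < v → ∀ b, s3.tab tRow v b = 0) →
          (∀ b, s3.tab tRow u b = if b = j / k ∧ s.tab tLabel u j = 1 then
            s2.tab tRow u b ||| 2 ^ (j % k) else s2.tab tRow u b) →
          (∀ b m, s3.tab tIdx b m = if b = j / k ∧ m = 2 ^ (j % k) then j + 1
            else s2.tab tIdx b m) → s3.reg rMask = 2 ^ (j % k) → s3.reg rBlk = j / k →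
          s3.reg rPow = 2 ^ k → wp w advanceProg (fun s4 t4 => t4 ≤ 20 ∧
            (s4.setReg rJ (j + 1)).reg rMask = 2 ^ ((j + 1) % k) ∧
            (s4.setReg rJ (j + 1)).reg rBlk = (j + 1) / k ∧
            (∀ v < u, (s4.setReg rJ (j + 1)).tab tRow v = s1.tab tRow v) ∧
            (∀ v, u < v → ∀ b, (s4.setReg rJ (j + 1)).tab tRow v b = 0) ∧
            Packed k (j + 1) (fun i => labels s u i = true) ((s4.setReg rJ (j + 1)).tab tRow u) ∧
            (∀ b m i, (s4.setReg rJ (j + 1)).tab tIdx b m = i + 1 →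
              i < d ∧ b = i / k ∧ m = 2 ^ (i % k)) ∧
            (∀ i < j + 1, (s4.setReg rJ (j + 1)).tab tIdx (i / k) (2 ^ (i % k)) = i + 1)) s3 := by
        intro s3 k1 k2 k3 k4 k5 k6 k7
        refine wp_mono (wp_advanceProg hk hkn hw k5 k6 k7) ?_
        rintro s4 t4 ⟨ht4, htab, hm4, hb4⟩
        simp only [Mem.tab_setReg, Mem.reg_setReg, Nat.reduceEqDiff, ↓reduceIte, htab]
        refine ⟨ht4, hm4, hb4, fun v hv => (k1 v hv).trans (g3 v hv), k2,
          hrow2.congr (fun _ _ => Iff.rfl) k3, fun b m i => ?_, fun i hi => ?_⟩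
        · rw [k4]
          split_ifs with hbm
          · intro he
            obtain rfl : j = i := by omega
            exact ⟨hj, hbm⟩
          · exact g6 b m i
        · rw [k4]
          split_ifs with hbm
          · rw [eq_of_div_mod hbm.1 (Nat.pow_right_injective le_rfl hbm.2)]
          · refine g7 i ?_
            rcases Nat.lt_succ_iff_lt_or_eq.1 hi with hi | rfl
            · exact hi
            · exact absurd ⟨rfl, rfl⟩ hbm
      generalize advanceProg = p at key ⊢
      simp only [wp, Test.Safe, Expr.Safe, Expr.val, Test.val, BinOp.Safe, BinOp.val,
        Test.cost, Expr.cost, hU2, hr2, hL2, g1, g2, Mem.reg_setCell]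
      refine ⟨⟨⟨trivial, trivial, by omega, by omega⟩, trivial, by omega, by omega⟩, fun hb => ?_,
        fun hb => ?_⟩
      · refine ⟨⟨trivial, by omega⟩, ⟨trivial, by omega⟩, ⟨⟨trivial, trivial, by omega, by omega⟩,
          trivial, trivial⟩, ⟨trivial, by omega⟩, ⟨trivial, by omega⟩, by simp, ?_⟩
        refine wp_mono (key _ (fun v hv => ?_) (fun v hv b => ?_) (fun b => ?_) (fun b m => ?_)
          ?_ ?_ ?_) fun s4 t4 h => ⟨by have := h.1; omega, h.2⟩
        · ext b; simp [show v ≠ u by omega]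
        · simp [show v ≠ u by omega, g4 v hv]
        · by_cases hbj : b = j / k <;> simp [hb, hbj]
        · simp
        · simp [g1]
        · simp [g2]
        · simp [hP2]
      · refine ⟨⟨trivial, by omega⟩, ⟨trivial, by omega⟩, by simp, ?_⟩
        refine wp_mono (key _ (fun v hv => ?_) (fun v hv b => ?_) (fun b => ?_) (fun b m => ?_)
          ?_ ?_ ?_) fun s4 t4 h => ⟨by have := h.1; omega, h.2⟩
        · ext b; simp
        · simp [g4 v hv]
        · simp [hb]
        · simp
        · simp [g1]
        · simp [g2]
        · simp [hP2]
    · rintro s2 t2 hF2 ⟨g1, g2, g3, g4, g5, g6, g7⟩ ht2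
      simp [hD1] at ht2 g1 g2 g5 g7
      refine ⟨by simp, ?_⟩
      simp only [Expr.cost, Expr.val, BinOp.val, Mem.tab_setReg, Mem.reg_setReg, Nat.reduceEqDiff,
        ↓reduceIte, g2]
      refine ⟨by omega, fun v hv => ?_, fun v hv b => g4 v (by omega) b, g6, fun _ => ⟨g7, trivial⟩⟩
      rcases Nat.lt_succ_iff_lt_or_eq.1 hv with hv | rfl
      · rw [g3 v hv]; exact h1 v hv
      · exact g5
  · rintro s1 t1 hF1 ⟨h1, h2, h3, h4⟩ ht1
    rw [hN] at h1 ht1 h4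
    obtain ⟨h4, h5⟩ := h4 (by omega)
    refine ⟨?_, h1, fun b m i => ⟨h3 b m i, fun ⟨hi, hb, hm⟩ => ?_⟩, h5⟩
    · nlinarith
    · rw [hb, hm]; exact h4 i hi


/-- All coordinates and their complements are packed. Both are kept, as the bits beyond position `n`
must be zero in the words of a complement, too. -/
theorem wp_packColsProg {w n k d : ℕ} {s : Mem} (hk : 1 ≤ k) (hkn : 2 ^ k ≤ n) (hw : n < 2 ^ w)
    (hN : s.reg rN = n) (hD : s.reg rD = d) (hdn : d < n) (hp : s.reg rPow = 2 ^ k)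
    (hL : ∀ u < n, ∀ i, s.tab tLabel u i ≤ 1) (hone : ∀ i b, s.tab tColOne i b = 0)
    (hzero : ∀ i b, s.tab tColZero i b = 0) :
    wp w packColsProg (fun s' t => t ≤ 200 * n ^ 2 + 10 ∧
      ∀ i < d, Packed k n (fun v => labels s v i = true) (s'.tab tColOne i) ∧
        Packed k n (fun v => labels s v i = false) (s'.tab tColZero i)) s := by
  simp only [packColsProg]
  have hw0 : 1 < 2 ^ w := by
    have := Nat.pow_le_pow_right (n := 2) (by norm_num) hk
    omega
  refine wp_forLoop_const (fun j s' =>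
    (∀ i < j, Packed k n (fun v => labels s v i = true) (s'.tab tColOne i) ∧
      Packed k n (fun v => labels s v i = false) (s'.tab tColZero i)) ∧
    (∀ i, j ≤ i → ∀ b, s'.tab tColOne i b = 0 ∧ s'.tab tColZero i b = 0))
    (n * 80 + 50) (by decide) (by decide) (by decide) (by simp [hD]; omega)
    ⟨by simp, by simp [hone, hzero]⟩ ?_ ?_
  · rintro j hj s1 hF1 hr1 ⟨h1, h2⟩
    rw [hD] at hj
    have hN1 : s1.reg rN = n := by rw [hF1.reg _ (by decide)]; exact hN
    have hP1 : s1.reg rPow = 2 ^ k := by rw [hF1.reg _ (by decide)]; exact hp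
    have hL1 : s1.tab tLabel = s.tab tLabel := hF1.tab _ (by decide)
    clear hF1
    simp only [wp]
    refine ⟨trivial, trivial, ?_⟩
    refine wp_forLoop_const (fun u s' => s'.reg rMask = 2 ^ (u % k) ∧ s'.reg rBlk = u / k ∧
      (∀ i, i ≠ j → s'.tab tColOne i = s1.tab tColOne i ∧ s'.tab tColZero i = s1.tab tColZero i) ∧
      Packed k u (fun v => labels s v j = true) (s'.tab tColOne j) ∧
      Packed k u (fun v => labels s v j = false) (s'.tab tColZero j))
      70 (by decide) (by decide) (by decide) (by simp [hN1]; omega) ?_ ?_ ?_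
    · exact ⟨by simp, by simp, by simp, .nil _ _ fun b => by simp [h2 j le_rfl b],
        .nil _ _ fun b => by simp [h2 j le_rfl b]⟩
    · rintro u hu s2 hF2 hr2 ⟨g1, g2, g3, g4, g5⟩
      simp [hN1] at hu
      have hJ2 : s2.reg rJ = j := by rw [hF2.reg _ (by decide)]; simp [hr1]
      have hP2 : s2.reg rPow = 2 ^ k := by rw [hF2.reg _ (by decide)]; simp [hP1]
      have hL2 : s2.tab tLabel = s.tab tLabel := by rw [hF2.tab _ (by decide)]; exact hL1
      clear hF2
      obtain ⟨e1, e2, e3⟩ := two_pow_mod_lt (i := u) hk hkn hw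
      have hjk := Nat.div_le_self u k
      have hlab := hL u hu j
      -- the state after the assignment to a table
      have key : ∀ s3 : Mem,
          (∀ i, i ≠ j → s3.tab tColOne i = s1.tab tColOne i ∧
            s3.tab tColZero i = s1.tab tColZero i) →
          Packed k (u + 1) (fun v => labels s v j = true) (s3.tab tColOne j) →
          Packed k (u + 1) (fun v => labels s v j = false) (s3.tab tColZero j) →
          s3.reg rMask = 2 ^ (u % k) → s3.reg rBlk = u / k → s3.reg rPow = 2 ^ k →
          wp w advanceProg (fun s4 t4 => t4 ≤ 20 ∧
            (s4.setReg rU (u + 1)).reg rMask = 2 ^ ((u + 1) % k) ∧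
            (s4.setReg rU (u + 1)).reg rBlk = (u + 1) / k ∧
            (∀ i, i ≠ j → (s4.setReg rU (u + 1)).tab tColOne i = s1.tab tColOne i ∧
              (s4.setReg rU (u + 1)).tab tColZero i = s1.tab tColZero i) ∧
            Packed k (u + 1) (fun v => labels s v j = true)
              ((s4.setReg rU (u + 1)).tab tColOne j) ∧
            Packed k (u + 1) (fun v => labels s v j = false)
              ((s4.setReg rU (u + 1)).tab tColZero j)) s3 := by
        intro s3 k1 k2 k3 k4 k5 k6
        refine wp_mono (wp_advanceProg hk hkn hw k4 k5 k6) ?_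
        rintro s4 t4 ⟨ht4, htab, hm4, hb4⟩
        simp only [Mem.tab_setReg, Mem.reg_setReg, Nat.reduceEqDiff, ↓reduceIte, htab]
        exact ⟨ht4, hm4, hb4, k1, k2, k3⟩
      generalize advanceProg = p at key ⊢
      have hltO := g4.lt (u / k)
      have hltZ := g5.lt (u / k)
      simp only [wp, Test.Safe, Expr.Safe, Expr.val, Test.val, BinOp.Safe, BinOp.val,
        Test.cost, Expr.cost, hJ2, hr2, hL2, g1, g2]
      refine ⟨⟨⟨trivial, trivial, by omega, by omega⟩, trivial, by omega, by omega⟩, fun hb => ?_,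
        fun hb => ?_⟩
      · refine ⟨⟨trivial, by omega⟩, ⟨trivial, by omega⟩, ⟨⟨trivial, trivial, by omega, by omega⟩,
          trivial, trivial⟩, ?_⟩
        refine wp_mono (key _ (fun i hi => ?_) ?_ ?_ ?_ ?_ ?_) fun s4 t4 h =>
          ⟨by have := h.1; omega, h.2⟩
        · rw [← (g3 i hi).1, ← (g3 i hi).2]
          constructor
          · ext b; simp [hi]
          · ext b; simp
        · exact g4.push hk (by simp [labels, hb]) fun b => by
            by_cases hbu : b = u / k <;> simp [hbu]
        · exact g5.skip (by simp [labels, hb]) fun b => by simp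
        · simp [g1]
        · simp [g2]
        · simp [hP2]
      · refine ⟨⟨trivial, by omega⟩, ⟨trivial, by omega⟩, ⟨⟨trivial, trivial, by omega, by omega⟩,
          trivial, trivial⟩, ?_⟩
        refine wp_mono (key _ (fun i hi => ?_) ?_ ?_ ?_ ?_ ?_) fun s4 t4 h =>
          ⟨by have := h.1; omega, h.2⟩
        · rw [← (g3 i hi).1, ← (g3 i hi).2]
          constructor
          · ext b; simp
          · ext b; simp [hi]
        · exact g4.skip (by simp [labels, hb]) fun b => by simp
        · exact g5.push hk (by simp [labels, hb]) fun b => by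
            by_cases hbu : b = u / k <;> simp [hbu]
        · simp [g1]
        · simp [g2]
        · simp [hP2]
    · rintro s2 t2 hF2 ⟨g1, g2, g3, g4, g5⟩ ht2
      simp [hN1] at ht2 g4 g5
      simp only [Expr.cost, Mem.tab_setReg]
      refine ⟨by omega, fun i hi => ?_, fun i hi b => ?_⟩
      · by_cases hij : i = j
        · subst hij; exact ⟨g4, g5⟩
        · rw [(g3 i hij).1, (g3 i hij).2]
          exact h1 i (by omega)
      · rw [(g3 i (by omega)).1, (g3 i (by omega)).2]
        exact h2 i (by omega) b
  · rintro s1 t1 hF1 ⟨h1, h2⟩ ht1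
    rw [hD] at h1 ht1
    refine ⟨?_, h1⟩
    nlinarith

end WordRAM

/-! ### Verification of the labels -/

namespace WordRAM

/-- The words of the labels of all vertices and of all coordinates have been stored. -/
structure IsPacking (n k d : ℕ) (s : Mem) : Prop where
  label_le : ∀ u < n, ∀ i, s.tab tLabel u i ≤ 1
  row : ∀ u < n, Packed k d (fun i => labels s u i = true) (s.tab tRow u)
  idx : IsIdx k d s
  one : ∀ i < d, Packed k n (fun v => labels s v i = true) (s.tab tColOne i)
  zero : ∀ i < d, Packed k n (fun v => labels s v i = false) (s.tab tColZero i)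

theorem IsPacking.congr {n k d : ℕ} {s s' : Mem} (h : IsPacking n k d s)
    (h1 : s'.tab tLabel = s.tab tLabel) (h2 : s'.tab tRow = s.tab tRow)
    (h3 : s'.tab tIdx = s.tab tIdx) (h4 : s'.tab tColOne = s.tab tColOne)
    (h5 : s'.tab tColZero = s.tab tColZero) : IsPacking n k d s' := by
  have hl : labels s' = labels s := by funext u i; simp only [labels, h1]
  refine ⟨?_, ?_, ?_, ?_, ?_⟩
  · rw [h1]; exact h.label_le
  · rw [hl, h2]; exact h.row
  · unfold IsIdx; rw [h3]; exact h.idx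
  · rw [hl, h4]; exact h.one
  · rw [hl, h5]; exact h.zero

/-- The bitwise difference of two packed labels consists of the coordinates in which they differ. -/
theorem Packed.xor {k d : ℕ} {l l' : ℕ → Bool} {row row' : ℕ → ℕ}
    (h : Packed k d (fun i => l i = true) row) (h' : Packed k d (fun i => l' i = true) row') :
    Packed k d (fun i => l i ≠ l' i) (fun b => row b ^^^ row' b) := by
  intro b j
  have h1 := h b j
  have h2 := h' b j
  rw [← and_assoc] at h1 h2 ⊢
  rw [Nat.testBit_xor]
  by_cases hd : j < k ∧ b * k + j < d
  · simp only [hd, true_and, ← Bool.eq_iff_iff] at h1 h2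
    simp [hd, h1, h2]
  · simp only [hd, false_and, iff_false, Bool.not_eq_true] at h1 h2
    simp [hd, h1, h2]

/-- Among the words `X 0, …, X (J - 1)` none is different from zero, or exactly one, or at least
two; the number `bad` tells which. If there is exactly one, it is looked up in the table `f`. -/
def OneWord (X : ℕ → ℕ) (f : ℕ → ℕ → ℕ) (J bad idx : ℕ) : Prop :=
  bad ≤ J ∧ ((bad = 0 ∧ ∀ b < J, X b = 0) ∨
    (bad = 1 ∧ ∃ b < J, X b ≠ 0 ∧ idx = f b (X b) ∧ ∀ b' < J, b' ≠ b → X b' = 0) ∨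
    (2 ≤ bad ∧ ∃ b < J, ∃ b' < J, b ≠ b' ∧ X b ≠ 0 ∧ X b' ≠ 0))

theorem OneWord.skip {X : ℕ → ℕ} {f : ℕ → ℕ → ℕ} {J bad idx : ℕ} (h : OneWord X f J bad idx)
    (hX : X J = 0) : OneWord X f (J + 1) bad idx := by
  obtain ⟨h0, h⟩ := h
  refine ⟨by omega, ?_⟩
  rcases h with ⟨h1, h2⟩ | ⟨h1, b, hb, h2, h3, h4⟩ | ⟨h1, b, hb, b', hb', h2⟩
  · refine .inl ⟨h1, fun b hb => ?_⟩
    rcases Nat.lt_succ_iff_lt_or_eq.1 hb with hb | rfl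
    exacts [h2 b hb, hX]
  · refine .inr (.inl ⟨h1, b, by omega, h2, h3, fun b' hb' hne => ?_⟩)
    rcases Nat.lt_succ_iff_lt_or_eq.1 hb' with hb' | rfl
    exacts [h4 b' hb' hne, hX]
  · exact .inr (.inr ⟨h1, b, by omega, b', by omega, h2⟩)

theorem OneWord.next {X : ℕ → ℕ} {f : ℕ → ℕ → ℕ} {J bad idx : ℕ} (h : OneWord X f J bad idx)
    (hX : X J ≠ 0) : OneWord X f (J + 1) (bad + 1) (f J (X J)) := by
  obtain ⟨h0, h⟩ := h
  refine ⟨by omega, ?_⟩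
  rcases h with ⟨h1, h2⟩ | ⟨h1, b, hb, h2, h3, h4⟩ | ⟨h1, b, hb, b', hb', h2⟩
  · exact .inr (.inl ⟨by omega, J, by omega, hX, rfl, fun b' hb' hne => h2 b' (by omega)⟩)
  · exact .inr (.inr ⟨by omega, b, by omega, J, by omega, by omega, h2, hX⟩)
  · exact .inr (.inr ⟨by omega, b, by omega, b', by omega, h2⟩)

/-- Exactly one bit is set if and only if exactly one word is different from zero and this word
occurs in the table of the words with one bit. -/
theorem OneWord.iff {k d : ℕ} {f : ℕ → Prop} {X : ℕ → ℕ} {s : Mem} {bad idx : ℕ}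
    (h : OneWord X (s.tab tIdx) (d / k + 1) bad idx) (hk : 1 ≤ k) (hX : Packed k d f X)
    (hi : IsIdx k d s) (i : ℕ) :
    bad = 1 ∧ idx = i + 1 ↔ ∀ i', (i' < d ∧ f i') ↔ i' = i := by
  have hblk : ∀ i' < d, i' / k < d / k + 1 := fun i' h =>
    Nat.lt_succ_of_le (Nat.div_le_div_right h.le)
  have hne : ∀ i', i' < d ∧ f i' → X (i' / k) ≠ 0 := by
    intro i' hi' h0
    have := (hX.testBit hk i').2 hi'
    simp [h0] at this
  constructor
  · rintro ⟨rfl, rfl⟩ i'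
    rcases h.2 with ⟨h1, -⟩ | ⟨-, b, hb, h2, h3, h4⟩ | ⟨h1, -⟩
    · omega
    · obtain ⟨h5, rfl, h6⟩ := (hi b (X b) i).1 h3.symm
      constructor
      · intro hi'
        have e1 : i' / k = i / k := by
          by_contra hne'
          exact hne i' hi' (h4 _ (hblk i' hi'.1) hne')
        have e2 := (hX.testBit hk i').2 hi'
        rw [e1, h6, Nat.testBit_two_pow, decide_eq_true_iff] at e2
        exact eq_of_div_mod e1 e2.symm
      · rintro rfl
        refine (hX.testBit hk i').1 ?_
        rw [h6, Nat.testBit_two_pow_self]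
    · omega
  · intro hall
    have hi0 := (hall i).2 rfl
    have hXi : X (i / k) = 2 ^ (i % k) := by
      refine Nat.eq_of_testBit_eq fun j => ?_
      rw [Nat.testBit_two_pow, Bool.eq_iff_iff, hX, hall, decide_eq_true_iff]
      constructor
      · rintro ⟨h1, h2⟩
        exact ((mul_add_eq_iff h1).1 h2).2.symm
      · rintro rfl
        exact ⟨Nat.mod_lt i hk, (mul_add_eq_iff (Nat.mod_lt i hk)).2 ⟨rfl, rfl⟩⟩
    have hzero : ∀ b, X b ≠ 0 → b = i / k := by
      intro b hb
      obtain ⟨j, hj⟩ := Nat.exists_testBit_of_ne_zero hb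
      rw [hX, hall] at hj
      exact ((mul_add_eq_iff hj.1).1 hj.2).1
    rcases h.2 with ⟨-, h2⟩ | ⟨h1, b, hb, h2, h3, h4⟩ | ⟨-, b, -, b', -, h3, h4, h5⟩
    · exact absurd (h2 _ (hblk i hi0.1)) (hne i hi0)
    · refine ⟨h1, ?_⟩
      rw [h3, hzero b h2, hXi]
      exact (hi _ _ i).2 ⟨hi0.1, rfl, rfl⟩
    · exact absurd ((hzero b h4).trans (hzero b' h5).symm) h3

open Classical in
/-- The edges at `u` take `O(d / k + 1)` steps each. The coordinates listed are all those flipped by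
an edge that flips only one, even if some other edge is found faulty. -/
theorem wp_flipProg {w n k d u : ℕ} {E : ℕ → ℕ → Prop} {s : Mem} (hk : 1 ≤ k) (hkn : 2 ^ k ≤ n)
    (hw : n < 2 ^ w) (hN : s.reg rN = n) (hdn : d < n) (hU : s.reg rU = u) (hu : u < n)
    (hJ : s.reg rNumBlk = d / k + 1) (hI : IsPacking n k d s)
    (hA : ∀ v < n, s.tab tAdj u v = 1 ↔ E u v) (hA1 : ∀ v, s.tab tAdj u v ≤ 1)
    (hE : ∀ v, E u v → v < n) :
    wp w flipProg (fun s' t =>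
      t ≤ 100 * n + ((Finset.range n).filter fun v => E u v).card * (100 + 50 * (d / k + 1)) + 100 ∧
      s'.reg rCnt ≤ ((Finset.range n).filter fun v => E u v).card ∧
      (∀ i, (∃ c < s'.reg rCnt, s'.tab tCls c 0 = i) ↔
        ∃ v, E u v ∧ diffSet (Finset.range d) (labels s) u v = {i}) ∧
      s'.reg rOk ≤ max 1 (s.reg rOk) ∧ (s'.reg rOk = 1 ↔
        s.reg rOk = 1 ∧ ∀ v, E u v → ∃ i, diffSet (Finset.range d) (labels s) u v = {i})) s := by
  have hw0 : 1 < 2 ^ w := by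
    have := Nat.pow_le_pow_right (n := 2) (by norm_num) hk
    omega
  have hJn : d / k + 1 ≤ n := by
    have := Nat.div_le_self d k
    omega
  set D := diffSet (Finset.range d) (labels s) with hD
  simp only [flipProg, wp]
  refine ⟨trivial, ?_⟩
  refine wp_forLoop_sum (fun v s' =>
    s'.reg rCnt ≤ ((Finset.range v).filter fun v => E u v).card ∧
      (∀ i, (∃ c < s'.reg rCnt, s'.tab tCls c 0 = i) ↔ ∃ x < v, E u x ∧ D u x = {i}) ∧
      s'.reg rOk ≤ max 1 (s.reg rOk) ∧
      (s'.reg rOk = 1 ↔ s.reg rOk = 1 ∧ ∀ x < v, E u x → ∃ i, D u x = {i}))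
    (fun v => 20 + if E u v then 90 + 50 * (d / k + 1) else 0)
    (by decide) (by decide) (by decide) (by simpa [hN] using hw) (by simp) ?_ ?_
  · rintro v hv s1 hF1 hr1 ⟨h1, h2, h3, h4⟩
    simp [hN] at hv
    have hU1 : s1.reg rU = u := by rw [hF1.reg _ (by decide)]; simp [hU]
    have hJ1 : s1.reg rNumBlk = d / k + 1 := by rw [hF1.reg _ (by decide)]; simp [hJ]
    have hA1' : s1.tab tAdj = s.tab tAdj := hF1.tab _ (by decide)
    have hRow1 : s1.tab tRow = s.tab tRow := hF1.tab _ (by decide)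
    have hIdx1 : s1.tab tIdx = s.tab tIdx := hF1.tab _ (by decide)
    clear hF1
    have hAv := hA v hv
    have hAv1 := hA1 v
    have hadd : ∀ p : ℕ → Prop, (∀ x < v + 1, p x) ↔ (∀ x < v, p x) ∧ p v := fun p =>
      ⟨fun h => ⟨fun x hx => h x (by omega), h v (by omega)⟩, fun h x hx => by
        rcases Nat.lt_succ_iff_lt_or_eq.1 hx with hx | rfl
        exacts [h.1 x hx, h.2]⟩
    have hadd' : ∀ p : ℕ → Prop, (∃ x < v + 1, p x) ↔ (∃ x < v, p x) ∨ p v := fun p =>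
      ⟨fun ⟨x, hx, h⟩ => by
        rcases Nat.lt_succ_iff_lt_or_eq.1 hx with hx | rfl
        exacts [.inl ⟨x, hx, h⟩, .inr h], fun h => by
        rcases h with ⟨x, hx, h⟩ | h
        exacts [⟨x, by omega, h⟩, ⟨v, by omega, h⟩]⟩
    have hcard : ((Finset.range (v + 1)).filter fun v => E u v).card =
        ((Finset.range v).filter fun v => E u v).card + if E u v then 1 else 0 := by
      rw [Finset.range_add_one, Finset.filter_insert]
      split_ifs <;> simp
    simp only [wp, Test.Safe, Expr.Safe, Expr.val, Test.val, hU1, hr1, hA1', hAv, Test.cost,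
      Expr.cost]
    refine ⟨⟨⟨trivial, trivial, by omega, by omega⟩, trivial, by omega, by omega⟩,
      fun hEv => ⟨trivial, trivial, ?_⟩, fun hEv => ?_⟩
    · refine wp_forLoop_const (fun j s' => OneWord (fun b => s.tab tRow u b ^^^ s.tab tRow v b)
        (s.tab tIdx) j (s'.reg rBad) (s'.reg rIdx) ∧ s'.reg rIdx ≤ d) 30 (by decide) (by decide) (by decide)
        (by simp [hJ1]; omega) ?_ ?_ ?_
      · exact ⟨⟨by simp, .inl ⟨by simp, by simp⟩⟩, by simp⟩
      · rintro j hj s2 hF2 hr2 ⟨g, g'⟩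
        simp [hJ1] at hj
        have hU2 : s2.reg rU = u := by rw [hF2.reg _ (by decide)]; simp [hU1]
        have hV2 : s2.reg rV = v := by rw [hF2.reg _ (by decide)]; simp [hr1]
        have hRow2 : s2.tab tRow = s.tab tRow := by rw [hF2.tab _ (by decide)]; exact hRow1
        have hIdx2 : s2.tab tIdx = s.tab tIdx := by rw [hF2.tab _ (by decide)]; exact hIdx1
        clear hF2
        have hx := (((hI.row u hu).xor (hI.row v hv)).lt j)
        have hbad := g.1
        simp only [wp, Test.Safe, Expr.Safe, Expr.val, Test.val, BinOp.Safe, BinOp.val, Test.cost,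
          Expr.cost, hU2, hV2, hr2, hRow2, hIdx2, Mem.reg_setReg, Mem.tab_setReg, Nat.reduceEqDiff,
          ↓reduceIte]
        refine ⟨⟨⟨trivial, trivial, by omega, by omega⟩, ⟨trivial, trivial, by omega, by omega⟩,
          trivial⟩, ⟨trivial, trivial, by omega, by omega⟩, fun h0 => ⟨by omega, g.skip h0, g'⟩,
          fun h0 => ⟨⟨trivial, trivial, trivial⟩, ⟨trivial, trivial, by omega, by omega⟩, by omega,
            g.next h0, hI.idx.le _ _⟩⟩
      · rintro s2 t2 hF2 ⟨g, g'⟩ ht2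
        simp only [Mem.reg_setReg, Nat.reduceEqDiff, ↓reduceIte, hJ1] at g g' ht2
        have hCnt2 : s2.reg rCnt = s1.reg rCnt := by rw [hF2.reg _ (by decide)]; simp
        have hOk2 : s2.reg rOk = s1.reg rOk := by rw [hF2.reg _ (by decide)]; simp
        have hCls2 : s2.tab tCls = s1.tab tCls := hF2.tab _ (by decide)
        clear hF2
        have hiff : ∀ i, s2.reg rBad = 1 ∧ s2.reg rIdx = i + 1 ↔ D u v = {i} := by
          intro i
          rw [g.iff hk ((hI.row u hu).xor (hI.row v hv)) hI.idx i, Finset.ext_iff]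
          simp only [hD, mem_diffSet, Finset.mem_range, Finset.mem_singleton]
        have hbad := g.1
        have hcn : ((Finset.range v).filter fun v => E u v).card ≤ v :=
          (Finset.card_filter_le _ _).trans (Finset.card_range v).le
        simp only [BinOp.Safe, BinOp.val,
          Mem.reg_setReg, Mem.tab_setReg, Mem.reg_setCell, Nat.reduceEqDiff,
          ↓reduceIte]
        refine ⟨⟨⟨trivial, trivial, by omega, by omega⟩, trivial, trivial, by omega, by omega⟩,
          fun hb => ⟨⟨trivial, by omega⟩, ⟨trivial, by omega⟩, ⟨trivial, trivial, by omega⟩,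
            ⟨trivial, trivial, trivial⟩, ?_, ?_, fun i => ?_, ?_, ?_⟩,
          fun hb => ⟨trivial, ?_, ?_, fun i => ?_, ?_, ?_⟩⟩
        · rw [if_pos hEv]
          omega
        · rw [hcard, if_pos hEv]
          omega
        · have hi := (hiff (s2.reg rIdx - 1)).1 ⟨hb.1, by omega⟩
          rw [hadd', ← h2, hi, hCnt2]
          simp only [Mem.tab_setCell, hCls2, true_and, and_true, hEv, Finset.singleton_inj]
          constructor
          · rintro ⟨c, hc, h⟩
            split_ifs at h with hcc
            · exact .inr h
            · exact .inl ⟨c, by omega, h⟩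
          · rintro (⟨c, hc, h⟩ | h)
            · exact ⟨c, by omega, by rw [if_neg (by omega)]; exact h⟩
            · exact ⟨s1.reg rCnt, by omega, by rw [if_pos rfl]; exact h⟩
        · rw [hOk2]
          exact h3
        · have hi := (hiff (s2.reg rIdx - 1)).1 ⟨hb.1, by omega⟩
          rw [hOk2, h4, hadd]
          simp [hi]
        · rw [if_pos hEv]
          omega
        · rw [hcard, hCnt2]
          omega
        · rw [hadd', ← h2, hCnt2, hCls2]
          refine (or_iff_left ?_).symm
          rintro ⟨-, hi⟩
          have := (hiff i).2 hi
          omega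
        · omega
        · rw [hadd]
          refine iff_of_false (by simp) ?_
          rintro ⟨-, -, h⟩
          obtain ⟨i, hi⟩ := h hEv
          have := (hiff i).2 hi
          omega
    · simp only [Mem.tab_setReg, Mem.reg_setReg, Nat.reduceEqDiff, ↓reduceIte]
      refine ⟨by omega, by rw [hcard]; omega, fun i => ?_, h3, ?_⟩
      · rw [h2, hadd']
        simp [hEv]
      · rw [h4, hadd]
        simp [hEv]
  · rintro s1 t1 hF1 ⟨h1, h2, h3, h4⟩ ht1
    simp only [Mem.reg_setReg, Nat.reduceEqDiff, ↓reduceIte, hN] at h1 h2 h4 ht1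
    refine ⟨?_, h1, fun i => ?_, h3, ?_⟩
    · rw [Finset.sum_add_distrib, Finset.sum_add_distrib, ← Finset.sum_filter, Finset.sum_const,
        Finset.sum_const, Finset.sum_const, Finset.card_range] at ht1
      simp only [smul_eq_mul, Expr.cost] at ht1 ⊢
      rw [Nat.mul_add] at ht1 ⊢
      omega
    · rw [h2]
      exact ⟨fun ⟨x, _, h⟩ => ⟨x, h⟩, fun ⟨x, h⟩ => ⟨x, hE x h.1, h⟩⟩
    · rw [h4]
      exact and_congr_right fun _ => ⟨fun h x hx => h x (hE x hx) hx, fun h x _ => h x⟩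


/-- The bits of the word `acc` are the vertices of block `b` that differ from `u` at one of the
coordinates `cls 0, …, cls (cnt - 1)`. -/
def Collected (n k : ℕ) (L : ℕ → ℕ → Bool) (u : ℕ) (cls : ℕ → ℕ) (cnt b acc : ℕ) : Prop :=
  ∀ j, acc.testBit j = true ↔
    j < k ∧ b * k + j < n ∧ ∃ c < cnt, L u (cls c) ≠ L (b * k + j) (cls c)

theorem Collected.lt {n k : ℕ} {L : ℕ → ℕ → Bool} {u : ℕ} {cls : ℕ → ℕ} {cnt b acc : ℕ}
    (h : Collected n k L u cls cnt b acc) : acc < 2 ^ k := by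
  refine Nat.lt_pow_two_of_testBit _ fun j hj => ?_
  rw [← Bool.not_eq_true, h j]
  omega

/-- The column of coordinate `cls cnt`, complemented if `u` has a `1` there, is joined to the word.
-/
theorem Collected.next {n k : ℕ} {L : ℕ → ℕ → Bool} {u : ℕ} {cls : ℕ → ℕ} {cnt b acc : ℕ}
    (h : Collected n k L u cls cnt b acc) {col : ℕ → ℕ}
    (hc : Packed k n (fun v => L v (cls cnt) = !L u (cls cnt)) col) :
    Collected n k L u cls (cnt + 1) b (acc ||| col b) := by
  intro j
  rw [Nat.testBit_or, Bool.or_eq_true, h j, hc b j]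
  constructor
  · rintro (⟨h1, h2, c, hc, h3⟩ | ⟨h1, h2, h3⟩)
    · exact ⟨h1, h2, c, by omega, h3⟩
    · refine ⟨h1, h2, cnt, by omega, ?_⟩
      rw [h3]
      simp
  · rintro ⟨h1, h2, c, hc, h3⟩
    rcases Nat.lt_succ_iff_lt_or_eq.1 hc with hc | rfl
    · exact .inl ⟨h1, h2, c, hc, h3⟩
    · exact .inr ⟨h1, h2, Bool.eq_not.2 h3.symm⟩

theorem wp_collectProg {w n k d u b cnt : ℕ} {s : Mem} (hk : 1 ≤ k) (hkn : 2 ^ k ≤ n)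
    (hw : n < 2 ^ w) (hdn : d < n) (hU : s.reg rU = u) (hu : u < n) (hB : s.reg rBlk = b)
    (hb : b ≤ n) (hC : s.reg rCnt = cnt) (hcn : cnt ≤ n) (hI : IsPacking n k d s)
    (hcls : ∀ c < cnt, s.tab tCls c 0 < d) :
    wp w collectProg (fun s' t => t ≤ cnt * 60 + 30 ∧
      Collected n k (labels s) u (fun c => s.tab tCls c 0) cnt b (s'.reg rAcc)) s := by
  have hw0 : 1 < 2 ^ w := by
    have := Nat.pow_le_pow_right (n := 2) (by norm_num) hk
    omega
  simp only [collectProg, wp]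
  refine ⟨trivial, ?_⟩
  refine wp_forLoop_const (fun j s' =>
    Collected n k (labels s) u (fun c => s.tab tCls c 0) j b (s'.reg rAcc))
    50 (by decide) (by decide) (by decide) (by simp [hC]; omega) (by intro j; simp) ?_ ?_
  · rintro j hj s1 hF1 hr1 h1
    simp [hC] at hj
    have hU1 : s1.reg rU = u := by rw [hF1.reg _ (by decide)]; simp [hU]
    have hB1 : s1.reg rBlk = b := by rw [hF1.reg _ (by decide)]; simp [hB]
    have hCls1 : s1.tab tCls = s.tab tCls := hF1.tab _ (by decide)
    have hL1 : s1.tab tLabel = s.tab tLabel := hF1.tab _ (by decide)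
    have hO1 : s1.tab tColOne = s.tab tColOne := hF1.tab _ (by decide)
    have hZ1 : s1.tab tColZero = s.tab tColZero := hF1.tab _ (by decide)
    clear hF1
    have hd := hcls j hj
    have hlab := hI.label_le u hu (s.tab tCls j 0)
    have hone := hI.one _ hd
    have hzero := hI.zero _ hd
    simp only [wp, Test.Safe, Expr.Safe, Expr.val, Test.val, BinOp.Safe, BinOp.val, Test.cost,
      Expr.cost, hU1, hB1, hr1, hCls1, hL1, hO1, hZ1, Mem.reg_setReg, Mem.tab_setReg,
      Nat.reduceEqDiff, ↓reduceIte]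
    refine ⟨⟨trivial, trivial, by omega, by omega⟩, ⟨⟨trivial, trivial, by omega, by omega⟩,
      trivial, by omega, by omega⟩, fun hl => ⟨⟨trivial, ⟨trivial, trivial, by omega, by omega⟩,
      trivial⟩, by omega, h1.next ?_⟩, fun hl => ⟨⟨trivial, ⟨trivial, trivial, by omega, by omega⟩,
      trivial⟩, by omega, h1.next ?_⟩⟩
    · exact hzero.congr (fun v _ => by simp [labels, hl]) fun _ => rfl
    · exact hone.congr (fun v _ => by simp [labels, hl]) fun _ => rfl
  · rintro s1 t1 hF1 h1 ht1
    simp only [Mem.reg_setReg, Nat.reduceEqDiff, ↓reduceIte, hC] at h1 ht1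
    refine ⟨?_, h1⟩
    simp only [Expr.cost]
    omega

/-- There are at most `n / k + 1` multiples of `k` below `n`: the steps at the start of a word are
taken for every word once. -/
theorem sum_mod_eq_zero_le {k : ℕ} (hk : 1 ≤ k) (C n : ℕ) :
    (∑ v ∈ Finset.range n, if v % k = 0 then C else 0) ≤ C * (n / k + 1) := by
  suffices h : (∑ v ∈ Finset.range n, if v % k = 0 then C else 0) ≤
      C * (n / k + if n % k = 0 then 0 else 1) by
    refine h.trans (Nat.mul_le_mul_left C ?_)
    split_ifs <;> omega
  induction n with
  | zero => simp
  | succ n ih =>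
    rw [Finset.sum_range_succ]
    rcases succ_div_mod n hk with ⟨h1, h2, h3⟩ | ⟨h1, h2, h3⟩
    · rw [h2, h3, if_pos rfl, Nat.add_zero, Nat.mul_add]
      split_ifs at ih ⊢ <;> simp only [Nat.mul_add] at ih <;> omega
    · rw [h2, h3, if_neg (Nat.succ_ne_zero _), Nat.mul_add]
      split_ifs at ih ⊢ <;> simp only [Nat.mul_add] at ih <;> omega

/-- The word of a block of vertices is computed when the block is entered, in `O(cnt + 1)` steps. -/
theorem wp_towardProg {w n k d u cnt : ℕ} {s : Mem} (hk : 1 ≤ k) (hkn : 2 ^ k ≤ n)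
    (hw : n < 2 ^ w) (hN : s.reg rN = n) (hdn : d < n) (hU : s.reg rU = u) (hu : u < n)
    (hP : s.reg rPow = 2 ^ k) (hC : s.reg rCnt = cnt) (hcn : cnt ≤ n) (hI : IsPacking n k d s)
    (hcls : ∀ c < cnt, s.tab tCls c 0 < d) (hok : s.reg rOk ≤ 1) :
    wp w towardProg (fun s' t => t ≤ 100 * n + (cnt * 60 + 30) * (n / k + 1) + 100 ∧
      s'.reg rOk ≤ 1 ∧ (s'.reg rOk = 1 ↔ s.reg rOk = 1 ∧ ∀ v < n, v ≠ u →
        ∃ c < cnt, labels s u (s.tab tCls c 0) ≠ labels s v (s.tab tCls c 0))) s := by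
  have hw0 : 1 < 2 ^ w := by
    have := Nat.pow_le_pow_right (n := 2) (by norm_num) hk
    omega
  simp only [towardProg, wp]
  refine ⟨trivial, trivial, trivial, ?_⟩
  refine wp_forLoop_sum (fun v s' => s'.reg rMask = 2 ^ (v % k) ∧ s'.reg rBlk = v / k ∧
    s'.reg rAcc < 2 ^ k ∧ (v % k ≠ 0 →
      Collected n k (labels s) u (fun c => s.tab tCls c 0) cnt (v / k) (s'.reg rAcc)) ∧
    s'.reg rOk ≤ 1 ∧ (s'.reg rOk = 1 ↔ s.reg rOk = 1 ∧ ∀ x < v, x ≠ u →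
        ∃ c < cnt, labels s u (s.tab tCls c 0) ≠ labels s x (s.tab tCls c 0)))
    (fun v => 60 + if v % k = 0 then cnt * 60 + 30 else 0)
    (by decide) (by decide) (by decide) (by simpa [hN] using hw) ?_ ?_ ?_
  · simp [hok]
  · rintro v hv s1 hF1 hr1 ⟨h1, h2, h3, h4, h5, h6⟩
    simp [hN] at hv
    have hU1 : s1.reg rU = u := by rw [hF1.reg _ (by decide)]; simp [hU]
    have hP1 : s1.reg rPow = 2 ^ k := by rw [hF1.reg _ (by decide)]; simp [hP]
    have hC1 : s1.reg rCnt = cnt := by rw [hF1.reg _ (by decide)]; simp [hC]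
    have hCls1 : s1.tab tCls = s.tab tCls := hF1.tab _ (by decide)
    have hL1 : s1.tab tLabel = s.tab tLabel := hF1.tab _ (by decide)
    have hI1 : IsPacking n k d s1 := hI.congr hL1 (hF1.tab _ (by decide)) (hF1.tab _ (by decide))
      (hF1.tab _ (by decide)) (hF1.tab _ (by decide))
    have hl1 : labels s1 = labels s := by funext u i; simp only [labels, hL1]
    clear hF1
    obtain ⟨e1, e2, e3⟩ := two_pow_mod_lt (i := v) hk hkn hw
    have hvk := Nat.div_le_self v k
    have hev : v / k * k + v % k = v := (mul_add_eq_iff (Nat.mod_lt v hk)).2 ⟨rfl, rfl⟩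
    -- the state when the word of the current block is available
    have key : ∀ s2 : Mem, s2.reg rU = u → s2.reg rV = v → s2.reg rMask = 2 ^ (v % k) →
        s2.reg rBlk = v / k → s2.reg rPow = 2 ^ k → s2.reg rOk = s1.reg rOk →
        Collected n k (labels s) u (fun c => s.tab tCls c 0) cnt (v / k) (s2.reg rAcc) →
        wp w (.branch (.and (.eq (.op .and (.reg rAcc) (.reg rMask)) (.const 0))
          (.not (.eq (.reg rU) (.reg rV)))) (rOk ≔ .const 0) .nop ;; advanceProg)
          (fun s3 t3 => t3 ≤ 40 ∧ s3.reg rMask = 2 ^ ((v + 1) % k) ∧ s3.reg rBlk = (v + 1) / k ∧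
            s3.reg rAcc < 2 ^ k ∧ ((v + 1) % k ≠ 0 → Collected n k (labels s) u
              (fun c => s.tab tCls c 0) cnt ((v + 1) / k) (s3.reg rAcc)) ∧
            s3.reg rOk ≤ 1 ∧ (s3.reg rOk = 1 ↔ s.reg rOk = 1 ∧ ∀ x < v + 1, x ≠ u →
              ∃ c < cnt, labels s u (s.tab tCls c 0) ≠ labels s x (s.tab tCls c 0))) s2 := by
      intro s2 hU2 hV2 hM2 hB2 hP2 hO2 hA2
      have hbit : s2.reg rAcc &&& 2 ^ (v % k) = 0 ↔
          ¬ ∃ c < cnt, labels s u (s.tab tCls c 0) ≠ labels s v (s.tab tCls c 0) := by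
        have e : (s2.reg rAcc).testBit (v % k) = true ↔ _ := hA2 (v % k)
        rw [hev] at e
        simp only [Nat.mod_lt v hk, hv, true_and] at e
        rw [← e, Nat.and_two_pow]
        cases (s2.reg rAcc).testBit (v % k) <;> simp
      have hadd : (∀ x < v + 1, x ≠ u →
          ∃ c < cnt, labels s u (s.tab tCls c 0) ≠ labels s x (s.tab tCls c 0)) ↔
          (∀ x < v, x ≠ u →
          ∃ c < cnt, labels s u (s.tab tCls c 0) ≠ labels s x (s.tab tCls c 0)) ∧ (v ≠ u →
          ∃ c < cnt, labels s u (s.tab tCls c 0) ≠ labels s v (s.tab tCls c 0)) := by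
        refine ⟨fun h => ⟨fun x hx => h x (by omega), h v (by omega)⟩, fun h x hx => ?_⟩
        rcases Nat.lt_succ_iff_lt_or_eq.1 hx with hx | rfl
        exacts [h.1 x hx, h.2]
      have hlt := hA2.lt
      have hand := Nat.and_le_left (n := s2.reg rAcc) (m := 2 ^ (v % k))
      -- the state after the test
      have key2 : ∀ s3 : Mem, s3.reg rMask = 2 ^ (v % k) → s3.reg rBlk = v / k →
          s3.reg rPow = 2 ^ k → s3.reg rAcc = s2.reg rAcc → s3.reg rOk ≤ 1 →
          (s3.reg rOk = 1 ↔ s.reg rOk = 1 ∧ ∀ x < v + 1, x ≠ u →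
              ∃ c < cnt, labels s u (s.tab tCls c 0) ≠ labels s x (s.tab tCls c 0)) →
          wp w advanceProg (fun s4 t4 => t4 ≤ 20 ∧ s4.reg rMask = 2 ^ ((v + 1) % k) ∧
            s4.reg rBlk = (v + 1) / k ∧
            s4.reg rAcc < 2 ^ k ∧ ((v + 1) % k ≠ 0 → Collected n k (labels s) u
              (fun c => s.tab tCls c 0) cnt ((v + 1) / k) (s4.reg rAcc)) ∧
            s4.reg rOk ≤ 1 ∧ (s4.reg rOk = 1 ↔ s.reg rOk = 1 ∧ ∀ x < v + 1, x ≠ u →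
              ∃ c < cnt, labels s u (s.tab tCls c 0) ≠ labels s x (s.tab tCls c 0))) s3 := by
        intro s3 k1 k2 k3 k4 k5 k6
        refine wp_frame (wp_advanceProg hk hkn hw k1 k2 k3) ?_
        rintro s4 t4 hF4 ⟨ht4, -, hm4, hb4⟩
        have hA4 : s4.reg rAcc = s2.reg rAcc := by rw [hF4.reg _ (by decide)]; exact k4
        have hO4 : s4.reg rOk = s3.reg rOk := hF4.reg _ (by decide)
        rw [hA4, hO4]
        refine ⟨ht4, hm4, hb4, hlt, fun h => ?_, k5, k6⟩
        rcases succ_div_mod v hk with ⟨-, h7, -⟩ | ⟨-, -, h7⟩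
        · exact absurd h7 h
        · rw [h7]; exact hA2
      generalize advanceProg = p at key2 ⊢
      simp only [wp, Test.Safe, Expr.Safe, Expr.val, Test.val, BinOp.Safe, BinOp.val, Test.cost,
        Expr.cost, hU2, hV2, hM2, hbit]
      refine ⟨⟨⟨⟨trivial, trivial, trivial⟩, trivial, by omega, by omega⟩, trivial, trivial,
        by omega, by omega⟩, fun hb => ⟨trivial, ?_⟩, fun hb => ?_⟩
      · refine wp_mono (key2 _ (by simp [hM2]) (by simp [hB2]) (by simp [hP2]) (by simp)
          (by simp) ?_) fun s4 t4 h => ⟨by have := h.1; omega, h.2⟩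
        rw [hadd]
        simp only [Mem.reg_setReg, ↓reduceIte]
        refine iff_of_false (by simp) ?_
        rintro ⟨-, -, h⟩
        exact hb.1 (h fun he => hb.2 he.symm)
      · refine wp_mono (key2 _ hM2 hB2 hP2 rfl (by omega) ?_) fun s4 t4 h =>
          ⟨by have := h.1; omega, h.2⟩
        rw [hadd, hO2, h6]
        refine and_congr_right fun _ => (and_iff_left ?_).symm
        intro hne
        by_contra h
        exact hb ⟨h, fun he => hne he.symm⟩
    have hmask : (2 ^ (v % k) = 1) ↔ v % k = 0 := by
      rw [Nat.pow_eq_one]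
      simp
    generalize (.branch (.and (.eq (.op .and (.reg rAcc) (.reg rMask)) (.const 0))
          (.not (.eq (.reg rU) (.reg rV)))) (rOk ≔ .const 0) .nop : Prog) = p at key ⊢
    simp only [wp] at key
    simp only [wp, Test.Safe, Expr.Safe, Expr.val, Test.val, Test.cost, Expr.cost, h1, hmask]
    refine ⟨⟨trivial, trivial, by omega, by omega⟩, fun h0 => ?_, fun h0 => ?_⟩
    · refine wp_frame (wp_collectProg hk hkn hw hdn hU1 hu h2 (by omega) hC1 hcn hI1
        (by rw [hCls1]; exact hcls)) ?_
      rintro s2 t2 hF2 ⟨ht2, hA2⟩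
      rw [hl1, hCls1] at hA2
      have hM2 : s2.reg rMask = 2 ^ (v % k) := by rw [hF2.reg _ (by decide)]; exact h1
      have hB2 : s2.reg rBlk = v / k := by rw [hF2.reg _ (by decide)]; exact h2
      refine wp_mono (key s2 (by rw [hF2.reg _ (by decide)]; exact hU1)
        (by rw [hF2.reg _ (by decide)]; exact hr1) hM2 hB2
        (by rw [hF2.reg _ (by decide)]; exact hP1) (hF2.reg _ (by decide)) hA2) ?_
      intro s3 t3 h3
      refine wp_mono h3 ?_
      rintro s4 t4 ⟨ht4, h4⟩
      refine ⟨?_, h4⟩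
      rw [if_pos h0]
      omega
    · refine wp_mono (key s1 hU1 hr1 h1 h2 hP1 rfl (h4 h0)) ?_
      intro s3 t3 h3
      refine wp_mono h3 ?_
      rintro s4 t4 ⟨ht4, h4⟩
      refine ⟨?_, h4⟩
      rw [if_neg h0]
      omega
  · rintro s1 t1 hF1 ⟨-, -, -, -, h5, h6⟩ ht1
    simp only [Mem.reg_setReg, Nat.reduceEqDiff, ↓reduceIte, hN] at h6 ht1
    refine ⟨?_, h5, h6⟩
    have := sum_mod_eq_zero_le hk (cnt * 60 + 30) n
    rw [Finset.sum_add_distrib, Finset.sum_add_distrib, Finset.sum_const,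
      Finset.sum_const, Finset.card_range] at ht1
    simp only [smul_eq_mul, Expr.cost] at ht1 ⊢
    omega


open Classical in
/-- The test is exact, also for labels that do not come from a partial cube. Its time is `O(n ^ 2 +
e * (n / k + 1))` for `e` edges, where `e = O(n * k)`. -/
theorem wp_checkProg {w n k d : ℕ} {E : ℕ → ℕ → Prop} {s : Mem} (hk : 1 ≤ k) (hkn : 2 ^ k ≤ n)
    (hw : n < 2 ^ w) (hN : s.reg rN = n) (hdn : d < n) (hP : s.reg rPow = 2 ^ k)
    (hJ : s.reg rNumBlk = d / k + 1) (hI : IsPacking n k d s) (hE : IsGraphOn (Set.Iio n) E)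
    (hA : ∀ u < n, ∀ v < n, s.tab tAdj u v = 1 ↔ E u v) (hA1 : ∀ u v, s.tab tAdj u v ≤ 1)
    (hsum : ∑ u ∈ Finset.range n, ((Finset.range n).filter fun v => E u v).card ≤
      (2 * k + 1) * n) :
    wp w checkProg (fun s' t => t ≤ 2000 * n ^ 2 + 100 ∧ s'.reg rOk ≤ 1 ∧
      (s'.reg rOk = 1 ↔ CubeLabeling (Set.Iio n) E (Finset.range d) (labels s))) s := by
  set deg : ℕ → ℕ := fun u => ((Finset.range n).filter fun v => E u v).card with hdeg
  set D := diffSet (Finset.range d) (labels s) with hD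
  have hdegn : ∀ u, deg u ≤ n := fun u => (Finset.card_filter_le _ _).trans (Finset.card_range n).le
  simp only [checkProg, wp]
  refine ⟨trivial, ?_⟩
  refine wp_forLoop_sum (fun u s' => s'.reg rOk ≤ 1 ∧ (s'.reg rOk = 1 ↔ ∀ x < u,
      (∀ v, E x v → ∃ i, D x v = {i}) ∧
      ∀ v < n, v ≠ x → ∃ y i, E x y ∧ D x y = {i} ∧ i ∈ D x v))
    (fun u => 250 * n + deg u * (100 + 50 * (d / k + 1)) + (deg u * 60 + 30) * (n / k + 1) + 200)
    (by decide) (by decide) (by decide) (by simpa [hN] using hw) (by simp) ?_ ?_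
  · rintro u hu s1 hF1 hr1 ⟨h1, h2⟩
    simp [hN] at hu
    have hN1 : s1.reg rN = n := by rw [hF1.reg _ (by decide)]; simp [hN]
    have hP1 : s1.reg rPow = 2 ^ k := by rw [hF1.reg _ (by decide)]; simp [hP]
    have hJ1 : s1.reg rNumBlk = d / k + 1 := by rw [hF1.reg _ (by decide)]; simp [hJ]
    have hA' : s1.tab tAdj = s.tab tAdj := hF1.tab _ (by decide)
    have hL1 : s1.tab tLabel = s.tab tLabel := hF1.tab _ (by decide)
    have hI1 : IsPacking n k d s1 := hI.congr hL1 (hF1.tab _ (by decide)) (hF1.tab _ (by decide))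
      (hF1.tab _ (by decide)) (hF1.tab _ (by decide))
    have hl1 : labels s1 = labels s := by funext u i; simp only [labels, hL1]
    clear hF1
    simp only [wp]
    refine wp_frame (wp_flipProg (E := E) hk hkn hw hN1 hdn hr1 hu hJ1 hI1 (by rw [hA']; exact hA u hu)
      (by rw [hA']; exact hA1 u) fun v hv => hE.right_mem hv) ?_
    rintro s2 t2 hF2 ⟨ht2, hc2, hcls2, ho2, ho2'⟩
    have hN2 : s2.reg rN = n := by rw [hF2.reg _ (by decide)]; exact hN1
    have hP2 : s2.reg rPow = 2 ^ k := by rw [hF2.reg _ (by decide)]; exact hP1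
    have hU2 : s2.reg rU = u := by rw [hF2.reg _ (by decide)]; exact hr1
    have hL2 : s2.tab tLabel = s1.tab tLabel := hF2.tab _ (by decide)
    have hI2 : IsPacking n k d s2 := hI1.congr hL2 (hF2.tab _ (by decide)) (hF2.tab _ (by decide))
      (hF2.tab _ (by decide)) (hF2.tab _ (by decide))
    have hl2 : labels s2 = labels s := by rw [← hl1]; funext u i; simp only [labels, hL2]
    clear hF2
    rw [hl1, ← hD] at hcls2 ho2'
    rw [max_eq_left h1] at ho2
    have hclsd : ∀ c < s2.reg rCnt, s2.tab tCls c 0 < d := by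
      intro c hc
      obtain ⟨v, -, hv⟩ := (hcls2 _).1 ⟨c, hc, rfl⟩
      have : s2.tab tCls c 0 ∈ D u v := by rw [hv]; simp
      exact Finset.mem_range.1 (mem_diffSet.1 this).1
    refine wp_mono (wp_towardProg hk hkn hw hN2 hdn hU2 hu hP2 rfl (hc2.trans (hdegn u)) hI2 hclsd
      ho2) ?_
    rintro s3 t3 ⟨ht3, ho3, ho3'⟩
    rw [hl2] at ho3'
    have hsame : ∀ v, (∃ c < s2.reg rCnt, labels s u (s2.tab tCls c 0) ≠
        labels s v (s2.tab tCls c 0)) ↔ ∃ y i, E u y ∧ D u y = {i} ∧ i ∈ D u v := by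
      intro v
      constructor
      · rintro ⟨c, hc, h⟩
        obtain ⟨y, h3, h4⟩ := (hcls2 _).1 ⟨c, hc, rfl⟩
        exact ⟨y, _, h3, h4, mem_diffSet.2 ⟨Finset.mem_range.2 (hclsd c hc), h⟩⟩
      · rintro ⟨y, i, h3, h4, h5⟩
        obtain ⟨c, hc, rfl⟩ := (hcls2 i).2 ⟨y, h3, h4⟩
        exact ⟨c, hc, (mem_diffSet.1 h5).2⟩
    refine ⟨?_, ho3, ?_⟩
    · have := Nat.mul_le_mul_right (n / k + 1) (Nat.add_le_add_right (Nat.mul_le_mul_right 60 hc2) 30)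
      change t2 ≤ 100 * n + deg u * _ + _ at ht2
      change _ ≤ (deg u * 60 + 30) * _ at this
      omega
    · simp only [Mem.reg_setReg, Nat.reduceEqDiff, ↓reduceIte]
      rw [ho3', ho2', h2]
      simp only [hsame]
      constructor
      · rintro ⟨⟨h3, h4⟩, h5⟩ x hx
        rcases Nat.lt_succ_iff_lt_or_eq.1 hx with hx | rfl
        exacts [h3 x hx, ⟨h4, h5⟩]
      · exact fun h => ⟨⟨fun x hx => h x (by omega), (h u (by omega)).1⟩, (h u (by omega)).2⟩
  · rintro s1 t1 hF1 ⟨h1, h2⟩ ht1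
    simp only [Mem.reg_setReg, Nat.reduceEqDiff, ↓reduceIte, hN] at h2 ht1
    refine ⟨?_, h1, ?_⟩
    · rw [Finset.sum_add_distrib, Finset.sum_add_distrib, Finset.sum_add_distrib,
        Finset.sum_add_distrib, ← Finset.sum_mul, ← Finset.sum_mul, ← Finset.sum_mul,
        Finset.sum_add_distrib, ← Finset.sum_mul] at ht1
      simp only [Finset.sum_const, Finset.card_range, smul_eq_mul] at ht1
      simp only [Expr.cost]
      set S := ∑ u ∈ Finset.range n, deg u
      have hkn' : k ≤ n := by
        have := Nat.lt_two_pow_self (n := k)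
        omega
      -- `O(n * k)` edges with `O(n / k + 1)` steps each
      have e1 : S ≤ 3 * n * k := by nlinarith
      have e2 : k * (n / k) ≤ n := Nat.mul_div_le n k
      have e3 : d / k ≤ n / k := Nat.div_le_div_right hdn.le
      have e4 : S * (n / k) ≤ 3 * n ^ 2 := by
        calc S * (n / k) ≤ 3 * n * k * (n / k) := Nat.mul_le_mul_right _ e1
          _ = 3 * n * (k * (n / k)) := by ring
          _ ≤ 3 * n * n := Nat.mul_le_mul_left _ e2
          _ = 3 * n ^ 2 := by ring
      have e5 : S * (d / k) ≤ S * (n / k) := Nat.mul_le_mul_left _ e3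
      have e6 : S ≤ 3 * n ^ 2 := by
        calc S ≤ 3 * n * k := e1
          _ ≤ 3 * n * n := Nat.mul_le_mul_left _ hkn'
          _ = 3 * n ^ 2 := by ring
      have e7 : n * (n / k) ≤ n ^ 2 := by
        rw [pow_two]
        exact Nat.mul_le_mul_left _ (Nat.div_le_self n k)
      have e8 : n ≤ n ^ 2 := Nat.le_self_pow (by norm_num) n
      have e9 : S * (100 + 50 * (d / k + 1)) = 150 * S + 50 * (S * (d / k)) := by ring
      have e10 : (S * 60 + n * 30) * (n / k + 1) =
        60 * (S * (n / k)) + 60 * S + 30 * (n * (n / k)) + 30 * n := by ring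
      have e11 : n * 250 * n = 250 * n ^ 2 := by ring
      rw [e9, e10, e11] at ht1
      omega
    · rw [h2]
      constructor
      · intro h
        refine ⟨fun u v huv => (h u (hE.left_mem huv)).1 v huv, fun u v hu hv huv => ?_⟩
        exact (h u hu).2 v hv huv.symm
      · exact fun h x hx => ⟨fun v hv => h.flip hv, fun v hv hne => h.toward hx hv hne.symm⟩

end WordRAM

/-! ### Recognition of partial cubes -/

namespace WordRAM

open Classical in
/-- The length of the list of neighbors is the degree. -/
theorem _root_.IsNbList.card_eq {E : ℕ → ℕ → Prop} {v n : ℕ} {nb : ℕ → ℕ} {m : ℕ}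
    (h : IsNbList E v nb m) (hE : ∀ y, E v y → y < n) :
    m = ((Finset.range n).filter fun y => E v y).card := by
  have : ((Finset.range n).filter fun y => E v y) = (Finset.range m).image nb := by
    ext y
    simp only [Finset.mem_filter, Finset.mem_range, Finset.mem_image, ← h.adj_iff]
    exact ⟨fun h => h.2, fun h => ⟨hE y h, h⟩⟩
  rw [this, Finset.card_image_of_injOn, Finset.card_range]
  intro i hi j hj
  simp only [Finset.coe_range, Set.mem_Iio] at hi hj
  exact h.inj i hi j hj

open Classical in
/-- A partial cube with `n` vertices has at most `n * log₂ n` edges. -/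
theorem sum_card_adj_le {n : ℕ} {E : ℕ → ℕ → Prop} {S : Finset ℕ} {l : ℕ → ℕ → Bool}
    (h : CubeLabeling (Set.Iio n) E S l) :
    ∑ u ∈ Finset.range n, ((Finset.range n).filter fun v => E u v).card ≤
      2 * (n * Nat.log 2 n) := by
  have h1 := card_pairs_diffSet_card_eq_one_le S l (Finset.range n) fun u hu v hv =>
    h.eq_of_diffSet_eq_empty (Finset.mem_range.1 hu) (Finset.mem_range.1 hv)
  rw [Finset.card_range] at h1
  refine le_trans (le_of_eq_of_le ?_ (Finset.card_le_card (s := ((Finset.range n).sigma fun u =>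
    (Finset.range n).filter fun v => E u v).map
      (Equiv.sigmaEquivProd ℕ ℕ).toEmbedding) fun p hp => ?_)) h1
  · rw [Finset.card_map, Finset.card_sigma]
  · obtain ⟨⟨u, v⟩, hq, rfl⟩ := Finset.mem_map.1 hp
    simp only [Finset.mem_sigma, Finset.mem_filter, Finset.mem_range] at hq
    obtain ⟨i, hi⟩ := h.flip hq.2.2
    simp [hq.1, hq.2.1, hi]

open Classical in
/-- The memory with the input graph `G`. -/
noncomputable def inputMem {n : ℕ} (G : SimpleGraph (Fin n)) : Mem where
  reg r := if r = 0 then n else 0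
  tab T u v := if T = tAdj ∧ natAdj G u v then 1 else 0

theorem toState_inputMem {w n : ℕ} (G : SimpleGraph (Fin n)) [DecidableRel G.Adj] :
    (inputMem G).toState w = inputState w G := by
  ext : 1
  · funext r
    simp only [Mem.toState, inputMem, inputState]
    split_ifs <;> rfl
  · funext T i j
    have : (∃ u v : Fin n, G.Adj u v ∧ i.toNat = u ∧ j.toNat = v) ↔ natAdj G i.toNat j.toNat := by
      constructor
      · rintro ⟨u, v, h, hi, hj⟩
        rw [hi, hj]
        exact natAdj_coe.2 h
      · rintro ⟨hu, hv, h⟩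
        exact ⟨_, _, h, rfl, rfl⟩
    have h := and_congr_right (a := T = tAdj) fun _ => this
    simp only [Mem.toState, inputMem, inputState]
    by_cases hc : T = tAdj ∧ natAdj G i.toNat j.toNat
    · rw [if_pos hc, if_pos (h.2 hc)]
      rfl
    · rw [if_neg hc, if_neg (mt h.1 hc)]
      rfl

open Classical in
/-- For `n ≥ 2`, so that `k = log₂ n` is positive. A graph of which the sum of the degrees is at
least `(2 * k + 1) * n` is rejected, and the condition `IsPartialCube G` provides the labeling for
the analysis of the phases. -/
theorem wp_largeProg {w n : ℕ} (G : SimpleGraph (Fin n)) (hw : n < 2 ^ w) (hn : 2 ≤ n) :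
    wp w largeProg (fun s' t => t ≤ 6000 * n ^ 2 + 1000 ∧
      (IsPartialCube G → s'.reg 0 = 1 ∧ s'.reg rD < n ∧
        (∀ u < n, ∀ i, s'.tab tLabel u i ≤ 1) ∧
        CubeLabeling (Set.Iio n) (natAdj G) (Finset.range (s'.reg rD)) (labels s')) ∧
      (¬ IsPartialCube G → s'.reg 0 = 0)) (inputMem G) := by
  set s := inputMem G with hs
  set E := natAdj G with hEd
  have hE : IsGraphOn (Set.Iio n) E := isGraphOn_natAdj G
  -- a labeling that is arbitrary if `G` is not a partial cube
  obtain ⟨S, l, hSl⟩ : ∃ (S : Finset ℕ) (l : ℕ → ℕ → Bool), IsPartialCube G →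
      CubeLabeling (Set.Iio n) E S l := by
    by_cases h : IsPartialCube G
    · obtain ⟨d, label, h⟩ := h
      obtain ⟨l, h⟩ := h.cubeLabeling
      exact ⟨_, l, fun _ => h⟩
    · exact ⟨∅, fun _ _ => false, fun h' => absurd h' h⟩
  have hA : ∀ u < n, ∀ v < n, s.tab tAdj u v = 1 ↔ E u v := by
    intro u _ v _
    simp [hs, inputMem, hEd]
  have hA1 : ∀ u v, s.tab tAdj u v ≤ 1 := by
    intro u v
    simp only [hs, inputMem]
    split_ifs <;> omega
  have htab : ∀ T ≠ 0, ∀ i j, s.tab T i j = 0 := by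
    intro T hT i j
    simp [hs, inputMem, hT]
  simp only [largeProg, wp]
  refine ⟨trivial, ?_⟩
  have hN0 : (s.setReg rN ((Expr.reg 0).val s)).reg rN = n := by simp [hs, inputMem]
  have htab0 : (s.setReg rN ((Expr.reg 0).val s)).tab = s.tab := rfl
  generalize s.setReg rN ((Expr.reg 0).val s) = s0 at hN0 htab0 ⊢
  refine wp_frame (wp_sizeProg (by omega) hw hN0) ?_
  rintro s1 t1 hF1 ⟨ht1, hPow1, hkn, hnk⟩
  have hN1 : s1.reg rN = n := by rw [hF1.reg _ (by decide)]; exact hN0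
  have htab1 : s1.tab = s.tab := by
    rw [← htab0]
    funext T
    exact hF1.tab _ (by simp [sizeProg, Prog.forLoop, Prog.tabs])
  clear hF1
  set k := s1.reg rLog with hkd
  have hk : 1 ≤ k := by
    by_contra h
    have : k = 0 := by omega
    rw [this] at hnk
    omega
  have hlog : Nat.log 2 n = k := (Nat.log_eq_iff (by omega)).2 ⟨hkn, hnk⟩
  refine wp_frame (wp_listProg (E := E) (by omega) hw hN1 hE (by rw [htab1]; exact hA)
    (by rw [htab1]; exact hA1) (by rw [htab1]; exact fun u _ => htab _ (by decide) _ _)) ?_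
  rintro s2 t2 hF2 ⟨ht2, hl2, hrep2, hrem, hquo⟩
  have hN2 : s2.reg rN = n := by rw [hF2.reg _ (by decide)]; exact hN1
  have hPow2 : s2.reg rPow = 2 ^ k := by rw [hF2.reg _ (by decide)]; exact hPow1
  have hLog2 : s2.reg rLog = k := hF2.reg _ (by decide)
  have htab2 : ∀ T, T ∉ listProg.tabs → s2.tab T = s.tab T := fun T hT => by
    rw [hF2.tab _ hT, htab1]
  clear hF2
  have hdeg2 : ∑ u ∈ Finset.range n, s2.tab tDeg u 0 =
      ∑ u ∈ Finset.range n, ((Finset.range n).filter fun v => E u v).card :=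
    Finset.sum_congr rfl fun u hu =>
      (hl2 u (Finset.mem_range.1 hu)).card_eq fun y hy => hE.right_mem hy
  have hquon : s2.reg rQuo ≤ n := by
    have h1 : ∑ u ∈ Finset.range n, s2.tab tDeg u 0 ≤ n * n := by
      refine (Finset.sum_le_card_nsmul _ _ n fun u hu =>
        (hl2 u (Finset.mem_range.1 hu)).le fun y hy => hE.right_mem hy).trans ?_
      simp
    exact Nat.le_of_mul_le_mul_right (by omega) (by omega : 0 < n)
  have hkk : k + k ≤ n := by
    have h1 : k - 1 < 2 ^ (k - 1) := Nat.lt_two_pow_self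
    have h2 : 2 ^ k = 2 * 2 ^ (k - 1) := by rw [← pow_succ', Nat.sub_add_cancel hk]
    omega
  have hn2 : n ≤ n ^ 2 := Nat.le_self_pow (by norm_num) n
  simp only [Test.Safe, Expr.Safe, Expr.val, Test.val, BinOp.Safe, BinOp.val, Test.cost,
    Expr.cost, hLog2]
  refine ⟨⟨⟨trivial, trivial, trivial⟩, trivial, by omega, by omega⟩, fun hlt => ⟨trivial, ?_, ?_, ?_⟩,
    fun hge => ?_⟩
  · omega
  · intro hpc
    have h1 := sum_card_adj_le (hSl hpc)
    rw [hlog, ← hdeg2, ← hquo] at h1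
    have h2 : (2 * k + 1) * n ≤ s2.reg rQuo * n := Nat.mul_le_mul_right _ (by omega)
    have h3 : (2 * k + 1) * n = 2 * (n * k) + n := by ring
    omega
  · intro _
    simp
  have hsum : ∑ u ∈ Finset.range n, s2.tab tDeg u 0 ≤ (2 * k + 1) * n := by
    have h2 : s2.reg rQuo * n ≤ 2 * k * n := Nat.mul_le_mul_right _ (by omega)
    have h3 : (2 * k + 1) * n = 2 * k * n + n := by ring
    omega
  refine wp_frame (wp_labelProg hw hk hkn hE hSl hN2 hPow2 hl2 hrep2 hsum ?_ ?_ ?_) ?_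
  · intro a _ b _
    rw [htab2 _ (by decide)]
    exact htab _ (by decide) _ _
  · intro a _
    rw [htab2 _ (by decide)]
    exact htab _ (by decide) _ _
  · intro u _ i
    rw [htab2 _ (by decide)]
    exact htab _ (by decide) _ _
  rintro s3 t3 hF3 ⟨ht3, hd3, hL3, hcube⟩
  have hN3 : s3.reg rN = n := by rw [hF3.reg _ (by decide)]; exact hN2
  have hPow3 : s3.reg rPow = 2 ^ k := by rw [hF3.reg _ (by decide)]; exact hPow2
  have htab3 : ∀ T, T ∉ listProg.tabs → T ∉ labelProg.tabs → s3.tab T = s.tab T := fun T hT hT' =>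
    by rw [hF3.tab _ hT', htab2 T hT]
  clear hF3
  refine wp_frame (wp_packRowsProg hk hkn hw hN3 rfl hd3 hPow3 hL3 ?_ ?_) ?_
  · intro u b
    rw [htab3 _ (by decide) (by decide)]
    exact htab _ (by decide) _ _
  · intro b m
    rw [htab3 _ (by decide) (by decide)]
    exact htab _ (by decide) _ _
  rintro s4 t4 hF4 ⟨ht4, hrow4, hidx4, hJ4⟩
  have hN4 : s4.reg rN = n := by rw [hF4.reg _ (by decide)]; exact hN3
  have hD4 : s4.reg rD = s3.reg rD := hF4.reg _ (by decide)
  have hPow4 : s4.reg rPow = 2 ^ k := by rw [hF4.reg _ (by decide)]; exact hPow3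
  have hL4 : s4.tab tLabel = s3.tab tLabel := hF4.tab _ (by decide)
  have hA4 : s4.tab tAdj = s.tab tAdj := by
    rw [hF4.tab _ (by decide)]; exact htab3 _ (by decide) (by decide)
  have hO4 : s4.tab tColOne = s.tab tColOne := by
    rw [hF4.tab _ (by decide)]; exact htab3 _ (by decide) (by decide)
  have hZ4 : s4.tab tColZero = s.tab tColZero := by
    rw [hF4.tab _ (by decide)]; exact htab3 _ (by decide) (by decide)
  clear hF4
  have hl4 : labels s4 = labels s3 := by funext u i; simp only [labels, hL4]
  refine wp_frame (wp_packColsProg hk hkn hw hN4 hD4 hd3 hPow4 (by rw [hL4]; exact hL3)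
    (by rw [hO4]; exact fun i b => htab _ (by decide) _ _)
    (by rw [hZ4]; exact fun i b => htab _ (by decide) _ _)) ?_
  rintro s5 t5 hF5 ⟨ht5, hcol5⟩
  have hN5 : s5.reg rN = n := by rw [hF5.reg _ (by decide)]; exact hN4
  have hD5 : s5.reg rD = s3.reg rD := by rw [hF5.reg _ (by decide)]; exact hD4
  have hPow5 : s5.reg rPow = 2 ^ k := by rw [hF5.reg _ (by decide)]; exact hPow4
  have hJ5 : s5.reg rNumBlk = s3.reg rD / k + 1 := by rw [hF5.reg _ (by decide)]; exact hJ4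
  have hL5 : s5.tab tLabel = s3.tab tLabel := by rw [hF5.tab _ (by decide)]; exact hL4
  have hA5 : s5.tab tAdj = s.tab tAdj := by rw [hF5.tab _ (by decide)]; exact hA4
  have hR5 : s5.tab tRow = s4.tab tRow := hF5.tab _ (by decide)
  have hI5 : s5.tab tIdx = s4.tab tIdx := hF5.tab _ (by decide)
  clear hF5
  have hl5 : labels s5 = labels s3 := by funext u i; simp only [labels, hL5]
  have hpack : IsPacking n k (s3.reg rD) s5 := by
    refine ⟨by rw [hL5]; exact hL3, ?_, ?_, ?_, ?_⟩
    · rw [hl5, hR5]; exact hrow4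
    · unfold IsIdx; rw [hI5]; exact hidx4
    · rw [hl5, ← hl4]; exact fun i hi => (hcol5 i hi).1
    · rw [hl5, ← hl4]; exact fun i hi => (hcol5 i hi).2
  refine wp_frame (wp_checkProg (E := E) hk hkn hw hN5 hd3 hPow5 hJ5 hpack hE (by rw [hA5]; exact hA)
    (by rw [hA5]; exact hA1) (by rw [← hdeg2]; exact hsum)) ?_
  rintro s6 t6 hF6 ⟨ht6, hok6, hok6'⟩
  have hD6 : s6.reg rD = s3.reg rD := by rw [hF6.reg _ (by decide)]; exact hD5
  have hL6 : s6.tab tLabel = s3.tab tLabel := by rw [hF6.tab _ (by decide)]; exact hL5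
  clear hF6
  have hl6 : labels (s6.setReg 0 (s6.reg rOk)) = labels s3 := by
    funext u i; simp only [labels, Mem.tab_setReg, hL6]
  rw [hl5] at hok6'
  refine ⟨trivial, ?_, fun hpc => ⟨?_, ?_, ?_, ?_⟩, fun hpc => ?_⟩
  · omega
  · exact hok6'.2 (hcube hpc)
  · simpa [hD6] using hd3
  · simpa [hL6] using hL3
  · rw [hl6]
    simpa [hD6] using hcube hpc
  · have h1 : s6.reg rOk ≠ 1 := fun h => hpc ⟨_, _, (hok6'.1 h).isPartialCubeLabeling⟩
    simp only [Mem.reg_setReg, ↓reduceIte]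
    omega

/-- A graph with at most one vertex is a partial cube with labels of length `0`, which the initial
memory contains already. -/
theorem wp_partialCubeProg {w n : ℕ} (G : SimpleGraph (Fin n)) (hw0 : 0 < w) (hw : n < 2 ^ w) :
    wp w partialCubeProg (fun s' t => t ≤ 8000 * (n ^ 2 + 1) ∧
      (IsPartialCube G → s'.reg 0 = 1 ∧ s'.reg rD ≤ n ∧
        (∀ u < n, ∀ i, s'.tab tLabel u i ≤ 1) ∧
        IsPartialCubeLabeling G fun (v : Fin n) (i : Fin (s'.reg rD)) => labels s' v i) ∧
      (¬ IsPartialCube G → s'.reg 0 = 0)) (inputMem G) := by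
  have h1w : 1 < 2 ^ w := Nat.one_lt_two_pow hw0.ne'
  have h0 : (inputMem G).reg 0 = n := by simp [inputMem]
  simp only [partialCubeProg, wp, Test.Safe, Expr.Safe, Expr.val, Test.val, Test.cost, Expr.cost,
    h0]
  refine ⟨⟨⟨trivial, trivial, by omega, by omega⟩, trivial, trivial, by omega, by omega⟩,
    fun hn => ?_, fun hn => ⟨trivial, by omega, fun _ => ⟨by simp, ?_, ?_, ?_⟩, fun h => ?_⟩⟩
  · refine wp_mono (wp_largeProg G hw (by omega)) ?_
    rintro s' t ⟨h1, h2, h3⟩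
    refine ⟨by omega, fun h => ?_, h3⟩
    obtain ⟨h4, h5, h6, h7⟩ := h2 h
    exact ⟨h4, h5.le, h6, h7.isPartialCubeLabeling⟩
  · simp [inputMem]
  · simp [inputMem]
  · have : Subsingleton (Fin n) := Fin.subsingleton_iff_le_one.2 (by omega)
    intro u v
    rw [Subsingleton.elim u v, SimpleGraph.edist_self, hammingDist_self]
    rfl
  · refine absurd ⟨0, fun _ _ => false, fun u v => ?_⟩ h
    have : Subsingleton (Fin n) := Fin.subsingleton_iff_le_one.2 (by omega)
    rw [Subsingleton.elim u v]
    simp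

end WordRAM

theorem mainTheorem1 :
    ∃ (P : WordRAM.Prog) (C : ℕ),
      ∀ (n : ℕ) (G : SimpleGraph (Fin n)) [DecidableRel G.Adj] (w : ℕ), 0 < w → n < 2 ^ w →
        ∃ (τ : WordRAM.State w) (t : ℕ),
          WordRAM.Runs P (WordRAM.inputState w G) τ t ∧ t ≤ C * (n ^ 2 + 1) ∧
          (IsPartialCube G → τ.reg 0 = 1 ∧ WordRAM.OutputsLabeling G τ) ∧
          (¬ IsPartialCube G → τ.reg 0 = 0) := by
  refine ⟨WordRAM.partialCubeProg, 8000, fun n G _ w hw0 hw => ?_⟩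
  obtain ⟨s', t, hR, h1, h2, h3⟩ := WordRAM.wp_runs (WordRAM.wp_partialCubeProg G hw0 hw)
  rw [WordRAM.toState_inputMem] at hR
  refine ⟨s'.toState w, t, hR, h1, fun h => ?_, fun h => ?_⟩
  · obtain ⟨h4, h5, h6, h7⟩ := h2 h
    have hd : ((s'.toState w).reg 1).toNat = s'.reg 1 := by
      simp only [WordRAM.Mem.toState, BitVec.toNat_ofNat]
      exact Nat.mod_eq_of_lt (by omega)
    refine ⟨?_, fun v i => WordRAM.labels s' v i, ?_, fun v i => ?_⟩
    · simp only [WordRAM.Mem.toState, h4]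
      rfl
    · rw [← hd] at h7
      exact h7
    · have hi : (i : ℕ) < s'.reg 1 := hd ▸ i.2
      have := h6 v v.2 i
      simp only [WordRAM.Mem.toState, BitVec.toNat_ofNat, WordRAM.labels]
      rw [Nat.mod_eq_of_lt (by omega), Nat.mod_eq_of_lt (by omega)]
      by_cases hl : s'.tab 1 v i = 1
      · simp [hl]
      · have : s'.tab 1 v i = 0 := by omega
        simp [this]
  · simp only [WordRAM.Mem.toState, h3 h]
    rfl
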